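/- For an integrable odd function $g:\mathbb R\to\mathbb C$ put $\widehat{g_s}(x)=\int_0^\infty g(t)\sin(xt)\,dt$ and $\mathcal T_g(x)=\widehat{g_s}(x)/x$ for $x>0$. For a function $h$ on $\mathbb R_+=(0,\infty)$ let $$\mathcal H_0h(x)=\frac2\pi\lim_{\delta\to0+}\int_{t>0,\ |t-x|>\delta}\frac{t\,h(t)}{t^2-x^2}\,dt\qquad(x>0)$$ be its odd Hilbert transform (principal value); $\mathcal H_0h$ is called integrable if this limit exists for almost every $x>0$ and defines a function in $L^1(\mathbb R_+)$, and otherwise $\|\mathcal H_0h\|_{L^1(\mathbb R_+)}=\infty$. Put $\|g\|_{H^1_0(\mathbb R_+)}=\|g\|_{L^1(\mathbb R_+)}+\|\mathcal H_0g\|_{L^1(\mathbb R_+)}$, and define the following spaces of odd functions $g\in L^1(\mathbb R)$: $H^1_0(\mathbb R_+)$, those with $\mathcal H_0g$ integrable; $Q_0$, those with $\int_0^\infty|\widehat{g_s}(x)|\,x^{-1}\,dx<\infty$; $H^1_Q(\mathbb R_+)$, those $g\in Q_0$ with $\mathcal H_0\mathcal T_g$ integrable; $L^1_0(\mathbb R_+)$,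 those with $\int_{\mathbb R}g(t)\,dt=0$. Then there is an absolute constant $C>0$ such that, for every integrable odd function $g$, $$\|\mathcal H_0\mathcal T_g\|_{L^1(\mathbb R_+)}\le C\,\|g\|_{H^1_0(\mathbb R_+)}$$ (the right-hand side may be infinite). Consequently, $$H^1_0(\mathbb R_+)\subseteq H^1_Q(\mathbb R_+)\subseteq Q_0\subseteq L^1_0(\mathbb R_+).$$ -/

import Mathlib

open MeasureTheory Filter Set Topology
open scoped ENNReal

noncomputable section

namespace HardyType

/-- Oddness of a function on the line, almost everywhere (functions in `L¹` are only
determined almost everywhere). -/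
def IsOdd (g : ℝ → ℂ) : Prop := ∀ᵐ t : ℝ, g (-t) = -g t

/-- The truncated odd Hilbert transform
`(2/π) ∫_{t > 0, |t - x| > δ} t g(t) / (t² - x²) dt`. -/
def truncH (g : ℝ → ℂ) (x δ : ℝ) : ℂ :=
  ((2 / Real.pi : ℝ) : ℂ) *
    ∫ t in {t : ℝ | 0 < t ∧ δ < |t - x|}, ((t / (t ^ 2 - x ^ 2) : ℝ) : ℂ) * g t

/-- The odd Hilbert transform `𝓗₀ g (x)`: the principal value, that is the limit of the
truncated transforms as `δ → 0+`. It is meaningful at the points where this limit exists. -/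
def hilbertOdd (g : ℝ → ℂ) (x : ℝ) : ℂ :=
  limUnder (𝓝[>] (0 : ℝ)) (fun δ => truncH g x δ)

/-- The principal value defining `𝓗₀ g (x)` exists for almost every `x > 0`. -/
def HilbertOddExists (g : ℝ → ℂ) : Prop :=
  ∀ᵐ x ∂(volume.restrict (Ioi (0 : ℝ))),
    ∃ c : ℂ, Tendsto (fun δ => truncH g x δ) (𝓝[>] (0 : ℝ)) (𝓝 c)

/-- `𝓗₀ g` is defined almost everywhere on `(0, ∞)` and integrable there. -/
def HilbertOddIntegrable (g : ℝ → ℂ) : Prop :=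
  HilbertOddExists g ∧ IntegrableOn (hilbertOdd g) (Ioi 0)

open Classical in
/-- The norm of `𝓗₀ g` in `L¹(0, ∞)`, an extended number. It is `∞` if `𝓗₀ g` fails to be
defined almost everywhere. -/
def hilbertOddNorm (g : ℝ → ℂ) : ℝ≥0∞ :=
  if HilbertOddExists g then ∫⁻ x in Ioi (0 : ℝ), ‖hilbertOdd g x‖ₑ else ∞

/-- The norm `‖g‖_{L¹(0,∞)} + ‖𝓗₀ g‖_{L¹(0,∞)}` of `H¹₀`; it is `∞` outside `H¹₀`. -/
def hardyOddNorm (g : ℝ → ℂ) : ℝ≥0∞ :=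
  (∫⁻ t in Ioi (0 : ℝ), ‖g t‖ₑ) + hilbertOddNorm g

/-- The sine Fourier transform `∫_0^∞ g(t) sin(xt) dt`. -/
def sineTransform (g : ℝ → ℂ) (x : ℝ) : ℂ :=
  ∫ t in Ioi (0 : ℝ), g t * ((Real.sin (x * t) : ℝ) : ℂ)

/-- `𝓣_g (x)`, the sine Fourier transform of `g` at `x` divided by `x`. -/
def sineQuot (g : ℝ → ℂ) (x : ℝ) : ℂ := sineTransform g x / (x : ℂ)

/-- `H¹₀`: odd integrable functions with integrable Hilbert transform. -/
def H10 : Set (ℝ → ℂ) := {g | Integrable g ∧ IsOdd g ∧ HilbertOddIntegrable g}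

/-- `Q₀`: odd integrable functions `g` with `∫_0^∞ |ĝ_s(x)| / x dx < ∞`. -/
def Q0 : Set (ℝ → ℂ) :=
  {g | Integrable g ∧ IsOdd g ∧ ∫⁻ x in Ioi (0 : ℝ), ‖sineQuot g x‖ₑ < ∞}

/-- `H¹_Q`: functions `g` in `Q₀` with integrable `𝓗₀ 𝓣_g`. -/
def H1Q : Set (ℝ → ℂ) := {g | g ∈ Q0 ∧ HilbertOddIntegrable (sineQuot g)}

/-- `L¹₀`: odd integrable functions with the cancellation property `∫_ℝ g = 0`. -/
def L10 : Set (ℝ → ℂ) := {g | Integrable g ∧ IsOdd g ∧ ∫ t : ℝ, g t = 0}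

end HardyType

end

namespace HardyType

/-! ### Hilbert's inequality for finite sums -/

/-! The transform `𝓗₀ 𝓣_g` is an explicit integral operator applied to `g`. In `t 𝓣_g(t) / (t² -
x²)` the factor `t` cancels. Splitting `1 / (t² - x²)` into the singular part `1 / (2x(t - x))` on
`(0, 2x]` and an integrable remainder, then using Fubini, gives `𝓗₀ 𝓣_g(x) = (2/π) x⁻¹ ∫ g(u) k(xu)
du` for every `x > 0`, where `k = compKer` is `cos v · Si(v)` plus the sine transform of the
remainder. With `L = lim Si`, one has `k(v) = O(√v)` at `0` and `k(v) = L cos v + O(1/v)` at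
infinity. Hence `k(v) - L (cos v - e^{-v})` is `O(√v / (1 + v))`, which is integrable against
`dv/v`, and by Tonelli this part costs only a multiple of `‖g‖₁` (`exists_abs_smallKer_le`,
`lintegral_kernel_le`).

What remains is to bound `∫ |∫ g(u) (cos xu - e^{-xu}) du| dx/x`, and here `𝓗₀ g` enters. The tool
is Hardy's inequality `∫_0^∞ |b̂(ξ)| dξ/ξ ≤ 4 ‖b‖₁` for integrable `b` whose Fourier integral
vanishes at all `ξ ≤ 0` (`lintegral_fourierInt_div_le`). For polynomials it follows from a
factorization into two square-integrable analytic factors and Hilbert's inequality; Fejér means of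
samples, followed by Fatou's lemma, carry it to the line.

Suitable `b` are boundary values of Cauchy integrals of `g` in the upper half-plane. The difference
of those along the positive and the negative axis has boundary function `±g - i 𝓗₀g`, which yields
the inequality for the sine transform and hence `H10 ⊆ Q0`. In their sum the Stieltjes transform of
`g` survives and need not be integrable. Subtracting twice the Cauchy integral along the negative
imaginary axis leaves an error with a kernel of Poisson size, bounded on `L¹`, and turns the cosine
transform into `cos - exp` (`lintegral_cosExp_div_le`).

That an integrable boundary function has one-sided spectrum is a theorem of Smirnov type
(`fourierInt_boundary_eq_zero`), needed because Cauchy integrals of `L¹` functions are in general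
not in `H¹`. Functions of nonnegative real part are made bounded by multipliers close to `1`, with
closeness controlled by Kolmogorov's estimate for the square root. Of the remaining inclusions, `H1Q
⊆ Q0` holds by definition and `Q0 ⊆ L10` by oddness. -/

theorem schur_sum_le (k M : ℕ) :
    ∑ l ∈ Finset.range M, √(k + 1 : ℝ) / (√(l + 1 : ℝ) * (k + l + 1)) ≤ 4 := by
  -- The two forms come from comparing the sum with an integral, replacing `k + l + 1` by the lower
  -- bound `k + 1` up to `l = k` and by `l + 1` afterwards. They agree at `M = k + 1`, both being
  -- `2`.
  have key : ∀ M : ℕ, ∑ l ∈ Finset.range M, √(k + 1 : ℝ) / (√(l + 1 : ℝ) * (k + l + 1)) ≤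
      if M ≤ k + 1 then 2 * √(M : ℝ) / √(k + 1 : ℝ) else 4 - 2 * √(k + 1 : ℝ) / √(M : ℝ) := by
    intro M
    set m : ℝ := √(k + 1 : ℝ) with hm
    have hm0 : 0 < m := by positivity
    have hmsq : m ^ 2 = k + 1 := Real.sq_sqrt (by positivity)
    induction M with
    | zero => simp
    | succ l ih =>
      rw [Finset.sum_range_succ]
      set b : ℝ := √(l + 1 : ℝ) with hb
      set a : ℝ := √(l : ℝ) with ha
      have hb0 : 0 < b := by positivity
      have ha0 : 0 ≤ a := by positivity
      have hbsq : b ^ 2 = l + 1 := Real.sq_sqrt (by positivity)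
      have hasq : a ^ 2 = l := Real.sq_sqrt (by positivity)
      have hab : a ≤ b := Real.sqrt_le_sqrt (by linarith)
      have hcast : √((l + 1 : ℕ) : ℝ) = b := by push_cast; rfl
      rw [hcast]
      have hden : (k + l + 1 : ℝ) = m ^ 2 + a ^ 2 := by rw [hmsq, hasq]; ring
      rw [hden]
      have hba : b ^ 2 = a ^ 2 + 1 := by rw [hbsq, hasq]
      by_cases h1 : l + 1 ≤ k + 1
      · rw [if_pos (by omega)] at ih
        rw [if_pos h1]
        -- Telescoping: `1 / b ≤ 2 (b - a)` because `(b - a)(b + a) = 1` and `a ≤ b`.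
        have h2 : m / (b * (m ^ 2 + a ^ 2)) ≤ 2 * (b - a) / m := by
          rw [div_le_div_iff₀ (by positivity) hm0]
          have h3 : 1 ≤ 2 * (b - a) * b := by nlinarith
          have h4 : m * m ≤ m ^ 2 + a ^ 2 := by nlinarith
          nlinarith [mul_le_mul h4 h3 zero_le_one (by positivity : 0 ≤ m ^ 2 + a ^ 2)]
        calc _ ≤ 2 * a / m + 2 * (b - a) / m := add_le_add ih h2
          _ = _ := by ring
      · have hlm : m ≤ a := by
          apply Real.sqrt_le_sqrt
          have : k + 1 ≤ l := by omega
          exact_mod_cast this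
        have ha1 : 0 < a := lt_of_lt_of_le hm0 hlm
        -- Telescoping again: the term is at most `m / b³`, which the increment of `-2m / √l`
        -- dominates.
        have h2 : m / (b * (m ^ 2 + a ^ 2)) ≤ 2 * m / a - 2 * m / b := by
          rw [div_sub_div _ _ ha1.ne' hb0.ne', div_le_div_iff₀ (by positivity) (by positivity)]
          have h5 : 1 ≤ m ^ 2 := by rw [hmsq]; linarith [(Nat.cast_nonneg k : (0:ℝ) ≤ k)]
          have h6 : b ^ 2 ≤ m ^ 2 + a ^ 2 := by linarith
          have h7 : a ≤ 2 * (b - a) * b ^ 2 := by nlinarith [mul_nonneg ha0 hb0.le]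
          have h8 : a ≤ 2 * (b - a) * (m ^ 2 + a ^ 2) := h7.trans (by gcongr)
          nlinarith [mul_le_mul_of_nonneg_left h8 (by positivity : 0 ≤ m * b)]
        rw [if_neg h1]
        have ih' : ∑ l ∈ Finset.range l, m / (√(l + 1 : ℝ) * (k + l + 1)) ≤ 4 - 2 * m / a := by
          split_ifs at ih with h
          · have hl : l = k + 1 := by omega
            have : a = m := by rw [ha, hm, hl]; push_cast; rfl
            rw [this] at ih ⊢
            refine ih.trans (le_of_eq ?_)
            field_simp; norm_num
          · exact ih
        linarith
  refine (key M).trans ?_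
  split_ifs with h
  · rw [div_le_iff₀ (by positivity)]
    have : √(M : ℝ) ≤ √(k + 1 : ℝ) := Real.sqrt_le_sqrt (by exact_mod_cast h)
    have := Real.sqrt_nonneg (k + 1 : ℝ)
    linarith
  · have : 0 ≤ 2 * √(k + 1 : ℝ) / √(M : ℝ) := by positivity
    linarith

/-- Schur's test with weights `√(k + 1)`: the arithmetic-geometric mean inequality separates the
variables, the defect being a square, and `schur_sum_le` bounds the row and column sums. The sharp
constant `π` is not needed. -/
theorem sum_mul_div_le (a b : ℕ → ℝ) (M : ℕ) :
    ∑ k ∈ Finset.range M, ∑ l ∈ Finset.range M, a k * b l / (k + l + 1 : ℝ) ≤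
      2 * (∑ k ∈ Finset.range M, a k ^ 2 + ∑ l ∈ Finset.range M, b l ^ 2) := by
  have h : ∀ k l : ℕ, a k * b l / (k + l + 1 : ℝ) ≤
      a k ^ 2 / 2 * (√(k + 1 : ℝ) / (√(l + 1 : ℝ) * (k + l + 1))) +
      b l ^ 2 / 2 * (√(l + 1 : ℝ) / (√(k + 1 : ℝ) * (l + k + 1))) := by
    intro k l
    have hp : 0 < √(k + 1 : ℝ) := by positivity
    have hq : 0 < √(l + 1 : ℝ) := by positivity
    set p := √(k + 1 : ℝ)
    set q := √(l + 1 : ℝ)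
    have hs : (0 : ℝ) < k + l + 1 := by positivity
    rw [add_comm (l : ℝ) k]
    have : a k ^ 2 / 2 * (p / (q * (k + l + 1))) + b l ^ 2 / 2 * (q / (p * (k + l + 1)))
        - a k * b l / (k + l + 1 : ℝ) = (a k * p - b l * q) ^ 2 / (2 * p * q * (k + l + 1)) := by
      field_simp
      ring
    have h2 : 0 ≤ (a k * p - b l * q) ^ 2 / (2 * p * q * (k + l + 1)) := by positivity
    linarith
  calc _ ≤ ∑ k ∈ Finset.range M, ∑ l ∈ Finset.range M,
        (a k ^ 2 / 2 * (√(k + 1 : ℝ) / (√(l + 1 : ℝ) * (k + l + 1))) +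
      b l ^ 2 / 2 * (√(l + 1 : ℝ) / (√(k + 1 : ℝ) * (l + k + 1)))) :=
        Finset.sum_le_sum fun k _ => Finset.sum_le_sum fun l _ => h k l
    _ = ∑ k ∈ Finset.range M, a k ^ 2 / 2 *
          ∑ l ∈ Finset.range M, (√(k + 1 : ℝ) / (√(l + 1 : ℝ) * (k + l + 1))) +
        ∑ l ∈ Finset.range M, b l ^ 2 / 2 *
          ∑ k ∈ Finset.range M, (√(l + 1 : ℝ) / (√(k + 1 : ℝ) * (l + k + 1))) := by
        simp_rw [Finset.sum_add_distrib, Finset.mul_sum]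
        congr 1
        exact Finset.sum_comm
    _ ≤ ∑ k ∈ Finset.range M, a k ^ 2 / 2 * 4 + ∑ l ∈ Finset.range M, b l ^ 2 / 2 * 4 := by
        gcongr with k hk l hl
        · exact schur_sum_le k M
        · exact schur_sum_le l M
    _ = _ := by rw [← Finset.sum_mul, ← Finset.sum_mul, ← Finset.sum_div, ← Finset.sum_div]; ring

/-! ### Taylor coefficients at the origin -/

/-- The Taylor coefficients of `f` at `0`, by iterated division. -/
noncomputable def taylorCoeff : ℕ → (ℂ → ℂ) → ℂ
  | 0, f => f 0
  | n + 1, f => taylorCoeff n (dslope f 0)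

theorem dslope_congr_ball {f g : ℂ → ℂ} (h : EqOn f g (Metric.ball 0 1)) :
    EqOn (dslope f 0) (dslope g 0) (Metric.ball 0 1) := by
  intro z hz
  have h0 : (0 : ℂ) ∈ Metric.ball (0 : ℂ) 1 := by simp
  by_cases hz0 : z = 0
  · subst hz0
    rw [dslope_same, dslope_same]
    exact (h.eventuallyEq_of_mem (Metric.isOpen_ball.mem_nhds h0)).deriv_eq
  · rw [dslope_of_ne _ hz0, dslope_of_ne _ hz0, slope, slope, h hz, h h0]

theorem taylorCoeff_congr (n : ℕ) {f g : ℂ → ℂ} (h : EqOn f g (Metric.ball 0 1)) :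
    taylorCoeff n f = taylorCoeff n g := by
  induction n generalizing f g with
  | zero => exact h (by simp)
  | succ n ih => exact ih (dslope_congr_ball h)

theorem differentiableOn_dslope_ball {f : ℂ → ℂ} (hf : DifferentiableOn ℂ f (Metric.ball 0 1)) :
    DifferentiableOn ℂ (dslope f 0) (Metric.ball 0 1) :=
  (Complex.differentiableOn_dslope (Metric.isOpen_ball.mem_nhds (by simp))).2 hf

theorem eq_add_mul_dslope (f : ℂ → ℂ) (z : ℂ) : f z = f 0 + z * dslope f 0 z := by
  have := sub_smul_dslope f 0 z
  simp only [sub_zero, smul_eq_mul] at this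
  rw [this]; ring

/-- Away from the origin the factor `z` cancels; at the origin both sides are continuous. Any
explicit expansion `c + z r(z)` thus identifies the divided difference, which drives the coefficient
rules below. -/
theorem eqOn_dslope_of_eq {f r : ℂ → ℂ} {c : ℂ} (hr : ContinuousOn r (Metric.ball 0 1))
    (hf : DifferentiableOn ℂ f (Metric.ball 0 1))
    (h : ∀ z ∈ Metric.ball (0 : ℂ) 1, f z = c + z * r z) :
    EqOn (dslope f 0) r (Metric.ball 0 1) := by
  have h0 : (0 : ℂ) ∈ Metric.ball (0 : ℂ) 1 := by simp
  have hc : f 0 = c := by simpa using h 0 h0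
  have hne : ∀ z ∈ Metric.ball (0 : ℂ) 1, z ≠ 0 → dslope f 0 z = r z := by
    intro z hz hz0
    have h1 := eq_add_mul_dslope f z
    rw [h z hz, hc] at h1
    exact (mul_left_cancel₀ hz0 (add_left_cancel h1)).symm
  intro z hz
  by_cases hz0 : z = 0
  · subst hz0
    have hn := Metric.isOpen_ball.mem_nhds h0
    have t1 : Tendsto (dslope f 0) (𝓝[≠] 0) (𝓝 (dslope f 0 0)) :=
      ((differentiableOn_dslope_ball hf).continuousOn.continuousAt hn).tendsto.mono_left
        nhdsWithin_le_nhds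
    have t2 : Tendsto r (𝓝[≠] 0) (𝓝 (r 0)) :=
      (hr.continuousAt hn).tendsto.mono_left nhdsWithin_le_nhds
    refine tendsto_nhds_unique (t1.congr' ?_) t2
    filter_upwards [nhdsWithin_le_nhds hn, self_mem_nhdsWithin] with w hw hw0 using hne w hw hw0
  · exact hne z hz hz0

theorem taylorCoeff_add (n : ℕ) {f g : ℂ → ℂ} (hf : DifferentiableOn ℂ f (Metric.ball 0 1))
    (hg : DifferentiableOn ℂ g (Metric.ball 0 1)) :
    taylorCoeff n (fun z => f z + g z) = taylorCoeff n f + taylorCoeff n g := by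
  induction n generalizing f g with
  | zero => rfl
  | succ n ih =>
    have hf' := differentiableOn_dslope_ball hf
    have hg' := differentiableOn_dslope_ball hg
    rw [taylorCoeff, taylorCoeff, taylorCoeff, ← ih hf' hg']
    refine taylorCoeff_congr n (eqOn_dslope_of_eq (c := f 0 + g 0) (hf'.add hg').continuousOn
      (hf.add hg) fun z _ => ?_)
    rw [eq_add_mul_dslope f z, eq_add_mul_dslope g z]
    ring

theorem taylorCoeff_const_mul (n : ℕ) (c : ℂ) {f : ℂ → ℂ}
    (hf : DifferentiableOn ℂ f (Metric.ball 0 1)) :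
    taylorCoeff n (fun z => c * f z) = c * taylorCoeff n f := by
  induction n generalizing f with
  | zero => rfl
  | succ n ih =>
    have hf' := differentiableOn_dslope_ball hf
    rw [taylorCoeff, taylorCoeff, ← ih hf']
    refine taylorCoeff_congr n (eqOn_dslope_of_eq (c := c * f 0) (hf'.const_mul c).continuousOn
      (hf.const_mul c) fun z _ => ?_)
    rw [eq_add_mul_dslope f z]
    ring

/-- The divided difference of `f g` is `(dslope f) g + f(0) (dslope g)`; iterating this Leibniz rule
builds the Cauchy product. -/
theorem taylorCoeff_mul (n : ℕ) {f g : ℂ → ℂ} (hf : DifferentiableOn ℂ f (Metric.ball 0 1))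
    (hg : DifferentiableOn ℂ g (Metric.ball 0 1)) :
    taylorCoeff n (fun z => f z * g z) =
      ∑ i ∈ Finset.range (n + 1), taylorCoeff i f * taylorCoeff (n - i) g := by
  induction n generalizing f g with
  | zero => simp [taylorCoeff]
  | succ n ih =>
    have hf' := differentiableOn_dslope_ball hf
    have hg' := differentiableOn_dslope_ball hg
    have h1 : taylorCoeff (n + 1) (fun z => f z * g z) =
        taylorCoeff n (fun z => dslope f 0 z * g z + f 0 * dslope g 0 z) := by
      rw [taylorCoeff]
      refine taylorCoeff_congr n (eqOn_dslope_of_eq (c := f 0 * g 0)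
        ((hf'.mul hg).add (hg'.const_mul (f 0))).continuousOn (hf.mul hg) fun z _ => ?_)
      rw [eq_add_mul_dslope f z, eq_add_mul_dslope g z]
      ring
    have h2 : DifferentiableOn ℂ (fun z => dslope f 0 z * g z) (Metric.ball 0 1) := hf'.mul hg
    rw [h1, taylorCoeff_add n h2 (hg'.const_mul _), taylorCoeff_const_mul n _ hg',
      ih hf' hg, Finset.sum_range_succ' _ (n + 1)]
    simp [taylorCoeff]

theorem taylorCoeff_polynomial (n : ℕ) (P : Polynomial ℂ) :
    taylorCoeff n (fun z => P.eval z) = P.coeff n := by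
  induction n generalizing P with
  | zero => simp [taylorCoeff, Polynomial.coeff_zero_eq_eval_zero]
  | succ n ih =>
    rw [taylorCoeff, ← Polynomial.coeff_divX, ← ih]
    refine taylorCoeff_congr n (eqOn_dslope_of_eq (c := P.coeff 0)
      P.divX.continuous.continuousOn P.differentiable.differentiableOn fun z _ => ?_)
    conv_lhs => rw [← Polynomial.divX_mul_X_add P]
    simp
    ring

/-! ### Bessel's inequality on circles -/

/-- In `|f(0) + z r(z)|²` the cross term is the real part of an analytic function vanishing at `0`,
so its circle mean is zero. Iterating produces Parseval's identity with a remainder; discarding the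
remainder gives Bessel. -/
theorem circleAverage_normSq_eq {f : ℂ → ℂ} (hf : DifferentiableOn ℂ f (Metric.ball 0 1))
    {ρ : ℝ} (h0 : 0 ≤ ρ) (h1 : ρ < 1) :
    Real.circleAverage (fun z => ‖f z‖ ^ 2) 0 ρ =
      ‖f 0‖ ^ 2 + ρ ^ 2 * Real.circleAverage (fun z => ‖dslope f 0 z‖ ^ 2) 0 ρ := by
  have hf' := differentiableOn_dslope_ball hf
  have hsub : Metric.sphere (0 : ℂ) ρ ⊆ Metric.ball 0 1 := fun z hz => by
    simp at hz ⊢; linarith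
  have hcl : Metric.closedBall (0 : ℂ) |ρ| ⊆ Metric.ball 0 1 := fun z hz => by
    rw [abs_of_nonneg h0] at hz; simp at hz ⊢; linarith
  set r := dslope f 0 with hr
  have hci : CircleIntegrable (fun z => ‖r z‖ ^ 2) 0 ρ :=
    ContinuousOn.circleIntegrable h0 ((hf'.continuousOn.mono hsub).norm.pow 2)
  have hzr : DifferentiableOn ℂ (fun z => (starRingEnd ℂ) (f 0) * (z * r z))
      (Metric.ball 0 1) := (differentiableOn_id.mul hf').const_mul _
  have hci2 : CircleIntegrable (fun z => (starRingEnd ℂ) (f 0) * (z * r z)) 0 ρ :=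
    ContinuousOn.circleIntegrable h0 (hzr.continuousOn.mono hsub)
  have hci3 : CircleIntegrable (fun z => Complex.reCLM ((starRingEnd ℂ) (f 0) * (z * r z))) 0 ρ :=
    ContinuousOn.circleIntegrable h0
      (Complex.reCLM.continuous.comp_continuousOn (hzr.continuousOn.mono hsub))
  have hmean : Real.circleAverage (fun z => (starRingEnd ℂ) (f 0) * (z * r z)) 0 ρ = 0 := by
    have : DiffContOnCl ℂ (fun z => (starRingEnd ℂ) (f 0) * (z * r z)) (Metric.ball 0 |ρ|) := by
      apply DifferentiableOn.diffContOnCl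
      exact hzr.mono (Metric.closure_ball_subset_closedBall.trans hcl)
    rw [this.circleAverage]; simp
  have hre : Real.circleAverage
      (fun z => Complex.reCLM ((starRingEnd ℂ) (f 0) * (z * r z))) 0 ρ = 0 := by
    have := Complex.reCLM.circleAverage_comp_comm hci2
    rw [hmean] at this
    simpa [Function.comp_def] using this
  have heq : EqOn (fun z => ‖f z‖ ^ 2)
      (fun z => (‖f 0‖ ^ 2 + ρ ^ 2 • ‖r z‖ ^ 2) +
        (2 : ℝ) • Complex.reCLM ((starRingEnd ℂ) (f 0) * (z * r z)))
      (Metric.sphere 0 |ρ|) := by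
    intro z hz
    rw [abs_of_nonneg h0] at hz
    have hz' : ‖z‖ = ρ := by simpa using hz
    simp only
    rw [eq_add_mul_dslope f z, ← hr, Complex.sq_norm, Complex.normSq_add, ← Complex.sq_norm,
      ← Complex.sq_norm, norm_mul, hz']
    simp only [smul_eq_mul, Complex.reCLM_apply]
    rw [← Complex.conj_re (f 0 * _)]
    simp only [map_mul, Complex.conj_conj]
    ring
  rw [Real.circleAverage_congr_sphere heq]
  have c1 : CircleIntegrable (fun z => ρ ^ 2 • ‖r z‖ ^ 2) 0 ρ := hci.const_smul
  have c0 : CircleIntegrable (fun _ : ℂ => ‖f 0‖ ^ 2) 0 ρ :=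
    ContinuousOn.circleIntegrable h0 continuousOn_const
  have c3 : CircleIntegrable
      (fun z => (2 : ℝ) • Complex.reCLM ((starRingEnd ℂ) (f 0) * (z * r z))) 0 ρ := hci3.const_smul
  have c4 : CircleIntegrable (fun z => ‖f 0‖ ^ 2 + ρ ^ 2 • ‖r z‖ ^ 2) 0 ρ := c0.add c1
  rw [Real.circleAverage_fun_add c4 c3, Real.circleAverage_fun_add c0 c1,
    Real.circleAverage_fun_smul, Real.circleAverage_fun_smul, hre, Real.circleAverage_const]
  simp

theorem sum_taylorCoeff_sq_le {f : ℂ → ℂ} (hf : DifferentiableOn ℂ f (Metric.ball 0 1))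
    {ρ : ℝ} (h0 : 0 ≤ ρ) (h1 : ρ < 1) (M : ℕ) :
    ∑ k ∈ Finset.range M, (‖taylorCoeff k f‖ * ρ ^ k) ^ 2 ≤
      Real.circleAverage (fun z => ‖f z‖ ^ 2) 0 ρ := by
  induction M generalizing f with
  | zero =>
    simp only [Finset.range_zero, Finset.sum_empty]
    exact Real.circleAverage_nonneg_of_nonneg fun z _ => by positivity
  | succ M ih =>
    rw [circleAverage_normSq_eq hf h0 h1, Finset.sum_range_succ', add_comm]
    have := ih (differentiableOn_dslope_ball hf)
    simp only [taylorCoeff, pow_zero, mul_one]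
    gcongr
    refine le_trans (le_of_eq ?_) (mul_le_mul_of_nonneg_left this (sq_nonneg ρ))
    rw [Finset.mul_sum]
    refine Finset.sum_congr rfl fun k _ => ?_
    ring

/-! ### Factorization of polynomials and Hardy's inequality on the circle -/

/-- Since `|z/a| < 1`, the factor `1 - z/a` stays in the right half-plane, where the principal
square root is analytic. -/
theorem exists_sqrt_sub {a : ℂ} (ha : 1 ≤ ‖a‖) :
    ∃ r : ℂ → ℂ, DifferentiableOn ℂ r (Metric.ball 0 1) ∧
      ∀ z ∈ Metric.ball (0 : ℂ) 1, r z ^ 2 = z - a := by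
  have ha0 : a ≠ 0 := by rintro rfl; simp at ha; linarith
  refine ⟨fun z => (-a) ^ (1 / 2 : ℂ) * (1 - z / a) ^ (1 / 2 : ℂ), ?_, ?_⟩
  · refine DifferentiableOn.const_mul (DifferentiableOn.cpow ?_ ?_ ?_) _
    · exact (differentiableOn_const _).sub (differentiableOn_id.div_const a)
    · exact differentiableOn_const _
    · intro z hz
      left
      have h1 : ‖z / a‖ < 1 := by
        rw [norm_div, div_lt_one (by positivity)]
        simp at hz; linarith
      have := (Complex.abs_re_le_norm (z / a)).trans_lt h1
      simp only [Complex.sub_re, Complex.one_re]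
      linarith [(abs_lt.1 this).2]
  · intro z hz
    have : ∀ w : ℂ, (w ^ (1 / 2 : ℂ)) ^ 2 = w := fun w => by
      rw [← Complex.cpow_nat_mul]; norm_num
    rw [mul_pow, this, this]
    field_simp
    ring

theorem exists_sqrt_one_sub {a : ℂ} (ha : ‖a‖ < 1) :
    ∃ r : ℂ → ℂ, DifferentiableOn ℂ r (Metric.ball 0 1) ∧
      ∀ z ∈ Metric.ball (0 : ℂ) 1, r z ^ 2 = 1 - a * z ∧ r z ≠ 0 := by
  have hre : ∀ z ∈ Metric.ball (0 : ℂ) 1, 0 < (1 - a * z).re := by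
    intro z hz
    have h1 : ‖a * z‖ < 1 := by
      rw [norm_mul]
      simp at hz
      nlinarith [norm_nonneg a, norm_nonneg z]
    have := (Complex.abs_re_le_norm (a * z)).trans_lt h1
    simp only [Complex.sub_re, Complex.one_re]
    linarith [(abs_lt.1 this).2]
  have hsq : ∀ w : ℂ, (w ^ (1 / 2 : ℂ)) ^ 2 = w := fun w => by
    rw [← Complex.cpow_nat_mul]; norm_num
  refine ⟨fun z => (1 - a * z) ^ (1 / 2 : ℂ), ?_, fun z hz => ⟨hsq _, fun h => ?_⟩⟩
  · refine DifferentiableOn.cpow ?_ (differentiableOn_const _) fun z hz => Or.inl (hre z hz)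
    exact (differentiableOn_const _).sub (differentiableOn_id.const_mul a)
  · have h1 := hsq (1 - a * z)
    have h2 := hre z hz
    simp only at h
    rw [h] at h1
    rw [← h1] at h2
    simp at h2

/-- The identity behind Blaschke factors: `(z - a) / (1 - āz)` has modulus at most `1` in the disc
and exactly `1` on the circle. -/
theorem norm_sub_sq_add (a z : ℂ) :
    ‖1 - (starRingEnd ℂ) a * z‖ ^ 2 = ‖z - a‖ ^ 2 + (1 - ‖a‖ ^ 2) * (1 - ‖z‖ ^ 2) := by
  simp only [Complex.sq_norm, Complex.normSq_apply]
  simp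
  ring

theorem norm_sub_le_norm_one_sub {a z : ℂ} (ha : ‖a‖ ≤ 1) (hz : ‖z‖ ≤ 1) :
    ‖z - a‖ ≤ ‖1 - (starRingEnd ℂ) a * z‖ := by
  have h := norm_sub_sq_add a z
  have h1 : 0 ≤ (1 - ‖a‖ ^ 2) * (1 - ‖z‖ ^ 2) :=
    mul_nonneg (by nlinarith [norm_nonneg a]) (by nlinarith [norm_nonneg z])
  exact le_of_sq_le_sq (by linarith) (norm_nonneg _)

/-- A polynomial is, on the open unit disc, a product of two analytic functions whose squared
moduli are dominated by a polynomial with the same modulus on the circle. -/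
theorem exists_factorization (P : Polynomial ℂ) :
    ∃ (Q : Polynomial ℂ) (s t : ℂ → ℂ), DifferentiableOn ℂ s (Metric.ball 0 1) ∧
      DifferentiableOn ℂ t (Metric.ball 0 1) ∧
      (∀ z ∈ Metric.ball (0 : ℂ) 1, P.eval z = s z * t z ∧ ‖s z‖ ^ 2 ≤ ‖Q.eval z‖ ∧
        ‖t z‖ ^ 2 ≤ ‖Q.eval z‖) ∧
      ∀ z : ℂ, ‖z‖ = 1 → ‖Q.eval z‖ = ‖P.eval z‖ := by
  have hP : P = Polynomial.C P.leadingCoeff *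
      (P.roots.map fun a => Polynomial.X - Polynomial.C a).prod :=
    (IsAlgClosed.splits P).eq_prod_roots
  rw [hP]
  generalize P.leadingCoeff = c
  generalize P.roots = m
  induction m using Multiset.induction_on with
  | empty =>
    refine ⟨Polynomial.C c, fun _ => c ^ (1 / 2 : ℂ), fun _ => c ^ (1 / 2 : ℂ),
      differentiableOn_const _, differentiableOn_const _, fun z _ => ?_, fun z _ => by simp⟩
    have h : c ^ (1 / 2 : ℂ) * c ^ (1 / 2 : ℂ) = c := by
      rw [← sq, ← Complex.cpow_nat_mul]; norm_num
    have h2 : ‖c ^ (1 / 2 : ℂ)‖ ^ 2 = ‖c‖ := by rw [sq, ← norm_mul, h]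
    simp only [Multiset.map_zero, Multiset.prod_zero, mul_one, Polynomial.eval_C]
    exact ⟨h.symm, h2.le, h2.le⟩
  | cons a m ih =>
    obtain ⟨Q, s, t, hs, ht, h1, h2⟩ := ih
    have hev : ∀ z : ℂ, (Polynomial.C c * ((a ::ₘ m).map
        fun a => Polynomial.X - Polynomial.C a).prod).eval z =
        (z - a) * (Polynomial.C c * (m.map fun a => Polynomial.X - Polynomial.C a).prod).eval z := by
      intro z
      simp only [Multiset.map_cons, Multiset.prod_cons, Polynomial.eval_mul, Polynomial.eval_sub,
        Polynomial.eval_X, Polynomial.eval_C]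
      ring
    simp only [hev]
    -- A factor `z - a` without zero in the open disc is split evenly between `s` and `t`. A zero
    -- inside forbids an analytic square root. Then `s` receives `r = √(1 - āz)`, `t` receives `(z -
    -- a)/r`, and `Q` receives `1 - āz`, which dominates `z - a` in the disc and has the same
    -- modulus on the circle.
    rcases le_or_gt 1 ‖a‖ with ha | ha
    · obtain ⟨r, hr, hr2⟩ := exists_sqrt_sub ha
      refine ⟨(Polynomial.X - Polynomial.C a) * Q, fun z => r z * s z, fun z => r z * t z,
        hr.mul hs, hr.mul ht, fun z hz => ?_, fun z hz => ?_⟩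
      · obtain ⟨e1, e2, e3⟩ := h1 z hz
        have e4 : ‖r z‖ ^ 2 = ‖z - a‖ := by rw [← norm_pow, hr2 z hz]
        refine ⟨by rw [e1, ← hr2 z hz]; ring, ?_, ?_⟩ <;>
        · simp only [Polynomial.eval_mul, Polynomial.eval_sub, Polynomial.eval_X,
            Polynomial.eval_C, norm_mul, mul_pow, e4]
          gcongr
      · simp [h2 z hz]
    · have ha' : ‖(starRingEnd ℂ) a‖ < 1 := by simpa using ha
      obtain ⟨r, hr, hr2⟩ := exists_sqrt_one_sub ha'
      refine ⟨(1 - Polynomial.C ((starRingEnd ℂ) a) * Polynomial.X) * Q, fun z => r z * s z,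
        fun z => (z - a) / r z * t z, hr.mul hs,
        (((differentiableOn_id.sub (differentiableOn_const a)).div hr
          fun z hz => (hr2 z hz).2).mul ht), fun z hz => ?_, fun z hz => ?_⟩
      · obtain ⟨e1, e2, e3⟩ := h1 z hz
        obtain ⟨f1, f2⟩ := hr2 z hz
        have e4 : ‖r z‖ ^ 2 = ‖1 - (starRingEnd ℂ) a * z‖ := by rw [← norm_pow, f1]
        have f3 : 0 < ‖r z‖ := norm_pos_iff.2 f2
        have e5 : (‖z - a‖ / ‖r z‖) ^ 2 ≤ ‖1 - (starRingEnd ℂ) a * z‖ := by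
          rw [div_pow, e4, div_le_iff₀ (by rw [← e4]; positivity), ← sq]
          have hz1 : ‖z‖ < 1 := by simpa using hz
          have := norm_sub_le_norm_one_sub ha.le hz1.le
          gcongr
        refine ⟨by rw [e1]; field_simp, ?_, ?_⟩
        · simp only [Polynomial.eval_mul, Polynomial.eval_sub, Polynomial.eval_X,
            Polynomial.eval_C, Polynomial.eval_one, norm_mul, mul_pow, e4]
          gcongr
        · simp only [Polynomial.eval_mul, Polynomial.eval_sub, Polynomial.eval_X,
            Polynomial.eval_C, Polynomial.eval_one, norm_mul, mul_pow, norm_div]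
          gcongr
      · have h3 := norm_sub_sq_add a z
        rw [hz] at h3
        have h4 : ‖1 - (starRingEnd ℂ) a * z‖ = ‖z - a‖ := by
          rw [← sq_eq_sq₀ (norm_nonneg _) (norm_nonneg _), h3]; ring
        simp [h2 z hz, h4]

/-- Hardy's inequality for polynomials. -/
theorem sum_norm_coeff_div_le (P : Polynomial ℂ) (M : ℕ) :
    ∑ n ∈ Finset.range M, ‖P.coeff n‖ / (n + 1 : ℝ) ≤
      4 * Real.circleAverage (fun z => ‖P.eval z‖) 0 1 := by
  obtain ⟨Q, s, t, hs, ht, h1, h2⟩ := exists_factorization P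
  have hPQ : Real.circleAverage (fun z => ‖P.eval z‖) 0 1 =
      Real.circleAverage (fun z => ‖Q.eval z‖) 0 1 := by
    refine Real.circleAverage_congr_sphere fun z hz => ?_
    exact (h2 z (by simpa using hz)).symm
  rw [hPQ]
  have hcoef : ∀ n, P.coeff n =
      ∑ i ∈ Finset.range (n + 1), taylorCoeff i s * taylorCoeff (n - i) t := by
    intro n
    rw [← taylorCoeff_mul n hs ht, ← taylorCoeff_polynomial]
    exact taylorCoeff_congr n fun z hz => (h1 z hz).1
  -- The factors are analytic only in the open disc, so the estimate is made on radius `ρ < 1`;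
  -- letting `ρ → 1` at the end requires continuity only of the polynomials.
  have hρ : ∀ ρ : ℝ, 0 ≤ ρ → ρ < 1 → ∑ n ∈ Finset.range M, ‖P.coeff n‖ * ρ ^ n / (n + 1 : ℝ) ≤
      4 * Real.circleAverage (fun z => ‖Q.eval z‖) 0 ρ := by
    intro ρ h0 h1ρ
    have hsub : Metric.sphere (0 : ℂ) ρ ⊆ Metric.ball 0 1 := fun z hz => by
      simp at hz ⊢; linarith
    have hQi : CircleIntegrable (fun z => ‖Q.eval z‖) 0 ρ :=
      ContinuousOn.circleIntegrable h0 (Q.continuous.norm.continuousOn)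
    have bs : Real.circleAverage (fun z => ‖s z‖ ^ 2) 0 ρ ≤
        Real.circleAverage (fun z => ‖Q.eval z‖) 0 ρ := by
      refine Real.circleAverage_mono (ContinuousOn.circleIntegrable h0
        ((hs.continuousOn.mono hsub).norm.pow 2)) hQi fun z hz => ?_
      rw [abs_of_nonneg h0] at hz
      exact (h1 z (hsub hz)).2.1
    have bt : Real.circleAverage (fun z => ‖t z‖ ^ 2) 0 ρ ≤
        Real.circleAverage (fun z => ‖Q.eval z‖) 0 ρ := by
      refine Real.circleAverage_mono (ContinuousOn.circleIntegrable h0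
        ((ht.continuousOn.mono hsub).norm.pow 2)) hQi fun z hz => ?_
      rw [abs_of_nonneg h0] at hz
      exact (h1 z (hsub hz)).2.2
    set α : ℕ → ℝ := fun k => ‖taylorCoeff k s‖ * ρ ^ k with hα
    set β : ℕ → ℝ := fun k => ‖taylorCoeff k t‖ * ρ ^ k with hβ
    have hα0 : ∀ k, 0 ≤ α k := fun k => by positivity
    have hβ0 : ∀ k, 0 ≤ β k := fun k => by positivity
    calc ∑ n ∈ Finset.range M, ‖P.coeff n‖ * ρ ^ n / (n + 1 : ℝ)
        ≤ ∑ n ∈ Finset.range M, ∑ p ∈ Finset.HasAntidiagonal.antidiagonal n,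
            α p.1 * β p.2 / (p.1 + p.2 + 1 : ℝ) := by
          gcongr with n hn
          rw [hcoef, Finset.Nat.sum_antidiagonal_eq_sum_range_succ_mk]
          calc _ ≤ (∑ i ∈ Finset.range (n + 1), ‖taylorCoeff i s * taylorCoeff (n - i) t‖)
                * ρ ^ n / (n + 1 : ℝ) := by
                gcongr; exact norm_sum_le _ _
            _ = _ := by
                rw [Finset.sum_mul, Finset.sum_div]
                refine Finset.sum_congr rfl fun i hi => ?_
                have hi' : i ≤ n := by simp at hi; omega
                have h3 : ((n - i : ℕ) : ℝ) = n - i := by push_cast [hi']; ring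
                have h4 : ρ ^ n = ρ ^ i * ρ ^ (n - i) := by rw [← pow_add]; congr 1; omega
                simp only [hα, hβ]
                rw [h3, norm_mul, h4]
                ring_nf
      -- The antidiagonals of index below `M` are disjoint and lie in the square; the added terms
      -- are nonnegative.
      _ ≤ ∑ k ∈ Finset.range M, ∑ l ∈ Finset.range M, α k * β l / (k + l + 1 : ℝ) := by
          rw [← Finset.sum_product', ← Finset.sum_biUnion]
          · refine Finset.sum_le_sum_of_subset_of_nonneg ?_ fun p _ _ => ?_
            · intro p hp
              simp only [Finset.mem_biUnion, Finset.mem_range, Finset.HasAntidiagonal.mem_antidiagonal,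
                Finset.mem_product] at hp ⊢
              obtain ⟨n, hn, hp⟩ := hp
              omega
            · have := hα0 p.1
              have := hβ0 p.2
              positivity
          · intro m _ n _ hmn
            refine Finset.disjoint_left.2 fun p hp hq => hmn ?_
            rw [Finset.HasAntidiagonal.mem_antidiagonal] at hp hq
            omega
      _ ≤ 2 * (∑ k ∈ Finset.range M, α k ^ 2 + ∑ l ∈ Finset.range M, β l ^ 2) :=
          sum_mul_div_le α β M
      _ ≤ 2 * (Real.circleAverage (fun z => ‖Q.eval z‖) 0 ρ +
            Real.circleAverage (fun z => ‖Q.eval z‖) 0 ρ) := by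
          gcongr
          · exact (sum_taylorCoeff_sq_le hs h0 h1ρ M).trans bs
          · exact (sum_taylorCoeff_sq_le ht h0 h1ρ M).trans bt
      _ = _ := by ring
  have hQc : Continuous (Real.circleAverage (fun z => ‖Q.eval z‖) 0) :=
    Real.Continuous.circleAverage Q.continuous.norm
  have t1 : Tendsto (fun ρ : ℝ => ∑ n ∈ Finset.range M, ‖P.coeff n‖ * ρ ^ n / (n + 1 : ℝ))
      (𝓝[<] 1) (𝓝 (∑ n ∈ Finset.range M, ‖P.coeff n‖ * 1 ^ n / (n + 1 : ℝ))) := by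
    have : Continuous (fun ρ : ℝ => ∑ n ∈ Finset.range M, ‖P.coeff n‖ * ρ ^ n / (n + 1 : ℝ)) := by
      fun_prop
    exact this.continuousAt.tendsto.mono_left nhdsWithin_le_nhds
  have t2 : Tendsto (fun ρ : ℝ => 4 * Real.circleAverage (fun z => ‖Q.eval z‖) 0 ρ)
      (𝓝[<] 1) (𝓝 (4 * Real.circleAverage (fun z => ‖Q.eval z‖) 0 1)) :=
    (hQc.const_mul 4).continuousAt.tendsto.mono_left nhdsWithin_le_nhds
  simp only [one_pow, mul_one] at t1
  refine le_of_tendsto_of_tendsto t1 t2 ?_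
  filter_upwards [Ioo_mem_nhdsLT (zero_lt_one : (0 : ℝ) < 1)] with ρ h using hρ ρ h.1.le h.2

/-! ### Hardy's inequality on the line -/

/-- The Fourier integral with kernel `e^{-iξx}`. -/
noncomputable def fourierInt (b : ℝ → ℂ) (ξ : ℝ) : ℂ :=
  ∫ x : ℝ, b x * Complex.exp (-(Complex.I * ξ * x))

theorem norm_exp_neg_I_mul (ξ x : ℝ) : ‖Complex.exp (-(Complex.I * ξ * x))‖ = 1 := by
  rw [Complex.norm_exp]; simp

theorem norm_exp_I_mul (ξ x : ℝ) : ‖Complex.exp (Complex.I * ξ * x)‖ = 1 := by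
  rw [Complex.norm_exp]; simp

theorem integrable_mul_exp {b : ℝ → ℂ} (hb : Integrable b) (ξ : ℝ) :
    Integrable fun x : ℝ => b x * Complex.exp (-(Complex.I * ξ * x)) := by
  refine hb.mul_bdd (c := 1) (by fun_prop) (ae_of_all _ fun x => ?_)
  exact (norm_exp_neg_I_mul ξ x).le

theorem continuous_fourierInt {b : ℝ → ℂ} (hb : Integrable b) : Continuous (fourierInt b) := by
  refine continuous_of_dominated (bound := fun x => ‖b x‖)
    (fun ξ => (integrable_mul_exp hb ξ).aestronglyMeasurable) (fun ξ => ae_of_all _ fun x => ?_)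
    hb.norm (ae_of_all _ fun x => by fun_prop)
  rw [norm_mul, norm_exp_neg_I_mul, mul_one]

theorem integral_exp_int (n : ℤ) (hn : n ≠ 0) (φ : ℝ) :
    ∫ θ in (0 : ℝ)..2 * Real.pi, Complex.exp (Complex.I * n * (θ - φ : ℝ)) = 0 := by
  have hc : Complex.I * n ≠ 0 := mul_ne_zero Complex.I_ne_zero (by exact_mod_cast hn)
  have h1 : ∀ θ : ℝ, Complex.exp (Complex.I * n * (θ - φ : ℝ)) =
      Complex.exp (-(Complex.I * n * φ)) * Complex.exp (Complex.I * n * θ) := fun θ => by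
    rw [← Complex.exp_add]; congr 1; push_cast; ring
  simp_rw [h1]
  rw [intervalIntegral.integral_const_mul, integral_exp_mul_complex hc]
  have h2 : Complex.exp (Complex.I * n * ((2 * Real.pi : ℝ) : ℂ)) = 1 := by
    rw [Complex.exp_eq_one_iff]
    exact ⟨n, by push_cast; ring⟩
  rw [h2]
  simp

theorem normSq_sum_exp (M : ℕ) (φ : ℝ) :
    ((‖∑ j ∈ Finset.range M, Complex.exp (Complex.I * j * φ)‖ ^ 2 : ℝ) : ℂ) =
      ∑ j ∈ Finset.range M, ∑ k ∈ Finset.range M,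
        Complex.exp (Complex.I * ((j - k : ℤ) : ℂ) * φ) := by
  rw [Complex.ofReal_pow, ← Complex.mul_conj', map_sum,
    Finset.sum_mul_sum]
  refine Finset.sum_congr rfl fun j _ => Finset.sum_congr rfl fun k _ => ?_
  rw [← Complex.exp_conj, ← Complex.exp_add]
  congr 1
  simp
  ring

theorem integral_fejer (M : ℕ) (φ : ℝ) :
    ∫ θ in (0 : ℝ)..2 * Real.pi,
      ‖∑ j ∈ Finset.range M, Complex.exp (Complex.I * j * (θ - φ : ℝ))‖ ^ 2 =
        2 * Real.pi * M := by
  have h : ((∫ θ in (0 : ℝ)..2 * Real.pi,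
      ‖∑ j ∈ Finset.range M, Complex.exp (Complex.I * j * (θ - φ : ℝ))‖ ^ 2 : ℝ) : ℂ) =
      2 * Real.pi * M := by
    rw [← intervalIntegral.integral_ofReal]
    simp_rw [normSq_sum_exp]
    rw [intervalIntegral.integral_finsetSum]
    · have : ∀ j ∈ Finset.range M, (∫ θ in (0 : ℝ)..2 * Real.pi, ∑ k ∈ Finset.range M,
          Complex.exp (Complex.I * ((j - k : ℤ) : ℂ) * (θ - φ : ℝ))) = 2 * Real.pi := by
        intro j hj
        rw [intervalIntegral.integral_finsetSum]
        · rw [Finset.sum_eq_single_of_mem j hj]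
          · simp
          · intro k _ hk
            exact integral_exp_int _ (by omega) φ
        · intro k _
          exact Continuous.intervalIntegrable (by fun_prop) _ _
      rw [Finset.sum_congr rfl this]
      simp
      ring
    · intro j _
      exact Continuous.intervalIntegrable (by fun_prop) _ _
  exact_mod_cast h

/-! ### Sampling the Fourier integral by Fejér means -/

section Fejer

variable {b : ℝ → ℂ}

/-- The Fejér mean of the samples of the Fourier integral, as a polynomial. -/
noncomputable def fejerPoly (b : ℝ → ℂ) (h : ℝ) (M : ℕ) : Polynomial ℂ :=
  ∑ j ∈ Finset.range M, ∑ k ∈ Finset.range M,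
    -- The exponent is truncated subtraction. A pair with `j < k` therefore lands in degree `0`,
    -- harmlessly, since its coefficient is a value of the Fourier integral at a negative frequency,
    -- which vanishes wherever the polynomial is used.
    Polynomial.C ((M : ℂ)⁻¹ * fourierInt b (((j : ℝ) - k) * h)) * Polynomial.X ^ (j - k)

/-- One-sided spectrum makes the full trigonometric sum over pairs `(j, k)` a polynomial. As an
integral against the nonnegative Fejér kernel it can be bounded in `L¹` without loss. -/
theorem fejerPoly_eval (hb : Integrable b) (h0 : ∀ ξ ≤ 0, fourierInt b ξ = 0) {h : ℝ}
    (hh : 0 < h) (M : ℕ) (θ : ℝ) :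
    (fejerPoly b h M).eval (circleMap 0 1 θ) = (M : ℂ)⁻¹ * ∫ x : ℝ, b x *
      ((‖∑ j ∈ Finset.range M, Complex.exp (Complex.I * j * (θ - h * x : ℝ))‖ ^ 2 : ℝ) : ℂ) := by
  simp_rw [normSq_sum_exp, Finset.mul_sum]
  have hterm : ∀ (j k : ℕ) (x : ℝ),
      b x * Complex.exp (Complex.I * ((j - k : ℤ) : ℂ) * (θ - h * x : ℝ)) =
      Complex.exp (Complex.I * ((j - k : ℤ) : ℂ) * θ) *
        (b x * Complex.exp (-(Complex.I * (((j : ℝ) - k) * h : ℝ) * x))) := by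
    intro j k x
    rw [mul_left_comm, ← Complex.exp_add]
    congr 2
    push_cast
    ring
  have hint : ∀ j k : ℕ, Integrable fun x : ℝ =>
      b x * Complex.exp (Complex.I * ((j - k : ℤ) : ℂ) * (θ - h * x : ℝ)) := by
    intro j k
    simp_rw [hterm]
    exact (integrable_mul_exp hb _).const_mul _
  rw [integral_finsetSum _ fun j _ => integrable_finsetSum _ fun k _ => hint j k, fejerPoly,
    Polynomial.eval_finsetSum, Finset.mul_sum]
  refine Finset.sum_congr rfl fun j _ => ?_
  rw [integral_finsetSum _ fun k _ => hint j k, Polynomial.eval_finsetSum, Finset.mul_sum]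
  refine Finset.sum_congr rfl fun k _ => ?_
  simp_rw [hterm]
  rw [integral_const_mul]
  simp only [Polynomial.eval_mul, Polynomial.eval_C, Polynomial.eval_pow, Polynomial.eval_X]
  change (M : ℂ)⁻¹ * fourierInt b (((j : ℝ) - k) * h) * circleMap 0 1 θ ^ (j - k) =
    (M : ℂ)⁻¹ * (Complex.exp (Complex.I * ((j - k : ℤ) : ℂ) * θ) *
      fourierInt b (((j : ℝ) - k) * h))
  rcases le_or_gt k j with hjk | hjk
  · have : circleMap 0 1 θ ^ (j - k) = Complex.exp (Complex.I * ((j - k : ℤ) : ℂ) * θ) := by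
      rw [circleMap]
      simp only [Complex.ofReal_one, one_mul, zero_add]
      rw [← Complex.exp_nat_mul]
      congr 1
      push_cast [hjk]
      ring
    rw [this]
    ring
  · have : fourierInt b (((j : ℝ) - k) * h) = 0 := by
      apply h0
      have : (j : ℝ) < k := by exact_mod_cast hjk
      nlinarith
    rw [this]
    simp

/-- The kernel is nonnegative and every translate of it has mean `M` over a period; Tonelli and the
factor `M⁻¹` leave exactly the `L¹` norm of `b`. -/
theorem circleAverage_fejerPoly_le (hb : Integrable b) (h0 : ∀ ξ ≤ 0, fourierInt b ξ = 0) {h : ℝ}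
    (hh : 0 < h) {M : ℕ} (hM : 0 < M) :
    Real.circleAverage (fun z => ‖(fejerPoly b h M).eval z‖) 0 1 ≤ ∫ x, ‖b x‖ := by
  set D : ℝ → ℝ → ℝ := fun θ x =>
    ‖∑ j ∈ Finset.range M, Complex.exp (Complex.I * j * (θ - h * x : ℝ))‖ ^ 2 with hD
  have hDc : Continuous (Function.uncurry D) := by
    simp only [hD, Function.uncurry_def]
    fun_prop
  have hDb : ∀ θ x, D θ x ≤ (M : ℝ) ^ 2 := by
    intro θ x
    simp only [hD]
    gcongr
    refine (norm_sum_le _ _).trans ?_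
    have : ∀ j ∈ Finset.range M, ‖Complex.exp (Complex.I * j * (θ - h * x : ℝ))‖ ≤ 1 := by
      intro j _
      rw [Complex.norm_exp]
      simp
    exact (Finset.sum_le_sum this).trans (by simp)
  have hD0 : ∀ θ x, 0 ≤ D θ x := fun θ x => by simp only [hD]; positivity
  have hpi : (0 : ℝ) ≤ 2 * Real.pi := by positivity
  have hprod : Integrable (Function.uncurry fun θ x => ‖b x‖ * D θ x)
      ((volume.restrict (Ioc 0 (2 * Real.pi))).prod volume) := by
    have h1 : Integrable (fun p : ℝ × ℝ => ‖b p.2‖)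
        ((volume.restrict (Ioc 0 (2 * Real.pi))).prod volume) := by
      have := (integrable_const (1 : ℝ) (μ := volume.restrict (Ioc 0 (2 * Real.pi)))).mul_prod
        hb.norm
      simpa using this
    refine h1.mul_bdd (c := (M : ℝ) ^ 2) hDc.aestronglyMeasurable (ae_of_all _ fun p => ?_)
    rw [Real.norm_of_nonneg (hD0 _ _)]
    exact hDb _ _
  have hle : ∀ θ : ℝ, ‖(fejerPoly b h M).eval (circleMap 0 1 θ)‖ ≤
      (M : ℝ)⁻¹ * ∫ x, ‖b x‖ * D θ x := by
    intro θ
    rw [fejerPoly_eval hb h0 hh, norm_mul]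
    have : ‖(M : ℂ)⁻¹‖ = (M : ℝ)⁻¹ := by simp
    rw [this]
    gcongr
    refine (norm_integral_le_integral_norm _).trans (le_of_eq ?_)
    refine integral_congr_ae (ae_of_all _ fun x => ?_)
    simp only [norm_mul]
    rw [Complex.norm_of_nonneg (hD0 θ x)]
  have hint : IntervalIntegrable (fun θ => (M : ℝ)⁻¹ * ∫ x, ‖b x‖ * D θ x) volume 0
      (2 * Real.pi) := by
    rw [intervalIntegrable_iff_integrableOn_Ioc_of_le hpi]
    exact hprod.integral_prod_left.const_mul _
  have hcont : Continuous fun θ : ℝ => ‖(fejerPoly b h M).eval (circleMap 0 1 θ)‖ := by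
    have := (fejerPoly b h M).continuous
    fun_prop
  rw [Real.circleAverage_def, smul_eq_mul]
  have hswap : ∫ θ in (0 : ℝ)..2 * Real.pi, ∫ x, ‖b x‖ * D θ x =
      2 * Real.pi * M * ∫ x, ‖b x‖ := by
    rw [intervalIntegral.integral_of_le hpi, integral_integral_swap hprod, ← integral_const_mul]
    refine integral_congr_ae (ae_of_all _ fun x => ?_)
    simp only
    rw [integral_const_mul, ← intervalIntegral.integral_of_le hpi]
    simp only [hD]
    rw [integral_fejer]
    ring
  calc _ ≤ (2 * Real.pi)⁻¹ * ∫ θ in (0 : ℝ)..2 * Real.pi, (M : ℝ)⁻¹ * ∫ x, ‖b x‖ * D θ x := by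
        gcongr
        exact intervalIntegral.integral_mono_on hpi (hcont.intervalIntegrable _ _) hint
          fun θ _ => hle θ
    _ = _ := by
        rw [intervalIntegral.integral_const_mul, hswap]
        have : (M : ℝ) ≠ 0 := by positivity
        field_simp

/-- Degree `n` is reached by the `M - n` pairs `j = k + n`; all others mapped there by truncation
have zero coefficient. -/
theorem fejerPoly_coeff (h0 : ∀ ξ ≤ 0, fourierInt b ξ = 0) {h : ℝ}
    (hh : 0 < h) {M n : ℕ} (hn : n < M) :
    (fejerPoly b h M).coeff n = ((M - n : ℕ) : ℂ) * ((M : ℂ)⁻¹ * fourierInt b (n * h)) := by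
  rw [fejerPoly, Finset.sum_comm, Polynomial.finsetSum_coeff]
  have : ∀ k ∈ Finset.range M, (∑ j ∈ Finset.range M,
      Polynomial.C ((M : ℂ)⁻¹ * fourierInt b (((j : ℝ) - k) * h)) *
        Polynomial.X ^ (j - k)).coeff n =
      if k < M - n then (M : ℂ)⁻¹ * fourierInt b (n * h) else 0 := by
    intro k hk
    rw [Polynomial.finsetSum_coeff]
    have h1 : ∀ j ∈ Finset.range M,
        (Polynomial.C ((M : ℂ)⁻¹ * fourierInt b (((j : ℝ) - k) * h)) *
          Polynomial.X ^ (j - k)).coeff n =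
        if j = k + n then (M : ℂ)⁻¹ * fourierInt b (n * h) else 0 := by
      intro j _
      rw [Polynomial.coeff_C_mul_X_pow]
      by_cases hj : j = k + n
      · subst hj
        simp
      · rw [if_neg hj]
        split_ifs with h2
        · have h3 : j < k := by omega
          rw [h0 _ (by have : (j : ℝ) < k := by exact_mod_cast h3
                       nlinarith), mul_zero]
        · rfl
    rw [Finset.sum_congr rfl h1, Finset.sum_ite_eq']
    refine if_congr ?_ rfl rfl
    rw [Finset.mem_range]
    omega
  rw [Finset.sum_congr rfl this, ← Finset.sum_filter, Finset.sum_const, nsmul_eq_mul]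
  congr 2
  have : Finset.filter (fun k => k < M - n) (Finset.range M) = Finset.range (M - n) := by
    ext k
    simp
    omega
  rw [this, Finset.card_range]

/-- Hardy's inequality for the Fejér polynomial carries weights `1 - n/M`, which tend to `1` as `M →
∞`. The bound does not depend on the step `h`, so it survives mesh refinement. -/
theorem sum_fourierInt_le (hb : Integrable b) (h0 : ∀ ξ ≤ 0, fourierInt b ξ = 0) {h : ℝ}
    (hh : 0 < h) (N : ℕ) :
    ∑ n ∈ Finset.range N, ‖fourierInt b (n * h)‖ / (n + 1 : ℝ) ≤ 4 * ∫ x, ‖b x‖ := by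
  have key : ∀ M : ℕ, N < M → ∑ n ∈ Finset.range N,
      (1 - n * (M : ℝ)⁻¹) * ‖fourierInt b (n * h)‖ / (n + 1 : ℝ) ≤ 4 * ∫ x, ‖b x‖ := by
    intro M hM
    have hM0 : 0 < M := by omega
    refine le_trans (le_of_eq ?_) ((sum_norm_coeff_div_le (fejerPoly b h M) N).trans
      (mul_le_mul_of_nonneg_left (circleAverage_fejerPoly_le hb h0 hh hM0) (by norm_num)))
    refine Finset.sum_congr rfl fun n hn => ?_
    have hn' : n < M := by simp at hn; omega
    rw [fejerPoly_coeff h0 hh hn', norm_mul, norm_mul]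
    congr 1
    rw [Complex.norm_natCast, norm_inv, Complex.norm_natCast]
    have : (M : ℝ) ≠ 0 := by positivity
    push_cast [hn'.le]
    field_simp
  have t : Tendsto (fun M : ℕ => ∑ n ∈ Finset.range N,
      (1 - n * (M : ℝ)⁻¹) * ‖fourierInt b (n * h)‖ / (n + 1 : ℝ)) atTop
      (𝓝 (∑ n ∈ Finset.range N, (1 - n * 0) * ‖fourierInt b (n * h)‖ / (n + 1 : ℝ))) := by
    refine tendsto_finsetSum _ fun n _ => ?_
    refine Tendsto.div_const (Tendsto.mul_const _ ?_) _
    exact tendsto_const_nhds.sub (tendsto_inv_atTop_nhds_zero_nat.const_mul _)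
  simp only [mul_zero, sub_zero, one_mul] at t
  refine le_of_tendsto t ?_
  filter_upwards [eventually_gt_atTop N] with M hM using key M hM

/-- Hardy's inequality for integrable functions with one-sided spectrum. -/
theorem lintegral_fourierInt_div_le (hb : Integrable b) (h0 : ∀ ξ ≤ 0, fourierInt b ξ = 0) :
    ∫⁻ ξ in Ioi (0 : ℝ), ‖fourierInt b ξ / ξ‖ₑ ≤ ENNReal.ofReal (4 * ∫ x, ‖b x‖) := by
  -- Step functions of mesh `h = 1/(m + 1)`. On the cell `[nh, (n+1)h)` the denominator is the right
  -- endpoint `(n + 1)h`, so the cell contributes exactly the `n`th term of `sum_fourierInt_le`, and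
  -- `n = 0` causes no trouble. Fatou's lemma then passes to the limit.
  set u : ℕ → ℝ → ℝ≥0∞ := fun m ξ =>
    ENNReal.ofReal (‖fourierInt b (⌊ξ * (m + 1)⌋₊ * (1 / (m + 1 : ℝ)))‖ /
      ((⌊ξ * (m + 1)⌋₊ + 1 : ℝ) * (1 / (m + 1 : ℝ)))) with hu
  have hmeas : ∀ m, Measurable (u m) := by
    intro m
    have h1 : Measurable fun n : ℕ => ENNReal.ofReal (‖fourierInt b (n * (1 / (m + 1 : ℝ)))‖ /
      ((n + 1 : ℝ) * (1 / (m + 1 : ℝ)))) := measurable_from_nat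
    exact h1.comp (Nat.measurable_floor.comp (measurable_id.mul_const _))
  have hlim : ∀ ξ ∈ Ioi (0 : ℝ), liminf (fun m => u m ξ) atTop = ‖fourierInt b ξ / ξ‖ₑ := by
    intro ξ hξ
    have hξ' : (0 : ℝ) < ξ := hξ
    have tN : Tendsto (fun m : ℕ => (m + 1 : ℝ)) atTop atTop :=
      tendsto_atTop_add_const_right _ _ tendsto_natCast_atTop_atTop
    have t0 : Tendsto (fun m : ℕ => (1 / (m + 1 : ℝ))) atTop (𝓝 0) :=
      tendsto_one_div_add_atTop_nhds_zero_nat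
    have t1 : Tendsto (fun m : ℕ => (⌊ξ * (m + 1)⌋₊ * (1 / (m + 1 : ℝ)))) atTop (𝓝 ξ) := by
      have := (tendsto_nat_floor_mul_div_atTop hξ'.le).comp tN
      simpa [Function.comp_def, div_eq_mul_inv] using this
    have t2 : Tendsto (fun m : ℕ => ((⌊ξ * (m + 1)⌋₊ + 1 : ℝ) * (1 / (m + 1 : ℝ)))) atTop
        (𝓝 ξ) := by
      have := t1.add t0
      rw [add_zero] at this
      refine this.congr fun m => by ring
    have t3 : Tendsto (fun m => u m ξ) atTop (𝓝 (ENNReal.ofReal (‖fourierInt b ξ‖ / ξ))) := by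
      refine ENNReal.tendsto_ofReal (Tendsto.div ?_ t2 hξ'.ne')
      exact ((continuous_fourierInt hb).norm.tendsto ξ).comp t1
    rw [t3.liminf_eq, ← ofReal_norm, norm_div, Complex.norm_of_nonneg hξ'.le]
  have hbound : ∀ m, ∫⁻ ξ in Ioi (0 : ℝ), u m ξ ≤ ENNReal.ofReal (4 * ∫ x, ‖b x‖) := by
    intro m
    have hm : (0 : ℝ) < m + 1 := by positivity
    set h : ℝ := 1 / (m + 1 : ℝ) with hh
    have hh0 : 0 < h := by positivity
    have hcover : Ioi (0 : ℝ) ⊆ ⋃ n : ℕ, Ico (n * h) ((n + 1) * h) := by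
      intro ξ hξ
      have hξ' : (0 : ℝ) < ξ := hξ
      rw [mem_iUnion]
      refine ⟨⌊ξ * (m + 1)⌋₊, ?_, ?_⟩
      · have := Nat.floor_le (show 0 ≤ ξ * (m + 1) by positivity)
        rw [hh, mul_one_div, div_le_iff₀ hm]
        exact this
      · have := Nat.lt_floor_add_one (ξ * (m + 1))
        rw [hh, mul_one_div, lt_div_iff₀ hm]
        exact this
    have hpiece : ∀ n : ℕ, ∫⁻ ξ in Ico (n * h) ((n + 1) * h), u m ξ =
        ENNReal.ofReal (‖fourierInt b (n * h)‖ / (n + 1 : ℝ)) := by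
      intro n
      have hc : ∀ ξ ∈ Ico (n * h) ((n + 1) * h), u m ξ =
          ENNReal.ofReal (‖fourierInt b (n * h)‖ / ((n + 1 : ℝ) * h)) := by
        intro ξ hξ
        have hfl : ⌊ξ * (m + 1)⌋₊ = n := by
          have h1 := hξ.1
          have h2 := hξ.2
          rw [hh, mul_one_div, div_le_iff₀ hm] at h1
          rw [hh, mul_one_div, lt_div_iff₀ hm] at h2
          rw [Nat.floor_eq_iff (le_trans (by positivity) h1)]
          exact ⟨h1, h2⟩
        simp only [hu, hfl, hh]
      rw [setLIntegral_congr_fun measurableSet_Ico hc, setLIntegral_const, Real.volume_Ico,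
        ← ENNReal.ofReal_mul (by positivity)]
      congr 1
      field_simp
      ring
    calc ∫⁻ ξ in Ioi (0 : ℝ), u m ξ ≤ ∫⁻ ξ in ⋃ n : ℕ, Ico (n * h) ((n + 1) * h), u m ξ :=
          lintegral_mono_set hcover
      _ ≤ ∑' n : ℕ, ∫⁻ ξ in Ico (n * h) ((n + 1) * h), u m ξ := lintegral_iUnion_le _ _
      _ = ∑' n : ℕ, ENNReal.ofReal (‖fourierInt b (n * h)‖ / (n + 1 : ℝ)) :=
          tsum_congr hpiece
      _ ≤ _ := by
          refine ENNReal.tsum_le_of_sum_range_le fun N => ?_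
          rw [← ENNReal.ofReal_sum_of_nonneg fun n _ => by positivity]
          exact ENNReal.ofReal_le_ofReal (sum_fourierInt_le hb h0 hh0 N)
  calc ∫⁻ ξ in Ioi (0 : ℝ), ‖fourierInt b ξ / ξ‖ₑ
      = ∫⁻ ξ in Ioi (0 : ℝ), liminf (fun m => u m ξ) atTop :=
        (setLIntegral_congr_fun measurableSet_Ioi hlim).symm
    _ ≤ liminf (fun m => ∫⁻ ξ in Ioi (0 : ℝ), u m ξ) atTop := lintegral_liminf_le hmeas
    _ ≤ _ := liminf_le_of_frequently_le' (Frequently.of_forall hbound)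

end Fejer

/-! ### Analytic functions on the upper half-plane -/

/-- The open upper half-plane. -/
abbrev uhp : Set ℂ := {z | 0 < z.im}

theorem isOpen_uhp : IsOpen uhp := isOpen_lt continuous_const Complex.continuous_im

theorem add_mul_I_mem_uhp (x : ℝ) {y : ℝ} (hy : 0 < y) : (x + y * Complex.I : ℂ) ∈ uhp := by
  simpa using hy

theorem continuous_comp_line {f : ℂ → ℂ} (hf : ContinuousOn f uhp) {y : ℝ} (hy : 0 < y) :
    Continuous fun x : ℝ => f (x + y * Complex.I) :=
  hf.comp_continuous (by fun_prop) fun x => add_mul_I_mem_uhp x hy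

/-- The integral over a horizontal line of a function that is analytic above it and decays
quadratically vanishes. -/
theorem integral_line_eq_zero {Φ : ℂ → ℂ} {c : ℝ} (hc : 0 ≤ c)
    (hΦ : DifferentiableOn ℂ Φ {z | c ≤ z.im}) {C R₀ : ℝ}
    (hb : ∀ z : ℂ, c ≤ z.im → R₀ ≤ ‖z‖ → ‖Φ z‖ ≤ C / ‖z‖ ^ 2) :
    ∫ x : ℝ, Φ (x + c * Complex.I) = 0 := by
  -- Without integrability the integral is zero by convention.
  by_cases hint : Integrable fun x : ℝ => Φ (x + c * Complex.I)
  swap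
  · exact integral_undef hint
  have t1 : Tendsto (fun R : ℝ => ∫ x in (-R)..R, Φ (x + c * Complex.I)) atTop
      (𝓝 (∫ x : ℝ, Φ (x + c * Complex.I))) :=
    intervalIntegral_tendsto_integral hint tendsto_neg_atTop_atBot tendsto_id
  have hle : ∀ᶠ R : ℝ in atTop, ‖∫ x in (-R)..R, Φ (x + c * Complex.I)‖ ≤ 4 * |C| / R := by
    filter_upwards [eventually_gt_atTop 0, eventually_ge_atTop R₀] with R hR hR0
    have hbd : ∀ z : ℂ, c ≤ z.im → R ≤ ‖z‖ → ‖Φ z‖ ≤ |C| / R ^ 2 := by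
      intro z hz hzR
      refine (hb z hz (hR0.trans hzR)).trans ?_
      have : 0 < ‖z‖ := hR.trans_le hzR
      calc C / ‖z‖ ^ 2 ≤ |C| / ‖z‖ ^ 2 := by gcongr; exact le_abs_self C
        _ ≤ |C| / R ^ 2 := by gcongr
    -- Cauchy's theorem on `[-R, R] × [c, c + R]`: on the three other sides `|Φ| ≤ |C|/R²`, and
    -- their total length is `4R`.
    have rect := Complex.integral_boundary_rect_eq_zero_of_differentiableOn Φ
      (-R + c * Complex.I) (R + (c + R) * Complex.I) (by
        refine hΦ.mono fun z hz => ?_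
        have := (Complex.mem_reProdIm.1 hz).2
        simp only [Complex.add_im, Complex.neg_im, Complex.ofReal_im, Complex.mul_im,
          Complex.I_im, Complex.ofReal_re, Complex.I_re, Complex.add_re] at this
        norm_num at this
        rw [uIcc_of_le (by linarith)] at this
        exact this.1)
    simp only [Complex.add_im, Complex.neg_im, Complex.ofReal_im, Complex.mul_im,
      Complex.I_im, Complex.ofReal_re, Complex.I_re, Complex.add_re, Complex.neg_re,
      Complex.mul_re, mul_zero, mul_one, add_zero, sub_zero, neg_zero, zero_add] at rect
    have e1 : ‖∫ x in (-R)..R, Φ (x + (c + R : ℝ) * Complex.I)‖ ≤ |C| / R ^ 2 * |R - -R| := by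
      refine intervalIntegral.norm_integral_le_of_norm_le_const fun x _ => hbd _ ?_ ?_
      · simp; linarith
      · refine le_trans ?_ (Complex.abs_im_le_norm _)
        simp
        rw [abs_of_nonneg (by linarith)]
        linarith
    have e2 : ‖∫ y in c..(c + R), Φ (R + y * Complex.I)‖ ≤ |C| / R ^ 2 * |c + R - c| := by
      refine intervalIntegral.norm_integral_le_of_norm_le_const fun x hx => hbd _ ?_ ?_
      · rw [uIoc_of_le (by linarith)] at hx
        simpa using hx.1.le
      · refine le_trans ?_ (Complex.abs_re_le_norm _)
        simp [le_abs_self]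
    have e3 : ‖∫ y in c..(c + R), Φ ((-R : ℝ) + y * Complex.I)‖ ≤ |C| / R ^ 2 * |c + R - c| := by
      refine intervalIntegral.norm_integral_le_of_norm_le_const fun x hx => hbd _ ?_ ?_
      · rw [uIoc_of_le (by linarith)] at hx
        simpa using hx.1.le
      · refine le_trans ?_ (Complex.abs_re_le_norm _)
        simp [le_abs_self]
    have h4 : (∫ x in (-R)..R, Φ (x + c * Complex.I)) =
        (∫ x in (-R)..R, Φ (x + (c + R : ℝ) * Complex.I)) -
          Complex.I • (∫ y in c..(c + R), Φ (R + y * Complex.I)) +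
          Complex.I • (∫ y in c..(c + R), Φ ((-R : ℝ) + y * Complex.I)) := by
      linear_combination (norm := skip) rect
      push_cast
      ring
    rw [h4]
    refine (norm_add_le _ _).trans ((add_le_add (norm_sub_le _ _) le_rfl).trans ?_)
    rw [norm_smul, norm_smul, Complex.norm_I, one_mul, one_mul]
    refine (add_le_add (add_le_add e1 e2) e3).trans (le_of_eq ?_)
    rw [abs_of_nonneg (by linarith : (0 : ℝ) ≤ R - -R),
      abs_of_nonneg (by linarith : (0 : ℝ) ≤ c + R - c)]
    field_simp
    ring
  have t2 : Tendsto (fun R : ℝ => 4 * |C| / R) atTop (𝓝 0) :=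
    tendsto_const_nhds.div_atTop tendsto_id
  exact tendsto_nhds_unique t1 (squeeze_zero_norm' hle t2)

theorem integrable_inv_one_add_sq_mul {f : ℝ → ℂ} (hf : Continuous f) {B : ℝ}
    (hB : ∀ x, ‖f x‖ ≤ B) : Integrable fun x : ℝ => ((1 + x ^ 2 : ℝ)⁻¹ : ℂ) * f x := by
  have h1 : Integrable fun x : ℝ => (((1 + x ^ 2)⁻¹ : ℝ) : ℂ) := integrable_inv_one_add_sq.ofReal
  have := h1.mul_bdd (c := B) hf.aestronglyMeasurable (ae_of_all _ hB)
  simpa using this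

/-! ### Square roots of functions with nonnegative real part -/

section Sqrt

variable {F : ℂ → ℂ} {L : ℝ}

/-- A square root of `1 + F`. -/
noncomputable def sqrtOneAdd (F : ℂ → ℂ) (z : ℂ) : ℂ := (1 + F z) ^ (1 / 2 : ℂ)

theorem sqrtOneAdd_sq (F : ℂ → ℂ) (z : ℂ) : sqrtOneAdd F z ^ 2 = 1 + F z := by
  rw [sqrtOneAdd, ← Complex.cpow_nat_mul]; norm_num

theorem sqrtOneAdd_re_nonneg (F : ℂ → ℂ) (z : ℂ) : 0 ≤ (sqrtOneAdd F z).re := by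
  rw [sqrtOneAdd]
  by_cases h : 1 + F z = 0
  · rw [h]; norm_num
  · rw [Complex.cpow_def_of_ne_zero h, Complex.exp_re]
    refine mul_nonneg (Real.exp_pos _).le (Real.cos_nonneg_of_mem_Icc ?_)
    have h1 := Complex.neg_pi_lt_arg (1 + F z)
    have h2 := Complex.arg_le_pi (1 + F z)
    have : (Complex.log (1 + F z) * (1 / 2 : ℂ)).im = (1 + F z).arg / 2 := by
      rw [show (1 / 2 : ℂ) = ((1 / 2 : ℝ) : ℂ) by norm_num, Complex.im_mul_ofReal, Complex.log_im]
      ring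
    rw [this]
    constructor <;> linarith

/-- The square of the root has positive real part, so its imaginary part is smaller in modulus than
its real part. This lets a mean of the real part control the mean of the modulus. -/
theorem norm_sqrtOneAdd_le_re {z : ℂ} (h : 0 ≤ (F z).re) :
    ‖sqrtOneAdd F z‖ ≤ 2 * (sqrtOneAdd F z).re := by
  have h1 := congrArg Complex.re (sqrtOneAdd_sq F z)
  have h2 := sqrtOneAdd_re_nonneg F z
  rw [sq] at h1
  simp only [Complex.mul_re, Complex.add_re, Complex.one_re] at h1
  refine le_of_sq_le_sq ?_ (by linarith)
  rw [Complex.sq_norm, Complex.normSq_apply]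
  nlinarith

theorem norm_sqrtOneAdd_le {z : ℂ} {A : ℝ} (h : ‖F z‖ ≤ A) : ‖sqrtOneAdd F z‖ ≤ 1 + A := by
  have h1 : ‖sqrtOneAdd F z‖ ^ 2 ≤ 1 + A := by
    rw [← norm_pow, sqrtOneAdd_sq]
    exact (norm_add_le _ _).trans (by simpa using h)
  have h2 : 0 ≤ A := (norm_nonneg _).trans h
  nlinarith [norm_nonneg (sqrtOneAdd F z)]

theorem differentiableOn_sqrtOneAdd (hF : DifferentiableOn ℂ F uhp)
    (hre : ∀ z ∈ uhp, 0 ≤ (F z).re) : DifferentiableOn ℂ (sqrtOneAdd F) uhp := by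
  refine DifferentiableOn.cpow ((differentiableOn_const 1).add hF) (differentiableOn_const _)
    fun z hz => Or.inl ?_
  have := hre z hz
  simp only [Complex.add_re, Complex.one_re]
  linarith

/-- Kolmogorov's estimate. -/
theorem integral_sqrtOneAdd_le (hF : DifferentiableOn ℂ F uhp)
    (hre : ∀ z ∈ uhp, 0 ≤ (F z).re) (hL : ∀ z ∈ uhp, ‖F z‖ ≤ L / z.im) {δ : ℝ} (hδ : 0 < δ)
    (hδ1 : δ ≤ 1) :
    Integrable (fun x : ℝ => ‖sqrtOneAdd F (x + δ * Complex.I)‖ / (1 + x ^ 2)) ∧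
    ∫ x : ℝ, ‖sqrtOneAdd F (x + δ * Complex.I)‖ / (1 + x ^ 2) ≤ 2 * Real.pi * (1 + L) := by
  set S := sqrtOneAdd F with hS
  have hSd := differentiableOn_sqrtOneAdd hF hre
  have hL0 : 0 ≤ L := by
    have := (norm_nonneg _).trans (hL Complex.I (by simp))
    simpa using this
  have hSb : ∀ z : ℂ, δ ≤ z.im → ‖S z‖ ≤ 1 + L / δ := by
    intro z hz
    refine norm_sqrtOneAdd_le ((hL z (hδ.trans_le hz)).trans ?_)
    gcongr
  have hB0 : 0 ≤ 1 + L / δ := by positivity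
  -- The point at height `1` above the line `Im z = δ`: its Poisson kernel on that line is a
  -- multiple of `1/(1 + x²)`, and `|F(z₀)| ≤ L` uniformly in `δ`.
  set z₀ : ℂ := (1 + δ : ℝ) * Complex.I with hz₀
  have hz₀m : z₀ ∈ uhp := by simp [hz₀]; linarith
  have hz₀n : ‖z₀‖ ≤ 2 := by
    rw [hz₀, norm_mul, Complex.norm_I, mul_one, Complex.norm_of_nonneg (by linarith)]; linarith
  have hSz₀ : ‖S z₀‖ ≤ 1 + L / δ := hSb z₀ (by simp [hz₀])
  have hSz₀' : ‖S z₀‖ ≤ 1 + L := by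
    refine norm_sqrtOneAdd_le ((hL z₀ hz₀m).trans ?_)
    refine div_le_self hL0 ?_
    simp [hz₀]; linarith
  have hds : DifferentiableOn ℂ (dslope S z₀) uhp :=
    (Complex.differentiableOn_dslope (isOpen_uhp.mem_nhds hz₀m)).2 hSd
  -- The other pole is the reflection of `z₀` in the line, hence below it. The vanishing integral is
  -- the mean value formula `∫ S/(1 + x²) = π S(z₀)`.
  have hzero : ∫ x : ℝ, (fun z => dslope S z₀ z / (z + (1 - δ : ℝ) * Complex.I))
      (x + δ * Complex.I) = 0 := by
    refine integral_line_eq_zero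
      (Φ := fun z => dslope S z₀ z / (z + (1 - δ : ℝ) * Complex.I)) hδ.le (C := 8 * (1 + L / δ)) (R₀ := 4) ?_ fun z hz hzn => ?_
    · refine (hds.mono fun z hz => hδ.trans_le hz).div ?_ fun z hz h => ?_
      · exact differentiableOn_id.add (differentiableOn_const _)
      · have := congrArg Complex.im h
        simp at this
        have hz' : δ ≤ z.im := hz
        linarith
    · have hne : z ≠ z₀ := by rintro rfl; linarith
      rw [dslope_of_ne _ hne, slope, vsub_eq_sub, smul_eq_mul, norm_div, norm_mul, norm_inv]
      have h1 : ‖z‖ / 2 ≤ ‖z - z₀‖ := by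
        have := norm_sub_norm_le z z₀
        linarith
      have h2 : ‖z‖ / 2 ≤ ‖z + (1 - δ : ℝ) * Complex.I‖ := by
        have := norm_sub_norm_le z (-((1 - δ : ℝ) * Complex.I))
        rw [sub_neg_eq_add, norm_neg, norm_mul, Complex.norm_I, mul_one,
          Complex.norm_of_nonneg (by linarith)] at this
        linarith
      have h3 : ‖S z - S z₀‖ ≤ 2 * (1 + L / δ) :=
        (norm_sub_le _ _).trans (by linarith [hSb z hz])
      have h4 : 0 < ‖z‖ / 2 := by linarith
      calc ‖z - z₀‖⁻¹ * ‖S z - S z₀‖ / ‖z + (1 - δ : ℝ) * Complex.I‖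
          ≤ (‖z‖ / 2)⁻¹ * (2 * (1 + L / δ)) / (‖z‖ / 2) := by gcongr
        _ = _ := by field_simp; ring
  have hline : ∀ x : ℝ, (fun z => dslope S z₀ z / (z + (1 - δ : ℝ) * Complex.I))
      (x + δ * Complex.I) =
      ((1 + x ^ 2 : ℝ)⁻¹ : ℂ) * S (x + δ * Complex.I) - ((1 + x ^ 2 : ℝ)⁻¹ : ℂ) * S z₀ := by
    intro x
    have hsub : (x + δ * Complex.I : ℂ) - z₀ = x - Complex.I := by rw [hz₀]; push_cast; ring
    have hadd : (x + δ * Complex.I : ℂ) + (1 - δ : ℝ) * Complex.I = x + Complex.I := by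
      push_cast; ring
    have hne1 : (x - Complex.I : ℂ) ≠ 0 := fun h => by
      have := congrArg Complex.im h; simp at this
    have hne2 : (x + Complex.I : ℂ) ≠ 0 := fun h => by
      have := congrArg Complex.im h; simp at this
    have hne : (x + δ * Complex.I : ℂ) ≠ z₀ := fun h => hne1 (by rw [← hsub, h, sub_self])
    have hprod : ((1 + x ^ 2 : ℝ) : ℂ) = (x - Complex.I) * (x + Complex.I) := by
      push_cast; ring_nf; simp; ring
    simp only
    rw [dslope_of_ne _ hne, slope, vsub_eq_sub, smul_eq_mul, hsub, hadd, hprod]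
    field_simp
  simp_rw [hline] at hzero
  have hScont : Continuous fun x : ℝ => S (x + δ * Complex.I) :=
    continuous_comp_line hSd.continuousOn hδ
  have hSbx : ∀ x : ℝ, ‖S (x + δ * Complex.I)‖ ≤ 1 + L / δ := fun x => hSb _ (by simp)
  have i1 := integrable_inv_one_add_sq_mul hScont hSbx
  have i2 := integrable_inv_one_add_sq_mul (continuous_const (y := S z₀)) fun _ => hSz₀
  rw [integral_sub i1 i2, sub_eq_zero] at hzero
  have hconst : ∫ x : ℝ, ((1 + x ^ 2 : ℝ)⁻¹ : ℂ) * S z₀ = Real.pi * S z₀ := by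
    rw [integral_mul_const]
    congr 1
    have : ∀ x : ℝ, ((1 + x ^ 2 : ℝ)⁻¹ : ℂ) = (((1 + x ^ 2)⁻¹ : ℝ) : ℂ) := fun x => by simp
    simp_rw [this]
    rw [integral_complex_ofReal, integral_univ_inv_one_add_sq]
  have hre2 : ∫ x : ℝ, (((1 + x ^ 2 : ℝ)⁻¹ : ℂ) * S (x + δ * Complex.I)).re =
      Real.pi * (S z₀).re := by
    have := integral_re i1
    simp only [RCLike.re_to_complex] at this
    rw [this, hzero, hconst, Complex.re_ofReal_mul]
  have hnorm : ∀ x : ℝ, ‖S (x + δ * Complex.I)‖ / (1 + x ^ 2) =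
      ‖((1 + x ^ 2 : ℝ)⁻¹ : ℂ) * S (x + δ * Complex.I)‖ := by
    intro x
    rw [norm_mul, norm_inv, Complex.norm_of_nonneg (by positivity)]
    ring
  have i3 : Integrable (fun x : ℝ => ‖S (x + δ * Complex.I)‖ / (1 + x ^ 2)) := by
    simp_rw [hnorm]; exact i1.norm
  refine ⟨i3, ?_⟩
  calc ∫ x : ℝ, ‖S (x + δ * Complex.I)‖ / (1 + x ^ 2)
      ≤ ∫ x : ℝ, 2 * (((1 + x ^ 2 : ℝ)⁻¹ : ℂ) * S (x + δ * Complex.I)).re := by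
        refine integral_mono i3 (i1.re.const_mul 2) fun x => ?_
        have h := norm_sqrtOneAdd_le_re (hre _ (add_mul_I_mem_uhp x hδ))
        simp only
        rw [← Complex.ofReal_inv, Complex.re_ofReal_mul, div_eq_inv_mul]
        have : 0 < (1 + x ^ 2)⁻¹ := by positivity
        nlinarith
    _ = 2 * (Real.pi * (S z₀).re) := by rw [integral_const_mul, hre2]
    _ ≤ 2 * (Real.pi * (1 + L)) := by
        gcongr
        exact (Complex.re_le_norm _).trans hSz₀'
    _ = _ := by ring

end Sqrt

/-! ### Smirnov's theorem -/

/-- Analytic functions on the upper half-plane that become bounded after multiplication by bounded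
analytic functions close to `1`. -/
def Regularizable (F : ℂ → ℂ) : Prop :=
  DifferentiableOn ℂ F uhp ∧ ∀ ε > 0, ∃ (N : ℂ → ℂ) (M : ℝ), DifferentiableOn ℂ N uhp ∧
    (∀ z ∈ uhp, ‖N z‖ ≤ 1 ∧ ‖N z * F z‖ ≤ M) ∧
    ∀ δ ∈ Ioc (0 : ℝ) 1, ∫ x : ℝ, ‖1 - N (x + δ * Complex.I)‖ / (1 + x ^ 2) ≤ ε

theorem Regularizable.congr {F G : ℂ → ℂ} (hF : Regularizable F) (h : EqOn G F uhp) :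
    Regularizable G := by
  refine ⟨hF.1.congr h, fun ε hε => ?_⟩
  obtain ⟨N, M, h1, h2, h3⟩ := hF.2 ε hε
  exact ⟨N, M, h1, fun z hz => by rw [h hz]; exact h2 z hz, h3⟩

theorem Regularizable.const_mul {F : ℂ → ℂ} (hF : Regularizable F) (c : ℂ) :
    Regularizable fun z => c * F z := by
  refine ⟨hF.1.const_mul c, fun ε hε => ?_⟩
  obtain ⟨N, M, h1, h2, h3⟩ := hF.2 ε hε
  refine ⟨N, ‖c‖ * M, h1, fun z hz => ⟨(h2 z hz).1, ?_⟩, h3⟩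
  rw [mul_left_comm, norm_mul]
  gcongr
  exact (h2 z hz).2

theorem integrable_one_sub_div {N : ℂ → ℂ} (hN : DifferentiableOn ℂ N uhp)
    (hN1 : ∀ z ∈ uhp, ‖N z‖ ≤ 1) {δ : ℝ} (hδ : 0 < δ) :
    Integrable fun x : ℝ => ‖1 - N (x + δ * Complex.I)‖ / (1 + x ^ 2) := by
  have := (integrable_inv_one_add_sq_mul (f := fun x => 1 - N (x + δ * Complex.I)) (B := 2)
    (continuous_const.sub (continuous_comp_line hN.continuousOn hδ)) fun x => ?_).norm
  · refine this.congr (ae_of_all _ fun x => ?_)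
    simp only
    rw [norm_mul, norm_inv, Complex.norm_of_nonneg (by positivity)]
    ring
  · refine (norm_sub_le _ _).trans ?_
    have := hN1 _ (add_mul_I_mem_uhp x hδ)
    rw [norm_one]
    linarith

theorem Regularizable.add {F G : ℂ → ℂ} (hF : Regularizable F) (hG : Regularizable G) :
    Regularizable fun z => F z + G z := by
  refine ⟨hF.1.add hG.1, fun ε hε => ?_⟩
  obtain ⟨N, M, h1, h2, h3⟩ := hF.2 (ε / 2) (by positivity)
  obtain ⟨N', M', h1', h2', h3'⟩ := hG.2 (ε / 2) (by positivity)
  -- The product regularizes both summands, each multiplier being bounded by `1`, and `1 - N N' = (1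
  -- - N) + N (1 - N')` adds the two errors.
  refine ⟨fun z => N z * N' z, M + M', h1.mul h1', fun z hz => ⟨?_, ?_⟩, fun δ hδ => ?_⟩
  · rw [norm_mul]
    exact mul_le_one₀ (h2 z hz).1 (norm_nonneg _) (h2' z hz).1
  · have e : N z * N' z * (F z + G z) = N' z * (N z * F z) + N z * (N' z * G z) := by ring
    rw [e]
    refine (norm_add_le _ _).trans (add_le_add ?_ ?_)
    · rw [norm_mul]
      exact (mul_le_of_le_one_left (norm_nonneg _) (h2' z hz).1).trans (h2 z hz).2
    · rw [norm_mul]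
      exact (mul_le_of_le_one_left (norm_nonneg _) (h2 z hz).1).trans (h2' z hz).2
  · have i1 := integrable_one_sub_div h1 (fun z hz => (h2 z hz).1) hδ.1
    have i2 := integrable_one_sub_div h1' (fun z hz => (h2' z hz).1) hδ.1
    have i3 := integrable_one_sub_div (N := fun z => N z * N' z) (h1.mul h1') (fun z hz => by
      rw [norm_mul]; exact mul_le_one₀ (h2 z hz).1 (norm_nonneg _) (h2' z hz).1) hδ.1
    calc _ ≤ ∫ x : ℝ, (‖1 - N (x + δ * Complex.I)‖ / (1 + x ^ 2) +
            ‖1 - N' (x + δ * Complex.I)‖ / (1 + x ^ 2)) := by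
          refine integral_mono i3 (i1.add i2) fun x => ?_
          simp only
          rw [← add_div]
          gcongr
          have hz := add_mul_I_mem_uhp x hδ.1
          have e : 1 - N (x + δ * Complex.I) * N' (x + δ * Complex.I) =
            (1 - N (x + δ * Complex.I)) +
              N (x + δ * Complex.I) * (1 - N' (x + δ * Complex.I)) := by ring
          rw [e]
          refine (norm_add_le _ _).trans (add_le_add le_rfl ?_)
          rw [norm_mul]
          exact mul_le_of_le_one_left (norm_nonneg _) (h2 _ hz).1
      _ ≤ ε / 2 + ε / 2 := by
          rw [integral_add i1 i2]
          exact add_le_add (h3 δ hδ) (h3' δ hδ)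
      _ = ε := by ring

/-- The multiplier is `N = 1/(1 + η²F)`. Since `Re F ≥ 0`, both `1` and `η²|F|` are at most `|1 +
η²F|`, so `|N| ≤ 1`, `|N F| ≤ η⁻²` and `|1 - N| ≤ min(1, η²|F|) ≤ η |1 + F|^{1/2}`. Kolmogorov's
estimate bounds the weighted integral of the last quantity by `2π(1 + L) η`. -/
theorem regularizable_of_re_nonneg {F : ℂ → ℂ} {L : ℝ} (hF : DifferentiableOn ℂ F uhp)
    (hre : ∀ z ∈ uhp, 0 ≤ (F z).re) (hL : ∀ z ∈ uhp, ‖F z‖ ≤ L / z.im) : Regularizable F := by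
  have hL0 : 0 ≤ L := by
    have := (norm_nonneg _).trans (hL Complex.I (by simp))
    simpa using this
  refine ⟨hF, fun ε hε => ?_⟩
  set η : ℝ := ε / (2 * Real.pi * (1 + L)) with hη
  have hη0 : 0 < η := by positivity
  have hre1 : ∀ z ∈ uhp, 1 ≤ (1 + (η ^ 2 : ℝ) * F z).re := by
    intro z hz
    rw [Complex.add_re, Complex.one_re, Complex.re_ofReal_mul]
    have := hre z hz
    nlinarith [sq_nonneg η]
  have hn1 : ∀ z ∈ uhp, 1 ≤ ‖1 + (η ^ 2 : ℝ) * F z‖ := fun z hz =>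
    (hre1 z hz).trans (Complex.re_le_norm _)
  have hn2 : ∀ z ∈ uhp, η ^ 2 * ‖F z‖ ≤ ‖1 + (η ^ 2 : ℝ) * F z‖ := by
    intro z hz
    refine le_of_sq_le_sq ?_ (norm_nonneg _)
    rw [Complex.sq_norm, Complex.normSq_add, mul_pow, Complex.sq_norm]
    have := hre z hz
    simp only [map_one, map_mul, Complex.normSq_ofReal, one_mul, Complex.conj_re, Complex.conj_ofReal,
      Complex.re_ofReal_mul]
    nlinarith [mul_nonneg (sq_nonneg η) this]
  have hne : ∀ z ∈ uhp, 1 + (η ^ 2 : ℝ) * F z ≠ 0 := fun z hz h => by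
    have := hn1 z hz
    rw [h] at this
    simp at this
    linarith
  have hNd : DifferentiableOn ℂ (fun z => (1 + (η ^ 2 : ℝ) * F z)⁻¹) uhp :=
    ((differentiableOn_const 1).add (hF.const_mul _)).inv hne
  have hN1 : ∀ z ∈ uhp, ‖(1 + (η ^ 2 : ℝ) * F z)⁻¹‖ ≤ 1 := fun z hz => by
    rw [norm_inv]; exact inv_le_one_of_one_le₀ (hn1 z hz)
  refine ⟨fun z => (1 + (η ^ 2 : ℝ) * F z)⁻¹, (η ^ 2)⁻¹, hNd, fun z hz => ⟨hN1 z hz, ?_⟩,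
    fun δ hδ => ?_⟩
  · have h1 : 0 < ‖1 + (η ^ 2 : ℝ) * F z‖ := zero_lt_one.trans_le (hn1 z hz)
    rw [norm_mul, norm_inv, inv_mul_le_iff₀ h1, ← div_eq_mul_inv, le_div_iff₀ (by positivity),
      mul_comm]
    exact hn2 z hz
  · obtain ⟨i1, h1⟩ := integral_sqrtOneAdd_le hF hre hL hδ.1 hδ.2
    calc _ ≤ ∫ x : ℝ, η * (‖sqrtOneAdd F (x + δ * Complex.I)‖ / (1 + x ^ 2)) := by
          refine integral_mono (integrable_one_sub_div hNd hN1 hδ.1) (i1.const_mul η) fun x => ?_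
          simp only
          rw [← mul_div_assoc]
          gcongr
          have hz := add_mul_I_mem_uhp x hδ.1
          generalize (x + δ * Complex.I : ℂ) = z at hz
          have h1 : 0 < ‖1 + (η ^ 2 : ℝ) * F z‖ := zero_lt_one.trans_le (hn1 z hz)
          have e : 1 - (1 + (η ^ 2 : ℝ) * F z)⁻¹ =
              (η ^ 2 : ℝ) * F z / (1 + (η ^ 2 : ℝ) * F z) := by
            have := hne z hz
            field_simp
            ring
          have e2 : ‖1 - (1 + (η ^ 2 : ℝ) * F z)⁻¹‖ =
              η ^ 2 * ‖F z‖ / ‖1 + (η ^ 2 : ℝ) * F z‖ := by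
            rw [e, norm_div, norm_mul, Complex.norm_of_nonneg (by positivity)]
          rw [e2]
          have q1 : η ^ 2 * ‖F z‖ / ‖1 + (η ^ 2 : ℝ) * F z‖ ≤ 1 := by
            rw [div_le_one h1]; exact hn2 z hz
          have q2 : η ^ 2 * ‖F z‖ / ‖1 + (η ^ 2 : ℝ) * F z‖ ≤ η ^ 2 * ‖F z‖ :=
            div_le_self (by positivity) (hn1 z hz)
          have q0 : 0 ≤ η ^ 2 * ‖F z‖ / ‖1 + (η ^ 2 : ℝ) * F z‖ := by positivity
          have q3 : ‖F z‖ ≤ ‖sqrtOneAdd F z‖ ^ 2 := by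
            rw [← norm_pow, sqrtOneAdd_sq]
            refine le_of_sq_le_sq ?_ (norm_nonneg _)
            rw [Complex.sq_norm, Complex.sq_norm, Complex.normSq_add]
            have := hre z hz
            simp
            linarith
          refine le_of_sq_le_sq ?_ (by positivity)
          rw [mul_pow]
          calc _ ≤ η ^ 2 * ‖F z‖ / ‖1 + (η ^ 2 : ℝ) * F z‖ := by nlinarith
            _ ≤ η ^ 2 * ‖F z‖ := q2
            _ ≤ _ := by gcongr
      _ ≤ η * (2 * Real.pi * (1 + L)) := by
          rw [integral_const_mul]
          gcongr
      _ = ε := by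
          rw [hη]
          field_simp

/-- An exponential with a quadratically decaying analytic factor. -/
noncomputable def decayExp (ξ η : ℝ) (z : ℂ) : ℂ :=
  Complex.exp (-(Complex.I * ξ * z)) / (1 - Complex.I * η * z) ^ 2

theorem one_sub_I_mul_normSq (η : ℝ) (z : ℂ) :
    ‖1 - Complex.I * η * z‖ ^ 2 = (1 + η * z.im) ^ 2 + η ^ 2 * z.re ^ 2 := by
  rw [Complex.sq_norm, Complex.normSq_apply]
  simp
  ring

theorem one_le_norm_one_sub {η : ℝ} (hη : 0 ≤ η) {z : ℂ} (hz : 0 ≤ z.im) :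
    1 ≤ ‖1 - Complex.I * η * z‖ := by
  refine le_of_sq_le_sq ?_ (norm_nonneg _)
  rw [one_sub_I_mul_normSq]
  have : 0 ≤ η * z.im := by positivity
  nlinarith [mul_nonneg (sq_nonneg η) (sq_nonneg z.re)]

theorem norm_exp_neg_le_one {ξ : ℝ} (hξ : ξ ≤ 0) {z : ℂ} (hz : 0 ≤ z.im) :
    ‖Complex.exp (-(Complex.I * ξ * z))‖ ≤ 1 := by
  rw [Complex.norm_exp]
  simp
  nlinarith

theorem norm_decayExp_le_one {ξ η : ℝ} (hξ : ξ ≤ 0) (hη : 0 ≤ η) {z : ℂ} (hz : 0 ≤ z.im) :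
    ‖decayExp ξ η z‖ ≤ 1 := by
  rw [decayExp, norm_div, norm_pow]
  exact div_le_one_of_le₀ ((norm_exp_neg_le_one hξ hz).trans
    (one_le_pow₀ (one_le_norm_one_sub hη hz))) (by positivity)

theorem norm_decayExp_le {ξ η : ℝ} (hξ : ξ ≤ 0) (hη : 0 < η) (hη1 : η ≤ 1) {z : ℂ}
    (hz : 0 ≤ z.im) : ‖decayExp ξ η z‖ ≤ (η ^ 2)⁻¹ * (1 + z.re ^ 2)⁻¹ := by
  rw [decayExp, norm_div, norm_pow, one_sub_I_mul_normSq, ← mul_inv, ← one_div]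
  have h1 := norm_exp_neg_le_one hξ hz
  have h2 : η ^ 2 * (1 + z.re ^ 2) ≤ (1 + η * z.im) ^ 2 + η ^ 2 * z.re ^ 2 := by
    have : 0 ≤ η * z.im := by positivity
    nlinarith
  gcongr

theorem norm_decayExp_le' {ξ η : ℝ} (hξ : ξ ≤ 0) (hη : 0 < η) {z : ℂ}
    (hz : 0 ≤ z.im) (hz0 : z ≠ 0) : ‖decayExp ξ η z‖ ≤ (η ^ 2)⁻¹ / ‖z‖ ^ 2 := by
  rw [decayExp, norm_div, norm_pow, one_sub_I_mul_normSq, div_eq_mul_inv (η ^ 2)⁻¹, ← mul_inv,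
    ← one_div]
  have h1 := norm_exp_neg_le_one hξ hz
  have h2 : η ^ 2 * ‖z‖ ^ 2 ≤ (1 + η * z.im) ^ 2 + η ^ 2 * z.re ^ 2 := by
    rw [Complex.sq_norm, Complex.normSq_apply]
    have : 0 ≤ η * z.im := by positivity
    nlinarith
  have h3 : 0 < ‖z‖ := norm_pos_iff.2 hz0
  gcongr

theorem one_sub_ne_zero' {η : ℝ} (hη : 0 ≤ η) {z : ℂ} (hz : 0 ≤ z.im) :
    1 - Complex.I * η * z ≠ 0 := fun h => by
  have := one_le_norm_one_sub hη hz
  rw [h] at this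
  simp at this
  linarith

theorem differentiableOn_decayExp (ξ : ℝ) {η : ℝ} (hη : 0 ≤ η) :
    DifferentiableOn ℂ (decayExp ξ η) {z | 0 ≤ z.im} := by
  refine DifferentiableOn.div (by fun_prop) (by fun_prop) fun z hz =>
    pow_ne_zero 2 (one_sub_ne_zero' hη hz)

theorem tendsto_integral_max_sub {b : ℝ → ℂ} (hb : Integrable b) :
    Tendsto (fun K : ℕ => ∫ x, max (‖b x‖ - K) 0) atTop (𝓝 0) := by
  have : Tendsto (fun K : ℕ => ∫ x, max (‖b x‖ - K) 0) atTop (𝓝 (∫ _ : ℝ, (0 : ℝ))) := by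
    refine tendsto_integral_of_dominated_convergence (fun x => ‖b x‖) (fun K => ?_) hb.norm
      (fun K => ae_of_all _ fun x => ?_) (ae_of_all _ fun x => ?_)
    · exact (hb.norm.aestronglyMeasurable.sub aestronglyMeasurable_const).sup
        aestronglyMeasurable_const
    · rw [Real.norm_of_nonneg (le_max_right _ _)]
      exact max_le (by linarith [(Nat.cast_nonneg K : (0 : ℝ) ≤ K)]) (norm_nonneg _)
    · refine tendsto_const_nhds.congr' ?_
      filter_upwards [eventually_ge_atTop ⌈‖b x‖⌉₊] with K hK
      rw [max_eq_right]
      have := Nat.ceil_le.1 hK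
      linarith
  simpa using this

/-- With `q` the damped exponential, `N F q` is analytic with quadratic decay, so its integral over
each line at height `δ > 0` is zero. Hence `∫ b q` equals `∫ (1 - N) b q` plus the integral of `N (b
q - F q)`. The latter tends to zero by dominated convergence since `N F` is bounded. In the former,
the part of `|b|` below `K` is paid by the smallness of `1 - N`, the excess over `K` by `|1 - N| ≤
2`. -/
theorem norm_integral_mul_decayExp_le {F : ℂ → ℂ} {b : ℝ → ℂ} (hF : Regularizable F)
    (hb : Integrable b)
    (hlim : ∀ᵐ x : ℝ, Tendsto (fun y : ℝ => F (x + y * Complex.I)) (𝓝[>] 0) (𝓝 (b x)))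
    {ξ η : ℝ} (hξ : ξ ≤ 0) (hη : 0 < η) (hη1 : η ≤ 1) {K : ℝ} (hK : 0 ≤ K) {ε : ℝ} (hε : 0 < ε) :
    ‖∫ x : ℝ, b x * decayExp ξ η x‖ ≤ K * (η ^ 2)⁻¹ * ε + 2 * ∫ x, max (‖b x‖ - K) 0 := by
  obtain ⟨N, M, hN, hNM, hNε⟩ := hF.2 ε hε
  set q := decayExp ξ η with hq
  have hqd : DifferentiableOn ℂ q uhp := (differentiableOn_decayExp ξ hη.le).mono
    fun z (hz : 0 < z.im) => hz.le
  have hqc : ContinuousOn q {z | 0 ≤ z.im} := (differentiableOn_decayExp ξ hη.le).continuousOn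
  have hq0c : Continuous fun x : ℝ => q x :=
    hqc.comp_continuous (by fun_prop) fun x => by simp
  set δ : ℕ → ℝ := fun n => 1 / (n + 1 : ℝ) with hδ
  have hδ0 : ∀ n, 0 < δ n := fun n => by positivity
  have hδ1 : ∀ n, δ n ≤ 1 := fun n => by
    rw [hδ]; exact div_le_one_of_le₀ (by linarith [(Nat.cast_nonneg n : (0 : ℝ) ≤ n)]) (by positivity)
  have hδt : Tendsto δ atTop (𝓝[>] 0) :=
    tendsto_nhdsWithin_iff.2 ⟨tendsto_one_div_add_atTop_nhds_zero_nat, Eventually.of_forall hδ0⟩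
  have hM0 : 0 ≤ M := (norm_nonneg _).trans (hNM Complex.I (by simp)).2
  have hbq : Integrable fun x : ℝ => b x * q x := by
    refine hb.mul_bdd (c := 1) hq0c.aestronglyMeasurable (ae_of_all _ fun x => ?_)
    exact norm_decayExp_le_one hξ hη.le (by simp)
  set T : ℕ → ℝ → ℂ := fun n x => N (x + δ n * Complex.I) *
    (b x * q x - F (x + δ n * Complex.I) * q (x + δ n * Complex.I)) with hT
  set G : ℕ → ℝ → ℂ := fun n x => N (x + δ n * Complex.I) * F (x + δ n * Complex.I) *
    q (x + δ n * Complex.I) with hG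
  have hGc : ∀ n, Continuous (G n) := fun n =>
    ((continuous_comp_line hN.continuousOn (hδ0 n)).mul
      (continuous_comp_line hF.1.continuousOn (hδ0 n))).mul
      (continuous_comp_line hqd.continuousOn (hδ0 n))
  have hGb : ∀ n x, ‖G n x‖ ≤ M * (η ^ 2)⁻¹ * (1 + x ^ 2)⁻¹ := by
    intro n x
    have hz := add_mul_I_mem_uhp x (hδ0 n)
    simp only [hG]
    rw [norm_mul, mul_assoc]
    refine mul_le_mul (hNM _ hz).2 ?_ (norm_nonneg _) hM0
    simpa using norm_decayExp_le (z := x + δ n * Complex.I) hξ hη hη1 (le_of_lt hz)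
  have hbd_int : Integrable fun x : ℝ => M * (η ^ 2)⁻¹ * (1 + x ^ 2)⁻¹ :=
    integrable_inv_one_add_sq.const_mul _
  have hGi : ∀ n, Integrable (G n) := fun n =>
    hbd_int.mono' (hGc n).aestronglyMeasurable (ae_of_all _ (hGb n))
  have hG0 : ∀ n, ∫ x, G n x = 0 := by
    intro n
    refine integral_line_eq_zero (Φ := fun z => N z * F z * q z) (hδ0 n).le
      (C := M * (η ^ 2)⁻¹) (R₀ := 1) ?_ fun z hz hz1 => ?_
    · exact ((hN.mul hF.1).mul hqd).mono fun z hz => (hδ0 n).trans_le hz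
    · have hz' : z ∈ uhp := (hδ0 n).trans_le hz
      rw [norm_mul, mul_div_assoc]
      refine mul_le_mul (hNM _ hz').2 ?_ (norm_nonneg _) hM0
      exact norm_decayExp_le' hξ hη (le_of_lt hz') fun h => by simp [h] at hz1; linarith
  have hNc : ∀ n, Continuous fun x : ℝ => N (x + δ n * Complex.I) := fun n =>
    continuous_comp_line hN.continuousOn (hδ0 n)
  have hTeq : ∀ n x, T n x = N (x + δ n * Complex.I) * (b x * q x) - G n x := fun n x => by
    simp only [hT, hG]; ring
  have hNbq : ∀ n, Integrable fun x : ℝ => N (x + δ n * Complex.I) * (b x * q x) := fun n =>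
    hbq.bdd_mul (c := 1) (hNc n).aestronglyMeasurable
      (ae_of_all _ fun x => (hNM _ (add_mul_I_mem_uhp x (hδ0 n))).1)
  have hTi : ∀ n, Integrable (T n) := fun n => by
    have := (hNbq n).sub (hGi n)
    exact this.congr (ae_of_all _ fun x => (hTeq n x).symm)
  have hTlim : Tendsto (fun n => ∫ x, T n x) atTop (𝓝 (∫ _ : ℝ, (0 : ℂ))) := by
    refine tendsto_integral_of_dominated_convergence
      (fun x => ‖b x * q x‖ + M * (η ^ 2)⁻¹ * (1 + x ^ 2)⁻¹) (fun n => (hTi n).aestronglyMeasurable)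
      (hbq.norm.add hbd_int) (fun n => ae_of_all _ fun x => ?_) ?_
    · rw [hTeq]
      refine (norm_sub_le _ _).trans (add_le_add ?_ (hGb n x))
      rw [norm_mul]
      exact mul_le_of_le_one_left (norm_nonneg _) (hNM _ (add_mul_I_mem_uhp x (hδ0 n))).1
    · filter_upwards [hlim] with x hx
      have t1 := hx.comp hδt
      have t2 : Tendsto (fun n => q (x + δ n * Complex.I)) atTop (𝓝 (q x)) := by
        have h1 : ContinuousWithinAt q {z | 0 ≤ z.im} (x : ℂ) := hqc _ (by simp)
        refine h1.tendsto.comp (tendsto_nhdsWithin_iff.2 ⟨?_, Eventually.of_forall fun n => ?_⟩)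
        · have : Tendsto (fun n => (x + (δ n : ℂ) * Complex.I)) atTop
              (𝓝 (x + ((0 : ℝ) : ℂ) * Complex.I)) := by
            refine tendsto_const_nhds.add (Tendsto.mul_const _ ?_)
            exact (Complex.continuous_ofReal.tendsto 0).comp
              tendsto_one_div_add_atTop_nhds_zero_nat
          simpa using this
        · simpa using (hδ0 n).le
      have t3 : Tendsto (fun n => b x * q x -
          F (x + δ n * Complex.I) * q (x + δ n * Complex.I)) atTop (𝓝 0) := by
        have := (tendsto_const_nhds (x := b x * q x)).sub (t1.mul t2)
        simpa using this
      refine squeeze_zero_norm (fun n => ?_) (tendsto_zero_iff_norm_tendsto_zero.1 t3)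
      simp only [hT]
      rw [norm_mul]
      exact mul_le_of_le_one_left (norm_nonneg _) (hNM _ (add_mul_I_mem_uhp x (hδ0 n))).1
  rw [integral_zero] at hTlim
  have hmax : Integrable fun x => max (‖b x‖ - K) 0 := by
    refine hb.norm.mono' ((hb.norm.aestronglyMeasurable.sub aestronglyMeasurable_const).sup
        aestronglyMeasurable_const) (ae_of_all _ fun x => ?_)
    rw [Real.norm_of_nonneg (le_max_right _ _)]
    exact max_le (by linarith) (norm_nonneg _)
  have hmain : ∀ n, ‖∫ x : ℝ, b x * q x‖ ≤
      (K * (η ^ 2)⁻¹ * ε + 2 * ∫ x, max (‖b x‖ - K) 0) + ‖∫ x, T n x‖ := by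
    intro n
    have i1 := integrable_one_sub_div hN (fun z hz => (hNM z hz).1) (hδ0 n)
    have h1 : ∫ x : ℝ, b x * q x =
        (∫ x : ℝ, (1 - N (x + δ n * Complex.I)) * (b x * q x)) + ∫ x, T n x := by
      have e : ∀ x : ℝ, (1 - N (x + δ n * Complex.I)) * (b x * q x) =
        b x * q x - N (x + δ n * Complex.I) * (b x * q x) := fun x => by ring
      simp_rw [e, hTeq]
      rw [integral_sub hbq (hNbq n), integral_sub (hNbq n) (hGi n), hG0 n]
      ring
    rw [h1]
    refine (norm_add_le _ _).trans (add_le_add ?_ le_rfl)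
    refine (norm_integral_le_of_norm_le
      ((i1.const_mul (K * (η ^ 2)⁻¹)).add (hmax.const_mul 2)) (ae_of_all _ fun x => ?_)).trans ?_
    · have hz := add_mul_I_mem_uhp x (hδ0 n)
      have hN1 := (hNM _ hz).1
      have hN2 : ‖1 - N (x + δ n * Complex.I)‖ ≤ 2 := by
        refine (norm_sub_le _ _).trans ?_
        rw [norm_one]; linarith
      have hq1 : ‖q x‖ ≤ 1 := norm_decayExp_le_one hξ hη.le (by simp)
      have hq2 : ‖q x‖ ≤ (η ^ 2)⁻¹ * (1 + x ^ 2)⁻¹ := by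
        simpa using norm_decayExp_le (z := x) hξ hη hη1 (by simp)
      have hb1 : ‖b x‖ ≤ K + max (‖b x‖ - K) 0 := by
        have := le_max_left (‖b x‖ - K) 0
        linarith
      simp only [Pi.add_apply]
      rw [norm_mul, norm_mul]
      set p := ‖1 - N (x + δ n * Complex.I)‖
      have hp : 0 ≤ p := norm_nonneg _
      calc p * (‖b x‖ * ‖q x‖) ≤ p * ((K + max (‖b x‖ - K) 0) * ‖q x‖) := by gcongr
        _ = K * p * ‖q x‖ + p * max (‖b x‖ - K) 0 * ‖q x‖ := by ring
        _ ≤ K * p * ((η ^ 2)⁻¹ * (1 + x ^ 2)⁻¹) + 2 * max (‖b x‖ - K) 0 * 1 := by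
            gcongr
        _ = _ := by ring
    · simp only [Pi.add_apply]
      rw [integral_add (i1.const_mul _) (hmax.const_mul 2), integral_const_mul, integral_const_mul]
      have := hNε (δ n) ⟨hδ0 n, hδ1 n⟩
      gcongr
  have hlim2 := (tendsto_const_nhds
    (x := K * (η ^ 2)⁻¹ * ε + 2 * ∫ x, max (‖b x‖ - K) 0)).add hTlim.norm
  rw [norm_zero, add_zero] at hlim2
  exact ge_of_tendsto' hlim2 hmain

/-- An integrable boundary function of a regularizable analytic function has one-sided
spectrum. -/
theorem fourierInt_boundary_eq_zero {F : ℂ → ℂ} {b : ℝ → ℂ} (hF : Regularizable F)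
    (hb : Integrable b)
    (hlim : ∀ᵐ x : ℝ, Tendsto (fun y : ℝ => F (x + y * Complex.I)) (𝓝[>] 0) (𝓝 (b x)))
    {ξ : ℝ} (hξ : ξ ≤ 0) : fourierInt b ξ = 0 := by
  have hzero : ∀ η : ℝ, 0 < η → η ≤ 1 → ∫ x : ℝ, b x * decayExp ξ η x = 0 := by
    intro η hη hη1
    -- The multiplier is chosen after `K`, with error small against `(K + 1) η⁻²`; afterwards `K →
    -- ∞`.
    have h1 : ∀ K : ℕ, ‖∫ x : ℝ, b x * decayExp ξ η x‖ ≤ 2 * ∫ x, max (‖b x‖ - K) 0 := by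
      intro K
      refine le_of_forall_pos_le_add fun ε hε => ?_
      have hc : 0 < (K + 1) * (η ^ 2)⁻¹ := by positivity
      have := norm_integral_mul_decayExp_le hF hb hlim hξ hη hη1 (Nat.cast_nonneg K)
        (ε := ε / ((K + 1) * (η ^ 2)⁻¹)) (by positivity)
      have h2 : K * (η ^ 2)⁻¹ * (ε / ((K + 1) * (η ^ 2)⁻¹)) ≤ ε := by
        rw [mul_div_assoc', div_le_iff₀ hc]
        have : 0 < ε * (η ^ 2)⁻¹ := by positivity
        nlinarith
      linarith
    have h2 := (tendsto_integral_max_sub hb).const_mul 2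
    rw [mul_zero] at h2
    exact norm_le_zero_iff.1 (ge_of_tendsto' h2 h1)
  -- Letting the damping parameter tend to zero restores the pure exponential.
  have ht : Tendsto (fun n : ℕ => ∫ x : ℝ, b x * decayExp ξ (1 / (n + 1 : ℝ)) x) atTop
      (𝓝 (fourierInt b ξ)) := by
    refine tendsto_integral_of_dominated_convergence (fun x => ‖b x‖) (fun n => ?_) hb.norm
      (fun n => ae_of_all _ fun x => ?_) (ae_of_all _ fun x => ?_)
    · refine hb.aestronglyMeasurable.mul (Continuous.aestronglyMeasurable ?_)
      exact (differentiableOn_decayExp ξ (by positivity)).continuousOn.comp_continuous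
        (by fun_prop) fun x => by simp
    · rw [norm_mul]
      exact mul_le_of_le_one_right (norm_nonneg _)
        (norm_decayExp_le_one hξ (by positivity) (by simp))
    · refine Tendsto.const_mul _ ?_
      have h0 : Tendsto (fun n : ℕ => (((1 / (n + 1 : ℝ)) : ℝ) : ℂ)) atTop (𝓝 ((0 : ℝ) : ℂ)) :=
        (Complex.continuous_ofReal.tendsto 0).comp tendsto_one_div_add_atTop_nhds_zero_nat
      have h1 := (((h0.const_mul Complex.I).mul_const (x : ℂ)).const_sub 1).pow 2
      have h2 := (tendsto_const_nhds (x := Complex.exp (-(Complex.I * ξ * x)))).div h1 (by simp)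
      simpa [decayExp, Pi.div_def] using h2
  have h3 : ∀ n : ℕ, ∫ x : ℝ, b x * decayExp ξ (1 / (n + 1 : ℝ)) x = 0 := fun n =>
    hzero _ (by positivity)
      (div_le_one_of_le₀ (by linarith [(Nat.cast_nonneg n : (0 : ℝ) ≤ n)]) (by positivity))
  simp_rw [h3] at ht
  exact (tendsto_nhds_unique ht tendsto_const_nhds)

/-! ### Cauchy integrals -/

section Cauchy

variable {μ : Measure ℝ} {a : ℝ → ℂ}

/-- The Cauchy integral of `w` along the curve `a`. -/
noncomputable def cauchyInt (μ : Measure ℝ) (a : ℝ → ℂ) (w : ℝ → ℂ) (z : ℂ) : ℂ :=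
  ∫ u, w u * (-Complex.I / (a u - z)) ∂μ

theorem im_le_norm_sub {a z : ℂ} (ha : a.im ≤ 0) : z.im ≤ ‖a - z‖ := by
  have := Complex.abs_im_le_norm (a - z)
  simp only [Complex.sub_im] at this
  have := neg_le_abs (a.im - z.im)
  linarith

theorem sub_ne_zero_of_mem_uhp {a z : ℂ} (ha : a.im ≤ 0) (hz : z ∈ uhp) : a - z ≠ 0 :=
  norm_pos_iff.1 (lt_of_lt_of_le hz (im_le_norm_sub ha))

theorem norm_cauchyKernel_le {a z : ℂ} (ha : a.im ≤ 0) (hz : z ∈ uhp) :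
    ‖-Complex.I / (a - z)‖ ≤ 1 / z.im := by
  have hz' : 0 < z.im := hz
  rw [norm_div, norm_neg, Complex.norm_I]
  have := im_le_norm_sub (z := z) ha
  gcongr

theorem integrable_cauchyInt (ha : Measurable a) (ha0 : ∀ u, (a u).im ≤ 0) {w : ℝ → ℂ}
    (hw : Integrable w μ) {z : ℂ} (hz : z ∈ uhp) :
    Integrable (fun u => w u * (-Complex.I / (a u - z))) μ :=
  hw.mul_bdd (c := 1 / z.im)
    (measurable_const.div (ha.sub_const z)).aestronglyMeasurable (ae_of_all _ fun u => norm_cauchyKernel_le (ha0 u) hz)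

theorem norm_cauchyInt_le (ha0 : ∀ u, (a u).im ≤ 0) {w : ℝ → ℂ}
    (hw : Integrable w μ) {z : ℂ} (hz : z ∈ uhp) :
    ‖cauchyInt μ a w z‖ ≤ (∫ u, ‖w u‖ ∂μ) / z.im := by
  have := norm_integral_le_of_norm_le (f := fun u => w u * (-Complex.I / (a u - z)))
    (hw.norm.mul_const (1 / z.im)) (ae_of_all _ fun u => by
      rw [norm_mul]; gcongr; exact norm_cauchyKernel_le (ha0 u) hz)
  rw [integral_mul_const] at this
  rw [cauchyInt]
  refine this.trans (le_of_eq (by ring))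

theorem differentiableOn_cauchyInt (ha : Measurable a) (ha0 : ∀ u, (a u).im ≤ 0) {w : ℝ → ℂ}
    (hw : Integrable w μ) : DifferentiableOn ℂ (cauchyInt μ a w) uhp := by
  intro z₀ hz₀
  have hz₀' : 0 < z₀.im := hz₀
  have hs : {z : ℂ | z₀.im / 2 < z.im} ∈ 𝓝 z₀ :=
    (isOpen_lt continuous_const Complex.continuous_im).mem_nhds (by
      change z₀.im / 2 < z₀.im; linarith)
  have hmem : ∀ z ∈ {z : ℂ | z₀.im / 2 < z.im}, z ∈ uhp := fun z hz =>
    lt_trans (half_pos hz₀') hz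
  have key := hasDerivAt_integral_of_dominated_loc_of_deriv_le (μ := μ) (𝕜 := ℂ)
    (F := fun z u => w u * (-Complex.I / (a u - z)))
    (F' := fun z u => w u * (-Complex.I / (a u - z) ^ 2))
    (bound := fun u => ‖w u‖ * (1 / (z₀.im / 2) ^ 2)) hs ?_
    (integrable_cauchyInt ha ha0 hw hz₀) ?_ ?_ (hw.norm.mul_const _) ?_
  · exact key.2.differentiableAt.differentiableWithinAt
  · filter_upwards [hs] with z hz using
      (integrable_cauchyInt ha ha0 hw (hmem z hz)).aestronglyMeasurable
  · exact hw.aestronglyMeasurable.mul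
      (measurable_const.div ((ha.sub_const z₀).pow_const 2)).aestronglyMeasurable
  · refine ae_of_all _ fun u z hz => ?_
    rw [norm_mul, norm_div, norm_neg, Complex.norm_I, norm_pow]
    have h1 := im_le_norm_sub (z := z) (ha0 u)
    have hz' : z₀.im / 2 < z.im := hz
    have : 0 < z₀.im / 2 := by positivity
    have h2 : z₀.im / 2 ≤ ‖a u - z‖ := by linarith
    gcongr
  · refine ae_of_all _ fun u z hz => ?_
    have h1 := sub_ne_zero_of_mem_uhp (ha0 u) (hmem z hz)
    have h2 : HasDerivAt (fun z : ℂ => a u - z) (-1) z := by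
      simpa using (hasDerivAt_id z).const_sub (a u)
    have h3 := ((hasDerivAt_const z (-Complex.I)).div h2 h1).const_mul (w u)
    exact h3.congr_deriv (by ring)

/-- `Re(-i/(a - z)) = (Im z - Im a)/|a - z|²` is nonnegative for a curve in the closed lower
half-plane; the factor `-i` in the kernel is there for this. -/
theorem cauchyInt_re_nonneg (ha : Measurable a) (ha0 : ∀ u, (a u).im ≤ 0) {w : ℝ → ℝ}
    (hw : Integrable w μ) (hw0 : ∀ u, 0 ≤ w u) {z : ℂ} (hz : z ∈ uhp) :
    0 ≤ (cauchyInt μ a (fun u => w u) z).re := by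
  have h := integral_re (integrable_cauchyInt ha ha0 hw.ofReal hz)
  simp only [RCLike.re_to_complex] at h
  rw [cauchyInt]
  refine le_of_le_of_eq (integral_nonneg fun u => ?_) h
  change 0 ≤ ((w u : ℂ) * (-Complex.I / (a u - z))).re
  rw [Complex.re_ofReal_mul]
  refine mul_nonneg (hw0 u) ?_
  have hz' : 0 < z.im := hz
  have := ha0 u
  rw [Complex.div_re]
  simp
  refine div_nonneg (by linarith) (Complex.normSq_nonneg _)

/-- The positive and negative parts of the real and imaginary parts of the density each give a
Cauchy integral with nonnegative real part, and `Regularizable` is stable under linear combinations.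
-/
theorem regularizable_cauchyInt (ha : Measurable a) (ha0 : ∀ u, (a u).im ≤ 0) {w : ℝ → ℂ}
    (hw : Integrable w μ) : Regularizable (cauchyInt μ a w) := by
  have hpos : ∀ v : ℝ → ℝ, Integrable v μ → (∀ u, 0 ≤ v u) →
      Regularizable (cauchyInt μ a fun u => v u) := fun v hv hv0 =>
    regularizable_of_re_nonneg (differentiableOn_cauchyInt ha ha0 hv.ofReal)
      (fun z hz => cauchyInt_re_nonneg ha ha0 hv hv0 hz)
      (fun z hz => norm_cauchyInt_le ha0 hv.ofReal hz)
  have hreal : ∀ v : ℝ → ℝ, Integrable v μ → Regularizable (cauchyInt μ a fun u => v u) := by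
    intro v hv
    have h1 := hpos (fun u => max (v u) 0) hv.pos_part fun u => le_max_right _ _
    have h2 := hpos (fun u => max (-v u) 0) hv.neg_part fun u => le_max_right _ _
    refine (h1.add (h2.const_mul (-1))).congr fun z hz => ?_
    have i1 : Integrable (fun u => ((max (v u) 0 : ℝ) : ℂ)) μ := hv.pos_part.ofReal
    have i2 : Integrable (fun u => ((max (-v u) 0 : ℝ) : ℂ)) μ := hv.neg_part.ofReal
    simp only [cauchyInt]
    rw [← integral_const_mul, ← integral_add (integrable_cauchyInt ha ha0 i1 hz)
      ((integrable_cauchyInt ha ha0 i2 hz).const_mul _)]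
    refine integral_congr_ae (ae_of_all _ fun u => ?_)
    have : v u = max (v u) 0 - max (-v u) 0 := by
      rcases le_total 0 (v u) with h | h
      · rw [max_eq_left h, max_eq_right (by linarith)]; ring
      · rw [max_eq_right h, max_eq_left (by linarith)]; ring
    simp only
    conv_lhs => rw [this]
    push_cast
    ring
  have h1 := hreal (fun u => (w u).re) hw.re
  have h2 := hreal (fun u => (w u).im) hw.im
  refine (h1.add (h2.const_mul Complex.I)).congr fun z hz => ?_
  have i1 : Integrable (fun u => ((w u).re : ℂ)) μ := hw.re.ofReal
  have i2 : Integrable (fun u => ((w u).im : ℂ)) μ := hw.im.ofReal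
  simp only [cauchyInt]
  rw [← integral_const_mul, ← integral_add (integrable_cauchyInt ha ha0 i1 hz)
    ((integrable_cauchyInt ha ha0 i2 hz).const_mul _)]
  refine integral_congr_ae (ae_of_all _ fun u => ?_)
  simp only
  conv_lhs => rw [← Complex.re_add_im (w u)]
  ring

end Cauchy

/-! ### Boundary values at Lebesgue points -/

section Lebesgue

variable {f : ℝ → ℂ} {p : ℝ}

/-- The mean oscillation of `f` about its value at `p`, on the interval of radius `r`. -/
noncomputable def meanOsc (f : ℝ → ℂ) (p r : ℝ) : ℝ :=
  (2 * r)⁻¹ * ∫ u in Metric.closedBall p r, ‖f u - f p‖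

theorem meanOsc_nonneg (f : ℝ → ℂ) (p : ℝ) {r : ℝ} (hr : 0 ≤ r) : 0 ≤ meanOsc f p r :=
  mul_nonneg (by positivity) (integral_nonneg fun _ => norm_nonneg _)

theorem ae_tendsto_meanOsc (hf : Integrable f) :
    ∀ᵐ p : ℝ, Tendsto (meanOsc f p) (𝓝[>] 0) (𝓝 0) := by
  filter_upwards [IsUnifLocDoublingMeasure.ae_tendsto_average_norm_sub volume
    hf.locallyIntegrable 1] with p hp
  have h := hp (ι := ℝ) (l := 𝓝[>] (0 : ℝ)) (fun _ => p) id tendsto_id (by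
    filter_upwards [self_mem_nhdsWithin] with r hr
    have : (0 : ℝ) < r := hr
    simpa using this.le)
  refine h.congr' ?_
  filter_upwards [self_mem_nhdsWithin] with r hr
  have : (0 : ℝ) < r := hr
  rw [setAverage_eq, meanOsc, measureReal_def, id, Real.volume_closedBall,
    ENNReal.toReal_ofReal (by positivity), smul_eq_mul]

theorem integrableOn_norm_sub (hf : Integrable f) (p r : ℝ) :
    IntegrableOn (fun u => ‖f u - f p‖) (Metric.closedBall p r) :=
  (hf.integrableOn.sub (integrableOn_const (by
    rw [Real.volume_closedBall]; exact ENNReal.ofReal_ne_top))).norm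

theorem meanOsc_le (hf : Integrable f) (p : ℝ) {r : ℝ} (hr : 0 < r) :
    meanOsc f p r ≤ (2 * r)⁻¹ * (∫ u, ‖f u‖) + ‖f p‖ := by
  have hfin : volume (Metric.closedBall p r) ≠ ∞ := by
    rw [Real.volume_closedBall]; exact ENNReal.ofReal_ne_top
  have h1 : ∫ u in Metric.closedBall p r, ‖f u - f p‖ ≤
      ∫ u in Metric.closedBall p r, (‖f u‖ + ‖f p‖) :=
    integral_mono (integrableOn_norm_sub hf p r)
      (hf.norm.integrableOn.add (integrableOn_const hfin)) fun u => norm_sub_le _ _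
  rw [integral_add hf.norm.integrableOn (integrableOn_const hfin), setIntegral_const,
    measureReal_def, Real.volume_closedBall, ENNReal.toReal_ofReal (by positivity),
    smul_eq_mul] at h1
  have h2 : ∫ u in Metric.closedBall p r, ‖f u‖ ≤ ∫ u, ‖f u‖ :=
    setIntegral_le_integral hf.norm (ae_of_all _ fun _ => norm_nonneg _)
  rw [meanOsc]
  calc _ ≤ (2 * r)⁻¹ * ((∫ u, ‖f u‖) + 2 * r * ‖f p‖) := by
        gcongr
        linarith
    _ = _ := by field_simp

theorem exists_meanOsc_le (hf : Integrable f) (hp : Tendsto (meanOsc f p) (𝓝[>] 0) (𝓝 0)) :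
    ∃ B, ∀ r, 0 < r → meanOsc f p r ≤ B := by
  have h1 : ∀ᶠ r in 𝓝[>] (0 : ℝ), meanOsc f p r < 1 := hp.eventually_lt_const zero_lt_one
  obtain ⟨r₀, hr₀, h⟩ := (mem_nhdsGT_iff_exists_Ioo_subset (a := (0 : ℝ))).1 h1
  have hr₀' : (0 : ℝ) < r₀ := hr₀
  refine ⟨1 + ((2 * r₀)⁻¹ * (∫ u, ‖f u‖) + ‖f p‖), fun r hr => ?_⟩
  have hI : 0 ≤ ∫ u, ‖f u‖ := integral_nonneg fun _ => norm_nonneg _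
  rcases lt_or_ge r r₀ with h2 | h2
  · have : meanOsc f p r < 1 := h ⟨hr, h2⟩
    have : 0 ≤ (2 * r₀)⁻¹ * (∫ u, ‖f u‖) + ‖f p‖ := by positivity
    linarith
  · refine (meanOsc_le hf p hr).trans ?_
    have : (2 * r)⁻¹ * (∫ u, ‖f u‖) ≤ (2 * r₀)⁻¹ * (∫ u, ‖f u‖) := by gcongr
    linarith

/-- For the least `k` with `|s| ≤ 2^k y`, either `k = 0` and the kernel is at most `1/y`, or `|s| >
2^{k-1} y` and it is at most `4 · 4^{-k}/y`. One term of the series already suffices. -/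
theorem poissonKernel_le_tsum {y : ℝ} (hy : 0 < y) (s : ℝ) :
    ENNReal.ofReal (y / (y ^ 2 + s ^ 2)) ≤
      ∑' k : ℕ, (Metric.closedBall (0 : ℝ) (2 ^ k * y)).indicator
        (fun _ => ENNReal.ofReal (4 * (1 / 4) ^ k / y)) s := by
  have hex : ∃ k : ℕ, |s| ≤ 2 ^ k * y := by
    obtain ⟨k, hk⟩ := pow_unbounded_of_one_lt (|s| / y) (one_lt_two : (1 : ℝ) < 2)
    exact ⟨k, by rw [div_lt_iff₀ hy] at hk; exact hk.le⟩
  classical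
  set k := Nat.find hex with hk
  have hk1 : |s| ≤ 2 ^ k * y := Nat.find_spec hex
  refine le_trans ?_ (ENNReal.le_tsum k)
  rw [indicator_of_mem (by simpa using hk1)]
  refine ENNReal.ofReal_le_ofReal ?_
  rw [div_le_div_iff₀ (by positivity) hy]
  rcases Nat.eq_zero_or_pos k with h0 | h0
  · rw [h0]
    nlinarith [sq_nonneg s]
  · have h2 : 2 ^ (k - 1) * y < |s| := by
      by_contra h
      exact Nat.find_min hex (m := k - 1) (by omega) (not_lt.1 h)
    obtain ⟨m, hm⟩ : ∃ m, k = m + 1 := ⟨k - 1, by omega⟩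
    rw [hm] at h2 ⊢
    simp only [Nat.add_sub_cancel] at h2
    have h3 : (2 ^ m * y) ^ 2 ≤ s ^ 2 := by
      rw [← sq_abs s]
      gcongr
    have h4 : (1 / 4 : ℝ) ^ (m + 1) * (2 ^ m) ^ 2 = 1 / 4 := by
      rw [← pow_mul, mul_comm m 2, pow_mul, pow_succ, mul_right_comm, ← mul_pow]
      norm_num
    have h5 : 0 ≤ (1 / 4 : ℝ) ^ (m + 1) := by positivity
    have h6 := mul_le_mul_of_nonneg_left h3 h5
    rw [mul_pow, ← mul_assoc, h4] at h6
    nlinarith [mul_nonneg h5 (sq_nonneg y)]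

/-- The ball of radius `2^k y` has length `2 · 2^k y`, which against the height `4 · 4^{-k}/y` gives
the weight `8 · 2^{-k}` on the mean oscillation at that scale. -/
theorem lintegral_poissonKernel_le (hf : Integrable f) {B : ℝ}
    (hB : ∀ r, 0 < r → meanOsc f p r ≤ B) {y : ℝ} (hy : 0 < y) :
    ∫⁻ u, ENNReal.ofReal (‖f u - f p‖ * (y / (y ^ 2 + (u - p) ^ 2))) ≤
      ENNReal.ofReal (∑' k : ℕ, 8 * (1 / 2) ^ k * meanOsc f p (2 ^ k * y)) := by
  have hsum : Summable fun k : ℕ => 8 * (1 / 2 : ℝ) ^ k * meanOsc f p (2 ^ k * y) := by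
    refine Summable.of_nonneg_of_le (fun k => ?_) (fun k => ?_)
      ((summable_geometric_two.mul_left 8).mul_right B)
    · exact mul_nonneg (by positivity) (meanOsc_nonneg _ _ (by positivity))
    · have := hB (2 ^ k * y) (by positivity)
      gcongr
  rw [ENNReal.ofReal_tsum_of_nonneg
    (fun k => mul_nonneg (by positivity) (meanOsc_nonneg _ _ (by positivity))) hsum]
  have hmeas : AEMeasurable fun u => ENNReal.ofReal ‖f u - f p‖ :=
    (hf.aestronglyMeasurable.sub aestronglyMeasurable_const).norm.aemeasurable.ennreal_ofReal
  calc _ ≤ ∫⁻ u, ∑' k : ℕ, (Metric.closedBall p (2 ^ k * y)).indicator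
          (fun u => ENNReal.ofReal ‖f u - f p‖ * ENNReal.ofReal (4 * (1 / 4) ^ k / y)) u := by
        refine lintegral_mono fun u => ?_
        rw [ENNReal.ofReal_mul (norm_nonneg _)]
        refine (mul_le_mul_right (poissonKernel_le_tsum hy (u - p)) _).trans (le_of_eq ?_)
        rw [← ENNReal.tsum_mul_left]
        refine tsum_congr fun k => ?_
        by_cases h : u ∈ Metric.closedBall p (2 ^ k * y)
        · rw [indicator_of_mem h, indicator_of_mem]
          simpa [Real.dist_eq] using h
        · rw [indicator_of_notMem h, indicator_of_notMem, mul_zero]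
          simpa [Real.dist_eq] using h
    _ = ∑' k : ℕ, ∫⁻ u, (Metric.closedBall p (2 ^ k * y)).indicator
          (fun u => ENNReal.ofReal ‖f u - f p‖ * ENNReal.ofReal (4 * (1 / 4) ^ k / y)) u := by
        refine lintegral_tsum fun k => ?_
        exact (hmeas.mul_const _).indicator Metric.isClosed_closedBall.measurableSet
    _ = _ := by
        refine tsum_congr fun k => ?_
        rw [lintegral_indicator Metric.isClosed_closedBall.measurableSet,
          lintegral_mul_const' _ _ ENNReal.ofReal_ne_top,
          ← ofReal_integral_eq_lintegral_ofReal (integrableOn_norm_sub hf p _)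
            (ae_of_all _ fun _ => norm_nonneg _),
          ← ENNReal.ofReal_mul (integral_nonneg fun _ => norm_nonneg _), meanOsc]
        congr 1
        have h2 : (1 / 4 : ℝ) ^ k = (1 / 2) ^ k * (1 / 2) ^ k := by rw [← mul_pow]; norm_num
        have h3 : (1 / 2 : ℝ) ^ k = (2 ^ k)⁻¹ := by rw [one_div, inv_pow]
        rw [h2, h3]
        field_simp
        ring

theorem tendsto_tsum_meanOsc (hf : Integrable f)
    (hp : Tendsto (meanOsc f p) (𝓝[>] 0) (𝓝 0)) :
    Tendsto (fun y : ℝ => ∑' k : ℕ, 8 * (1 / 2) ^ k * meanOsc f p (2 ^ k * y)) (𝓝[>] 0)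
      (𝓝 0) := by
  obtain ⟨B, hB⟩ := exists_meanOsc_le hf hp
  have : Tendsto (fun y : ℝ => ∑' k : ℕ, 8 * (1 / 2) ^ k * meanOsc f p (2 ^ k * y)) (𝓝[>] 0)
      (𝓝 (∑' _ : ℕ, (0 : ℝ))) := by
    refine tendsto_tsum_of_dominated_convergence (bound := fun k => 8 * (1 / 2) ^ k * B)
      ((summable_geometric_two.mul_left 8).mul_right B) (fun k => ?_) ?_
    · have t1 : Tendsto (fun y : ℝ => 2 ^ k * y) (𝓝[>] 0) (𝓝[>] 0) := by
        refine tendsto_nhdsWithin_iff.2 ⟨?_, ?_⟩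
        · have : Tendsto (fun y : ℝ => 2 ^ k * y) (𝓝 0) (𝓝 (2 ^ k * 0)) :=
            tendsto_id.const_mul _
          rw [mul_zero] at this
          exact this.mono_left nhdsWithin_le_nhds
        · filter_upwards [self_mem_nhdsWithin] with y hy
          have : (0 : ℝ) < y := hy
          exact mul_pos (by positivity) this
      have := (hp.comp t1).const_mul (8 * (1 / 2) ^ k)
      simpa using this
    · filter_upwards [self_mem_nhdsWithin] with y hy k
      have hy' : (0 : ℝ) < y := hy
      rw [Real.norm_of_nonneg
        (mul_nonneg (by positivity) (meanOsc_nonneg _ _ (by positivity)))]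
      have := hB (2 ^ k * y) (by positivity)
      gcongr
  simpa using this

/-- The difference between the Cauchy kernel at height `σ y` and the truncated kernel. -/
noncomputable def cauchyDiff (σ y s : ℝ) : ℂ :=
  1 / (s - σ * y * Complex.I) - {s : ℝ | y < |s|}.indicator (fun s => (1 / s : ℂ)) s

theorem normSq_sub_mul_I (σ y s : ℝ) (hσ : σ ^ 2 = 1) :
    Complex.normSq (s - σ * y * Complex.I) = y ^ 2 + s ^ 2 := by
  rw [Complex.normSq_apply]
  simp
  linear_combination y ^ 2 * hσ

/-- For `|s| > y` the difference is `iσy / ((s - iσy) s)`, and otherwise only the Cauchy kernel is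
present; either way comparing `|s - iσy|` with `2|s|` or `2y` gives a Poisson bound. The sign `σ`
covers approach from above and below. -/
theorem norm_cauchyDiff_le {σ y : ℝ} (hσ : σ ^ 2 = 1) (hy : 0 < y) (s : ℝ) :
    ‖cauchyDiff σ y s‖ ≤ 2 * (y / (y ^ 2 + s ^ 2)) := by
  have hn : ‖(s - σ * y * Complex.I : ℂ)‖ ^ 2 = y ^ 2 + s ^ 2 := by
    rw [Complex.sq_norm, normSq_sub_mul_I σ y s hσ]
  set n := ‖(s - σ * y * Complex.I : ℂ)‖ with hn'
  have hn0 : 0 < n := by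
    have h1 : 0 < n ^ 2 := by rw [hn]; positivity
    exact lt_of_le_of_ne (norm_nonneg _) fun h => by rw [← h] at h1; simp at h1
  have hne : (s - σ * y * Complex.I : ℂ) ≠ 0 := norm_pos_iff.1 hn0
  rw [← hn]
  by_cases h : y < |s|
  · rw [cauchyDiff, indicator_of_mem (by exact h)]
    have hs0 : s ≠ 0 := by rintro rfl; simp at h; linarith
    have hs : (s : ℂ) ≠ 0 := by exact_mod_cast hs0
    have e : (1 / (s - σ * y * Complex.I) - 1 / s : ℂ) =
        σ * y * Complex.I / ((s - σ * y * Complex.I) * s) := by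
      field_simp
      ring
    have hσ1 : |σ| = 1 := by
      exact (abs_eq zero_le_one).2 (by simpa using hσ)
    rw [e, norm_div, norm_mul, norm_mul, norm_mul, Complex.norm_I, Complex.norm_real,
      Complex.norm_real, Complex.norm_real, Real.norm_eq_abs, Real.norm_eq_abs, Real.norm_eq_abs,
      hσ1, abs_of_pos hy, ← hn']
    rw [mul_one, one_mul, ← mul_div_assoc, div_le_div_iff₀ (by positivity) (by positivity)]
    have h1 : n ≤ 2 * |s| := by
      refine le_of_sq_le_sq ?_ (by positivity)
      rw [hn, mul_pow, sq_abs]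
      have : y ^ 2 ≤ s ^ 2 := by rw [← sq_abs s]; gcongr
      nlinarith
    have := mul_le_mul_of_nonneg_left h1 (by positivity : 0 ≤ y * n)
    nlinarith
  · rw [cauchyDiff, indicator_of_notMem (by exact h), sub_zero, norm_div, norm_one, ← hn',
      ← mul_div_assoc, div_le_div_iff₀ hn0 (by positivity)]
    have h1 : n ≤ 2 * y := by
      refine le_of_sq_le_sq ?_ (by positivity)
      rw [hn]
      have : s ^ 2 ≤ y ^ 2 := by rw [← sq_abs s]; gcongr; exact not_lt.1 h
      nlinarith
    nlinarith

theorem integral_poissonKernel {y : ℝ} (hy : 0 < y) :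
    Integrable (fun s : ℝ => y / (y ^ 2 + s ^ 2)) ∧
      ∫ s : ℝ, y / (y ^ 2 + s ^ 2) = Real.pi := by
  have e : ∀ s : ℝ, y / (y ^ 2 + s ^ 2) = y⁻¹ * (1 + (s / y) ^ 2)⁻¹ := fun s => by
    field_simp
  simp_rw [e]
  refine ⟨(integrable_inv_one_add_sq.comp_div hy.ne').const_mul _, ?_⟩
  rw [integral_const_mul, Measure.integral_comp_div (fun s : ℝ => (1 + s ^ 2)⁻¹),
    integral_univ_inv_one_add_sq, abs_of_pos hy, smul_eq_mul]
  field_simp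

theorem measurable_cauchyDiff (σ y : ℝ) : Measurable (cauchyDiff σ y) := by
  refine Measurable.sub ?_ (Measurable.indicator ?_ ?_)
  · exact measurable_const.div ((Complex.measurable_ofReal).sub_const _)
  · exact measurable_const.div Complex.measurable_ofReal
  · exact measurableSet_lt measurable_const continuous_abs.measurable

theorem integrable_cauchyDiff {σ y : ℝ} (hσ : σ ^ 2 = 1) (hy : 0 < y) :
    Integrable (cauchyDiff σ y) :=
  ((integral_poissonKernel hy).1.const_mul 2).mono' (measurable_cauchyDiff σ y).aestronglyMeasurable
    (ae_of_all _ (norm_cauchyDiff_le hσ hy))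

/-- Symmetrizing in `s` cancels the odd truncated kernel and turns the Cauchy kernel into `2iσ`
times the Poisson kernel, of mass `π`. -/
theorem integral_cauchyDiff {σ y : ℝ} (hσ : σ ^ 2 = 1) (hy : 0 < y) :
    ∫ s, cauchyDiff σ y s = σ * Real.pi * Complex.I := by
  have hi := integrable_cauchyDiff hσ hy
  have h1 : ∫ s, cauchyDiff σ y (-s) = ∫ s, cauchyDiff σ y s :=
    integral_neg_eq_self (cauchyDiff σ y) volume
  have h2 : ∀ s : ℝ, cauchyDiff σ y s + cauchyDiff σ y (-s) =
      2 * σ * Complex.I * ((y / (y ^ 2 + s ^ 2) : ℝ) : ℂ) := by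
    intro s
    have hne1 : (s - σ * y * Complex.I : ℂ) ≠ 0 := by
      rw [← Complex.normSq_pos, normSq_sub_mul_I σ y s hσ]; positivity
    have hne2 : (((-s : ℝ) : ℂ) - σ * y * Complex.I : ℂ) ≠ 0 := by
      rw [← Complex.normSq_pos, normSq_sub_mul_I σ y (-s) hσ]; positivity
    have hind : {s : ℝ | y < |s|}.indicator (fun s => (1 / s : ℂ)) (-s) =
        -{s : ℝ | y < |s|}.indicator (fun s => (1 / s : ℂ)) s := by
      by_cases h : y < |s|
      · rw [indicator_of_mem (by simpa using h), indicator_of_mem (by exact h)]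
        push_cast
        rw [div_neg]
      · rw [indicator_of_notMem (by simpa using h), indicator_of_notMem (by exact h), neg_zero]
    rw [cauchyDiff, cauchyDiff, hind]
    have hprod : (y ^ 2 + s ^ 2 : ℂ) =
        -((s - σ * y * Complex.I) * (((-s : ℝ) : ℂ) - σ * y * Complex.I)) := by
      have hσc : (σ : ℂ) ^ 2 = 1 := by exact_mod_cast hσ
      push_cast
      linear_combination (-(y : ℂ) ^ 2) * hσc + (σ : ℂ) ^ 2 * y ^ 2 * Complex.I_sq
    push_cast at hne2 hprod ⊢
    rw [hprod]
    field_simp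
    ring
  have h3 : 2 * ∫ s, cauchyDiff σ y s = 2 * (σ * Real.pi * Complex.I) := by
    calc 2 * ∫ s, cauchyDiff σ y s = ∫ s, (cauchyDiff σ y s + cauchyDiff σ y (-s)) := by
          rw [integral_add hi hi.comp_neg, h1]; ring
      _ = _ := by
          simp_rw [h2]
          rw [integral_const_mul, integral_complex_ofReal, (integral_poissonKernel hy).2]
          ring
  exact mul_left_cancel₀ two_ne_zero h3

/-- The constant `f p` meets the exact mass of the kernel; the oscillation `f u - f p` meets its
Poisson bound, and the dyadic sum of mean oscillations tends to zero. -/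
theorem tendsto_integral_cauchyDiff (hf : Integrable f)
    (hp : Tendsto (meanOsc f p) (𝓝[>] 0) (𝓝 0)) {σ : ℝ} (hσ : σ ^ 2 = 1) :
    Tendsto (fun y : ℝ => ∫ u, f u * cauchyDiff σ y (u - p)) (𝓝[>] 0)
      (𝓝 (f p * (σ * Real.pi * Complex.I))) := by
  obtain ⟨B, hB⟩ := exists_meanOsc_le hf hp
  rw [tendsto_iff_norm_sub_tendsto_zero]
  have hlim := (tendsto_tsum_meanOsc hf hp).const_mul 2
  rw [mul_zero] at hlim
  refine squeeze_zero' (Eventually.of_forall fun _ => norm_nonneg _) ?_ hlim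
  filter_upwards [self_mem_nhdsWithin] with y hy
  have hy' : (0 : ℝ) < y := hy
  have hic : Integrable fun u => cauchyDiff σ y (u - p) :=
    (integrable_cauchyDiff hσ hy').comp_sub_right p
  have hbd : ∀ u : ℝ, ‖cauchyDiff σ y (u - p)‖ ≤ 2 / y := by
    intro u
    refine (norm_cauchyDiff_le hσ hy' _).trans ?_
    rw [← mul_div_assoc, div_le_div_iff₀ (by positivity) hy']
    nlinarith [sq_nonneg (u - p)]
  have h1 : (∫ u, f u * cauchyDiff σ y (u - p)) - f p * (σ * Real.pi * Complex.I) =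
      ∫ u, (f u - f p) * cauchyDiff σ y (u - p) := by
    simp_rw [sub_mul]
    rw [integral_sub (hf.mul_bdd (c := 2 / y) hic.aestronglyMeasurable (ae_of_all _ hbd))
      (hic.const_mul _), integral_const_mul, integral_sub_right_eq_self (cauchyDiff σ y) p,
      integral_cauchyDiff hσ hy']
  rw [h1]
  refine (norm_integral_le_lintegral_norm _).trans ?_
  have h2 : ∫⁻ u, ENNReal.ofReal ‖(f u - f p) * cauchyDiff σ y (u - p)‖ ≤
      ENNReal.ofReal (2 * ∑' k : ℕ, 8 * (1 / 2) ^ k * meanOsc f p (2 ^ k * y)) := by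
    rw [ENNReal.ofReal_mul (by norm_num)]
    calc _ ≤ ∫⁻ u, ENNReal.ofReal 2 *
            ENNReal.ofReal (‖f u - f p‖ * (y / (y ^ 2 + (u - p) ^ 2))) := by
          refine lintegral_mono fun u => ?_
          rw [← ENNReal.ofReal_mul (by norm_num), norm_mul]
          refine ENNReal.ofReal_le_ofReal ?_
          have := mul_le_mul_of_nonneg_left (norm_cauchyDiff_le hσ hy' (u - p))
            (norm_nonneg (f u - f p))
          linarith
      _ ≤ _ := by
          rw [lintegral_const_mul' _ _ ENNReal.ofReal_ne_top]
          exact mul_le_mul_right (lintegral_poissonKernel_le hf hB hy') _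
  refine ENNReal.toReal_le_of_le_ofReal ?_ h2
  exact mul_nonneg (by norm_num) (tsum_nonneg fun k =>
    mul_nonneg (by positivity) (meanOsc_nonneg _ _ (by positivity)))

/-- At a Lebesgue point, the Cauchy integral and the truncated principal value differ
asymptotically by the jump. -/
theorem tendsto_cauchy_sub_trunc (hf : Integrable f)
    (hp : Tendsto (meanOsc f p) (𝓝[>] 0) (𝓝 0)) {σ : ℝ} (hσ : σ ^ 2 = 1) :
    Tendsto (fun y : ℝ => (∫ u, f u * (1 / ((u : ℂ) - p - σ * y * Complex.I))) -
      ∫ u in {u : ℝ | y < |u - p|}, f u * (1 / ((u : ℂ) - p))) (𝓝[>] 0)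
      (𝓝 (f p * (σ * Real.pi * Complex.I))) := by
  refine (tendsto_integral_cauchyDiff hf hp hσ).congr' ?_
  filter_upwards [self_mem_nhdsWithin] with y hy
  have hy' : (0 : ℝ) < y := hy
  have hms : MeasurableSet {u : ℝ | y < |u - p|} :=
    measurableSet_lt measurable_const (by fun_prop)
  rw [← integral_indicator hms, ← integral_sub]
  · refine integral_congr_ae (ae_of_all _ fun u => ?_)
    simp only [cauchyDiff]
    rw [mul_sub]
    congr 1
    · push_cast; rfl
    · by_cases h : y < |u - p|
      · rw [indicator_of_mem (by exact h), indicator_of_mem (by exact h)]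
        push_cast; rfl
      · rw [indicator_of_notMem (by exact h), indicator_of_notMem (by exact h), mul_zero]
  · refine hf.mul_bdd (c := 1 / y) (Measurable.aestronglyMeasurable ?_) (ae_of_all _ fun u => ?_)
    · exact measurable_const.div (((Complex.measurable_ofReal).sub_const _).sub_const _)
    · rw [norm_div, norm_one]
      have h1 : y ^ 2 ≤ ‖((u : ℂ) - p - σ * y * Complex.I)‖ ^ 2 := by
        have := normSq_sub_mul_I σ y (u - p) hσ
        push_cast at this
        rw [Complex.sq_norm, this]
        nlinarith [sq_nonneg (u - p)]
      have h2 := le_of_sq_le_sq h1 (norm_nonneg _)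
      gcongr
  · rw [integrable_indicator_iff hms]
    refine Integrable.mul_bdd (c := 1 / y) hf.integrableOn (Measurable.aestronglyMeasurable ?_) ?_
    · exact measurable_const.div ((Complex.measurable_ofReal).sub_const _)
    · filter_upwards [ae_restrict_mem hms] with u hu
      rw [norm_div, norm_one, ← Complex.ofReal_sub, Complex.norm_real, Real.norm_eq_abs]
      have : y < |u - p| := hu
      gcongr

end Lebesgue

/-! ### Functions given on the two half-lines -/

/-- The function on the line equal to `α x` at `x > 0` and to `β (-x)` at `x ≤ 0`. -/
noncomputable def glue (α β : ℝ → ℂ) (x : ℝ) : ℂ := if 0 < x then α x else β (-x)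

theorem volume_eq_add :
    (volume : Measure ℝ) = volume.restrict (Ioi 0) + volume.restrict (Iio 0) := by
  have h := Measure.restrict_add_restrict_compl (μ := (volume : Measure ℝ))
    (measurableSet_Ioi (a := (0 : ℝ)))
  rw [compl_Ioi, ← restrict_Iio_eq_restrict_Iic] at h
  exact h.symm

theorem measurePreserving_neg_Iio :
    MeasurePreserving (Neg.neg : ℝ → ℝ) (volume.restrict (Iio 0)) (volume.restrict (Ioi 0)) := by
  have h := (Measure.measurePreserving_neg (volume : Measure ℝ)).restrict_preimage
    (measurableSet_Ioi (a := (0 : ℝ)))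
  simpa using h

theorem measurableEmbedding_neg_real : MeasurableEmbedding (Neg.neg : ℝ → ℝ) :=
  (MeasurableEquiv.neg ℝ).measurableEmbedding

theorem ae_of_ae_Ioi {P : ℝ → Prop} (h : ∀ᵐ p ∂volume.restrict (Ioi (0 : ℝ)), P p ∧ P (-p)) :
    ∀ᵐ x : ℝ, P x := by
  rw [volume_eq_add, ae_add_measure_iff]
  refine ⟨h.mono fun p hp => hp.1, ?_⟩
  have := measurePreserving_neg_Iio.quasiMeasurePreserving.ae h
  exact this.mono fun x hx => by simpa using hx.2

section Glue

variable {α β : ℝ → ℂ}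

theorem glue_ae_Ioi : glue α β =ᵐ[volume.restrict (Ioi 0)] α := by
  filter_upwards [ae_restrict_mem measurableSet_Ioi] with x hx
  exact if_pos hx

theorem glue_ae_Iio : glue α β =ᵐ[volume.restrict (Iio 0)] fun x => β (-x) := by
  filter_upwards [ae_restrict_mem measurableSet_Iio] with x hx
  exact if_neg (not_lt.2 (le_of_lt hx))

theorem lintegral_glue : ∫⁻ x, ‖glue α β x‖ₑ =
    (∫⁻ x in Ioi (0 : ℝ), ‖α x‖ₑ) + ∫⁻ x in Ioi (0 : ℝ), ‖β x‖ₑ := by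
  conv_lhs => rw [volume_eq_add]
  rw [lintegral_add_measure]
  congr 1
  · exact lintegral_congr_ae ((glue_ae_Ioi (α := α) (β := β)).mono fun x hx => by simp only [hx])
  · rw [← measurePreserving_neg_Iio.lintegral_comp_emb measurableEmbedding_neg_real]
    exact lintegral_congr_ae ((glue_ae_Iio (α := α) (β := β)).mono fun x hx => by simp only [hx])

theorem integrable_glue (hα : IntegrableOn α (Ioi 0)) (hβ : IntegrableOn β (Ioi 0)) :
    Integrable (glue α β) := by
  rw [volume_eq_add, integrable_add_measure]
  refine ⟨hα.congr glue_ae_Ioi.symm, Integrable.congr ?_ glue_ae_Iio.symm⟩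
  exact (measurePreserving_neg_Iio.integrable_comp_emb measurableEmbedding_neg_real).2 hβ

theorem fourierInt_glue (hα : IntegrableOn α (Ioi 0)) (hβ : IntegrableOn β (Ioi 0)) (ξ : ℝ) :
    fourierInt (glue α β) ξ =
      (∫ x in Ioi (0 : ℝ), α x * Complex.exp (-(Complex.I * ξ * x))) +
        ∫ x in Ioi (0 : ℝ), β x * Complex.exp (Complex.I * ξ * x) := by
  have hi := integrable_mul_exp (integrable_glue hα hβ) ξ
  rw [fourierInt]
  conv_lhs => rw [volume_eq_add]
  rw [volume_eq_add, integrable_add_measure] at hi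
  rw [integral_add_measure hi.1 hi.2]
  congr 1
  · exact integral_congr_ae ((glue_ae_Ioi (α := α) (β := β)).mono fun x hx => by simp only [hx])
  · rw [← measurePreserving_neg_Iio.integral_comp measurableEmbedding_neg_real]
    refine integral_congr_ae ((glue_ae_Iio (α := α) (β := β)).mono fun x hx => ?_)
    simp only [hx]
    push_cast
    ring_nf

end Glue

/-! ### Boundary values of the Cauchy integrals of a function on the half-line -/

section Boundary

variable {g : ℝ → ℂ}

theorem tendsto_cauchyInt_of_le_norm (hg : IntegrableOn g (Ioi 0)) {a : ℝ → ℂ} (ha : Measurable a)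
    {x d : ℝ} (hd : 0 < d) (had : ∀ u, 0 < u → d ≤ |(a u).re - x|) :
    Tendsto (fun y : ℝ => cauchyInt (volume.restrict (Ioi 0)) a g (x + y * Complex.I)) (𝓝[>] 0)
      (𝓝 (∫ u in Ioi (0 : ℝ), g u * (-Complex.I / (a u - x)))) := by
  refine tendsto_integral_filter_of_dominated_convergence (fun u => ‖g u‖ * (1 / d))
    (Eventually.of_forall fun y => hg.aestronglyMeasurable.mul
      (measurable_const.div (ha.sub_const _)).aestronglyMeasurable)
    (Eventually.of_forall fun y => ?_) (hg.norm.mul_const _) ?_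
  · filter_upwards [ae_restrict_mem measurableSet_Ioi] with u hu
    rw [norm_mul, norm_div, norm_neg, Complex.norm_I]
    have h1 : d ≤ ‖a u - (x + y * Complex.I)‖ := by
      refine (had u hu).trans (le_trans (le_of_eq ?_) (Complex.abs_re_le_norm _))
      simp
    gcongr
  · filter_upwards [ae_restrict_mem measurableSet_Ioi] with u hu
    refine Tendsto.const_mul _ (Tendsto.div tendsto_const_nhds ?_ fun h => ?_)
    · have : Tendsto (fun y : ℝ => a u - (x + y * Complex.I)) (𝓝 0)
          (𝓝 (a u - (x + (0 : ℝ) * Complex.I))) :=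
        (by fun_prop : Continuous fun y : ℝ => a u - (x + y * Complex.I)).tendsto 0
      simp only [Complex.ofReal_zero, zero_mul, add_zero] at this
      exact this.mono_left nhdsWithin_le_nhds
    · have h2 := had u hu
      have h3 := congrArg Complex.re h
      simp only [Complex.sub_re, Complex.ofReal_re, Complex.zero_re] at h3
      rw [h3, abs_zero] at h2
      linarith

theorem integrableOn_mul_inv_add (hg : IntegrableOn g (Ioi 0)) {p : ℝ} (hp : 0 < p) :
    IntegrableOn (fun u => g u * (1 / ((u : ℂ) + p))) (Ioi 0) := by
  refine Integrable.mul_bdd (c := 1 / p) hg (Measurable.aestronglyMeasurable ?_) ?_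
  · exact measurable_const.div (Complex.measurable_ofReal.add_const _)
  · filter_upwards [ae_restrict_mem measurableSet_Ioi] with u hu
    have hu' : (0 : ℝ) < u := hu
    rw [norm_div, norm_one, ← Complex.ofReal_add, Complex.norm_of_nonneg (by positivity)]
    gcongr
    linarith

/-- The Stieltjes transform. -/
noncomputable def stieltjes (g : ℝ → ℂ) (p : ℝ) : ℂ :=
  ∫ u in Ioi (0 : ℝ), g u * (1 / ((u : ℂ) + p))

theorem measurableSet_trunc (x δ : ℝ) : MeasurableSet {t : ℝ | δ < |t - x|} :=
  measurableSet_lt measurable_const (by fun_prop)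

theorem trunc_eq_inter (x δ : ℝ) :
    {t : ℝ | 0 < t ∧ δ < |t - x|} = {t : ℝ | δ < |t - x|} ∩ Ioi 0 := by
  ext t
  exact and_comm

theorem tendsto_setIntegral_trunc {f : ℝ → ℂ} {p : ℝ} (hf : IntegrableOn f (Ioi 0)) :
    Tendsto (fun δ : ℝ => ∫ t in {t : ℝ | 0 < t ∧ δ < |t - p|}, f t) (𝓝[>] 0)
      (𝓝 (∫ t in Ioi (0 : ℝ), f t)) := by
  have h1 : ∀ δ : ℝ, ∫ t in {t : ℝ | 0 < t ∧ δ < |t - p|}, f t =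
      ∫ t in Ioi (0 : ℝ), {t : ℝ | δ < |t - p|}.indicator f t := by
    intro δ
    rw [integral_indicator (measurableSet_trunc p δ),
      Measure.restrict_restrict (measurableSet_trunc p δ), trunc_eq_inter]
  simp_rw [h1]
  refine tendsto_integral_filter_of_dominated_convergence (fun t => ‖f t‖)
    (Eventually.of_forall fun δ => hf.aestronglyMeasurable.indicator (measurableSet_trunc p δ))
    (Eventually.of_forall fun δ => ae_of_all _ fun t => norm_indicator_le_norm_self _ _) hf.norm ?_
  have hne : ∀ᵐ t ∂volume.restrict (Ioi (0 : ℝ)), t ≠ p :=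
    ae_restrict_of_ae (Measure.ae_ne volume p)
  filter_upwards [hne] with t ht
  refine tendsto_const_nhds.congr' ?_
  have hpos : 0 < |t - p| := abs_pos.2 (sub_ne_zero.2 ht)
  filter_upwards [nhdsWithin_le_nhds (Iio_mem_nhds hpos)] with δ hδ
  rw [indicator_of_mem (by exact hδ)]

theorem integrableOn_mul_inv_sub (hg : IntegrableOn g (Ioi 0)) (p : ℝ) {δ : ℝ} (hδ : 0 < δ) :
    IntegrableOn (fun u => g u * (1 / ((u : ℂ) - p))) {t : ℝ | 0 < t ∧ δ < |t - p|} := by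
  have hsub : {t : ℝ | 0 < t ∧ δ < |t - p|} ⊆ Ioi 0 := fun t ht => ht.1
  refine Integrable.mul_bdd (c := 1 / δ) (hg.mono_set hsub) (Measurable.aestronglyMeasurable ?_) ?_
  · exact measurable_const.div ((Complex.measurable_ofReal).sub_const _)
  · have hms : MeasurableSet {t : ℝ | 0 < t ∧ δ < |t - p|} := by
      rw [trunc_eq_inter]
      exact (measurableSet_trunc p δ).inter measurableSet_Ioi
    filter_upwards [ae_restrict_mem hms] with u hu
    rw [norm_div, norm_one, ← Complex.ofReal_sub, Complex.norm_real, Real.norm_eq_abs]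
    have : δ < |u - p| := hu.2
    gcongr

/-- Partial fractions: `2u/(u² - p²) = 1/(u - p) + 1/(u + p)`. Only the first term is singular; the
second converges to the Stieltjes transform. -/
theorem truncH_eq (hg : IntegrableOn g (Ioi 0)) {p : ℝ} (hp : 0 < p) {δ : ℝ} (hδ : 0 < δ) :
    Real.pi * truncH g p δ =
      (∫ u in {t : ℝ | δ < |t - p|}, (Ioi (0 : ℝ)).indicator g u * (1 / ((u : ℂ) - p))) +
        ∫ u in {t : ℝ | 0 < t ∧ δ < |t - p|}, g u * (1 / ((u : ℂ) + p)) := by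
  have hsub : {t : ℝ | 0 < t ∧ δ < |t - p|} ⊆ Ioi 0 := fun t ht => ht.1
  have hms : MeasurableSet {t : ℝ | 0 < t ∧ δ < |t - p|} := by
    rw [trunc_eq_inter]
    exact (measurableSet_trunc p δ).inter measurableSet_Ioi
  have h1 : ∫ u in {t : ℝ | δ < |t - p|}, (Ioi (0 : ℝ)).indicator g u * (1 / ((u : ℂ) - p)) =
      ∫ u in {t : ℝ | 0 < t ∧ δ < |t - p|}, g u * (1 / ((u : ℂ) - p)) := by
    rw [trunc_eq_inter, inter_comm, ← Measure.restrict_restrict measurableSet_Ioi,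
      ← integral_indicator measurableSet_Ioi]
    refine integral_congr_ae (ae_of_all _ fun u => ?_)
    by_cases hu : u ∈ Ioi (0 : ℝ)
    · simp only [indicator_of_mem hu]
    · simp only [indicator_of_notMem hu, zero_mul]
  rw [h1, ← integral_add (integrableOn_mul_inv_sub hg p hδ)
    ((integrableOn_mul_inv_add hg hp).mono_set hsub), truncH, ← mul_assoc, ← integral_const_mul]
  refine setIntegral_congr_fun hms fun u hu => ?_
  have h2 : u - p ≠ 0 := fun h => by
    have := hu.2
    rw [h, abs_zero] at this
    linarith
  have h3 : u + p ≠ 0 := by have := hu.1; positivity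
  have h2' : (u : ℂ) - p ≠ 0 := by exact_mod_cast h2
  have h3' : (u : ℂ) + p ≠ 0 := by exact_mod_cast h3
  have h4 : (u : ℂ) ^ 2 - p ^ 2 = (u - p) * (u + p) := by ring
  have hpi : (Real.pi : ℂ) ≠ 0 := by exact_mod_cast Real.pi_ne_zero
  push_cast
  rw [h4]
  field_simp
  ring

theorem tendsto_trunc_cauchy (hg : IntegrableOn g (Ioi 0)) {p : ℝ} (hp : 0 < p) {c : ℂ}
    (hc : Tendsto (fun δ => truncH g p δ) (𝓝[>] 0) (𝓝 c)) :
    Tendsto (fun δ : ℝ => ∫ u in {t : ℝ | δ < |t - p|},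
      (Ioi (0 : ℝ)).indicator g u * (1 / ((u : ℂ) - p))) (𝓝[>] 0)
      (𝓝 (Real.pi * c - stieltjes g p)) := by
  have h1 := (hc.const_mul (Real.pi : ℂ)).sub
    (tendsto_setIntegral_trunc (p := p) (integrableOn_mul_inv_add hg hp))
  refine h1.congr' ?_
  filter_upwards [self_mem_nhdsWithin] with δ hδ
  rw [truncH_eq hg hp hδ]
  ring

/-- The Sokhotski–Plemelj formula. Existence of the principal value is taken from that of `𝓗₀ g(p)`,
so no theorem on almost everywhere existence is required. -/
theorem tendsto_indicator_cauchy (hg : IntegrableOn g (Ioi 0)) {p : ℝ} (hp : 0 < p) {c : ℂ}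
    (hc : Tendsto (fun δ => truncH g p δ) (𝓝[>] 0) (𝓝 c))
    (hL : Tendsto (meanOsc ((Ioi (0 : ℝ)).indicator g) p) (𝓝[>] 0) (𝓝 0)) {σ : ℝ}
    (hσ : σ ^ 2 = 1) :
    Tendsto (fun y : ℝ => ∫ u in Ioi (0 : ℝ), g u * (1 / ((u : ℂ) - p - σ * y * Complex.I)))
      (𝓝[>] 0) (𝓝 (g p * (σ * Real.pi * Complex.I) + (Real.pi * c - stieltjes g p))) := by
  have hf : Integrable ((Ioi (0 : ℝ)).indicator g) := hg.integrable_indicator measurableSet_Ioi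
  have h1 := (tendsto_cauchy_sub_trunc hf hL hσ).add (tendsto_trunc_cauchy hg hp hc)
  rw [indicator_of_mem (by exact hp)] at h1
  refine h1.congr fun y => ?_
  rw [sub_add_cancel, ← integral_indicator measurableSet_Ioi]
  refine integral_congr_ae (ae_of_all _ fun u => ?_)
  by_cases hu : u ∈ Ioi (0 : ℝ)
  · simp only [indicator_of_mem hu]
  · simp only [indicator_of_notMem hu, zero_mul]

/-- The Cauchy integral of `g` along the positive axis. -/
noncomputable def cauchyPos (g : ℝ → ℂ) : ℂ → ℂ :=
  cauchyInt (volume.restrict (Ioi 0)) (fun u => (u : ℂ)) g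

/-- The Cauchy integral of `g` along the negative axis. -/
noncomputable def cauchyNeg (g : ℝ → ℂ) : ℂ → ℂ :=
  cauchyInt (volume.restrict (Ioi 0)) (fun u => -(u : ℂ)) g

/-- The Cauchy integral of `g` along the negative imaginary axis. -/
noncomputable def cauchyImag (g : ℝ → ℂ) : ℂ → ℂ :=
  -- The absolute value keeps the curve in the closed lower half-plane for every real `u`, as the
  -- general lemmas on `cauchyInt` demand; it is invisible to the measure.
  cauchyInt (volume.restrict (Ioi 0)) (fun u => -(((|u| : ℝ) : ℂ) * Complex.I)) g

theorem regularizable_cauchyPos (hg : IntegrableOn g (Ioi 0)) : Regularizable (cauchyPos g) :=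
  regularizable_cauchyInt Complex.measurable_ofReal (fun u => by simp) hg

theorem regularizable_cauchyNeg (hg : IntegrableOn g (Ioi 0)) : Regularizable (cauchyNeg g) :=
  regularizable_cauchyInt Complex.measurable_ofReal.neg (fun u => by simp) hg

theorem regularizable_cauchyImag (hg : IntegrableOn g (Ioi 0)) : Regularizable (cauchyImag g) :=
  regularizable_cauchyInt (by fun_prop) (fun u => by simp) hg

theorem tendsto_cauchyPos_pos (hg : IntegrableOn g (Ioi 0)) {p : ℝ} (hp : 0 < p) {c : ℂ}
    (hc : Tendsto (fun δ => truncH g p δ) (𝓝[>] 0) (𝓝 c))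
    (hL : Tendsto (meanOsc ((Ioi (0 : ℝ)).indicator g) p) (𝓝[>] 0) (𝓝 0)) :
    Tendsto (fun y : ℝ => cauchyPos g (p + y * Complex.I)) (𝓝[>] 0)
      (𝓝 (Real.pi * g p - Complex.I * Real.pi * c + Complex.I * stieltjes g p)) := by
  have h := (tendsto_indicator_cauchy hg hp hc hL (one_pow 2)).const_mul (-Complex.I)
  convert h.congr fun y => ?_ using 2
  · push_cast
    linear_combination ((Real.pi : ℂ) * g p) * Complex.I_sq
  · rw [cauchyPos, cauchyInt, ← integral_const_mul]
    congr 1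
    ext u
    push_cast
    rw [one_mul, sub_sub]
    ring

theorem tendsto_cauchyNeg_neg (hg : IntegrableOn g (Ioi 0)) {p : ℝ} (hp : 0 < p) {c : ℂ}
    (hc : Tendsto (fun δ => truncH g p δ) (𝓝[>] 0) (𝓝 c))
    (hL : Tendsto (meanOsc ((Ioi (0 : ℝ)).indicator g) p) (𝓝[>] 0) (𝓝 0)) :
    Tendsto (fun y : ℝ => cauchyNeg g ((-p : ℝ) + y * Complex.I)) (𝓝[>] 0)
      (𝓝 (Real.pi * g p + Complex.I * Real.pi * c - Complex.I * stieltjes g p)) := by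
  have h := (tendsto_indicator_cauchy hg hp hc hL (σ := -1) (by norm_num)).const_mul Complex.I
  convert h.congr fun y => ?_ using 2
  · push_cast
    linear_combination ((Real.pi : ℂ) * g p) * Complex.I_sq
  · rw [cauchyNeg, cauchyInt, ← integral_const_mul]
    congr 1
    ext u
    have : -(u : ℂ) - ((-p : ℝ) + y * Complex.I) = -(u - p - (-1 : ℝ) * y * Complex.I) := by
      push_cast
      ring
    rw [this, neg_div_neg_eq]
    ring

theorem tendsto_cauchyPos_neg (hg : IntegrableOn g (Ioi 0)) {p : ℝ} (hp : 0 < p) :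
    Tendsto (fun y : ℝ => cauchyPos g ((-p : ℝ) + y * Complex.I)) (𝓝[>] 0)
      (𝓝 (-(Complex.I * stieltjes g p))) := by
  have h := tendsto_cauchyInt_of_le_norm hg (a := fun u => (u : ℂ)) Complex.measurable_ofReal
    (x := -p) hp fun u hu => by
      rw [Complex.ofReal_re, abs_of_pos (by linarith)]
      linarith
  have e : -(Complex.I * stieltjes g p) =
      ∫ u in Ioi (0 : ℝ), g u * (-Complex.I / ((u : ℂ) - (-p : ℝ))) := by
    rw [stieltjes, ← neg_mul, ← integral_const_mul]
    congr 1
    ext u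
    push_cast
    rw [sub_neg_eq_add]
    ring
  rw [e]
  exact h

theorem tendsto_cauchyNeg_pos (hg : IntegrableOn g (Ioi 0)) {p : ℝ} (hp : 0 < p) :
    Tendsto (fun y : ℝ => cauchyNeg g (p + y * Complex.I)) (𝓝[>] 0)
      (𝓝 (Complex.I * stieltjes g p)) := by
  have h := tendsto_cauchyInt_of_le_norm hg (a := fun u => -(u : ℂ))
    Complex.measurable_ofReal.neg (x := p) hp fun u hu => by
      rw [Complex.neg_re, Complex.ofReal_re, abs_of_neg (by linarith)]
      linarith
  have e : Complex.I * stieltjes g p =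
      ∫ u in Ioi (0 : ℝ), g u * (-Complex.I / (-(u : ℂ) - p)) := by
    rw [stieltjes, ← integral_const_mul]
    congr 1
    ext u
    have : -(u : ℂ) - p = -(u + p) := by ring
    rw [this, neg_div_neg_eq]
    ring
  rw [e]
  exact h

/-- The boundary values of the Cauchy integral along the imaginary axis. -/
noncomputable def imagBoundary (g : ℝ → ℂ) (x : ℝ) : ℂ :=
  ∫ u in Ioi (0 : ℝ), g u * (1 / ((x : ℂ) + u * Complex.I))

theorem tendsto_cauchyImag (hg : IntegrableOn g (Ioi 0)) {x : ℝ} (hx : x ≠ 0) :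
    Tendsto (fun y : ℝ => cauchyImag g (x + y * Complex.I)) (𝓝[>] 0)
      (𝓝 (Complex.I * imagBoundary g x)) := by
  have h := tendsto_cauchyInt_of_le_norm hg
    (a := fun u => -(((|u| : ℝ) : ℂ) * Complex.I)) (by fun_prop) (x := x) (abs_pos.2 hx)
    fun u hu => by simp
  have e : Complex.I * imagBoundary g x =
      ∫ u in Ioi (0 : ℝ), g u * (-Complex.I / (-(((|u| : ℝ) : ℂ) * Complex.I) - x)) := by
    rw [imagBoundary, ← integral_const_mul]
    refine setIntegral_congr_fun measurableSet_Ioi fun u hu => ?_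
    rw [abs_of_pos hu]
    have : -((u : ℂ) * Complex.I) - x = -(x + u * Complex.I) := by ring
    rw [this, neg_div_neg_eq]
    ring
  rw [e]
  exact h

end Boundary

/-! ### Integral operators on the half-line -/

section Kernel

variable {g : ℝ → ℂ} {K : ℝ → ℝ → ℂ} {A : ℝ≥0∞}

theorem lintegral_kernel_le (hg : IntegrableOn g (Ioi 0)) (hK : Measurable (Function.uncurry K))
    (hA : ∀ u, 0 < u → ∫⁻ p in Ioi (0 : ℝ), ‖K p u‖ₑ ≤ A) :
    ∫⁻ p in Ioi (0 : ℝ), ∫⁻ u in Ioi (0 : ℝ), ‖g u * K p u‖ₑ ≤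
      A * ∫⁻ u in Ioi (0 : ℝ), ‖g u‖ₑ := by
  have hgm : AEMeasurable (fun z : ℝ × ℝ => ‖g z.2‖ₑ)
      ((volume.restrict (Ioi 0)).prod (volume.restrict (Ioi 0))) :=
    (hg.aestronglyMeasurable.comp_snd).enorm
  have hm : AEMeasurable (Function.uncurry fun p u => ‖g u * K p u‖ₑ)
      ((volume.restrict (Ioi 0)).prod (volume.restrict (Ioi 0))) := by
    have : (Function.uncurry fun p u => ‖g u * K p u‖ₑ) =
        fun z : ℝ × ℝ => ‖g z.2‖ₑ * ‖Function.uncurry K z‖ₑ := by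
      ext z
      simp [Function.uncurry_def]
    rw [this]
    exact hgm.mul hK.enorm.aemeasurable
  rw [lintegral_lintegral_swap hm]
  calc _ ≤ ∫⁻ u in Ioi (0 : ℝ), A * ‖g u‖ₑ := by
        refine lintegral_mono_ae ?_
        filter_upwards [ae_restrict_mem measurableSet_Ioi] with u hu
        simp_rw [enorm_mul]
        rw [lintegral_const_mul' _ _ enorm_ne_top, mul_comm]
        exact mul_le_mul_left (hA u hu) _
    _ = _ := lintegral_const_mul'' _ hg.aestronglyMeasurable.enorm

theorem integrable_kernel (hg : IntegrableOn g (Ioi 0)) (hK : Measurable (Function.uncurry K))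
    (hAt : A ≠ ∞) (hA : ∀ u, 0 < u → ∫⁻ p in Ioi (0 : ℝ), ‖K p u‖ₑ ≤ A) :
    Integrable (Function.uncurry fun p u => g u * K p u)
      ((volume.restrict (Ioi 0)).prod (volume.restrict (Ioi 0))) := by
  have hm : AEStronglyMeasurable (Function.uncurry fun p u => g u * K p u)
      ((volume.restrict (Ioi 0)).prod (volume.restrict (Ioi 0))) :=
    (hg.aestronglyMeasurable.comp_snd).mul hK.aestronglyMeasurable
  refine ⟨hm, ?_⟩
  rw [HasFiniteIntegral, lintegral_prod _ hm.enorm]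
  refine (lintegral_kernel_le hg hK hA).trans_lt (ENNReal.mul_lt_top hAt.lt_top ?_)
  exact hg.hasFiniteIntegral

theorem lintegral_integral_kernel_le (hg : IntegrableOn g (Ioi 0))
    (hK : Measurable (Function.uncurry K))
    (hA : ∀ u, 0 < u → ∫⁻ p in Ioi (0 : ℝ), ‖K p u‖ₑ ≤ A) :
    ∫⁻ p in Ioi (0 : ℝ), ‖∫ u in Ioi (0 : ℝ), g u * K p u‖ₑ ≤
      A * ∫⁻ u in Ioi (0 : ℝ), ‖g u‖ₑ :=
  (lintegral_mono fun _ => enorm_integral_le_lintegral_enorm _).trans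
    (lintegral_kernel_le hg hK hA)

/-- The Poisson kernel has mass `π` at every height `u`, so such kernels define bounded operators on
`L¹(0, ∞)`. -/
theorem lintegral_poisson_le {C : ℝ} (hC : 0 ≤ C)
    (hK : ∀ p u : ℝ, 0 < p → 0 < u → ‖K p u‖ ≤ C * (u / (u ^ 2 + p ^ 2))) {u : ℝ} (hu : 0 < u) :
    ∫⁻ p in Ioi (0 : ℝ), ‖K p u‖ₑ ≤ ENNReal.ofReal (C * Real.pi) := by
  have h1 := integral_poissonKernel hu
  calc _ ≤ ∫⁻ p in Ioi (0 : ℝ), ENNReal.ofReal (C * (u / (u ^ 2 + p ^ 2))) := by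
        refine lintegral_mono_ae ?_
        filter_upwards [ae_restrict_mem measurableSet_Ioi] with p hp
        rw [← ofReal_norm]
        exact ENNReal.ofReal_le_ofReal (hK p u hp hu)
    _ ≤ ∫⁻ p : ℝ, ENNReal.ofReal (C * (u / (u ^ 2 + p ^ 2))) := setLIntegral_le_lintegral _ _
    _ = _ := by
        rw [← ofReal_integral_eq_lintegral_ofReal (h1.1.const_mul C)
          (ae_of_all _ fun p => by positivity), integral_const_mul, h1.2]

end Kernel

/-! ### The two Hardy inequalities -/

/-- The kernel of the difference of the Stieltjes transform and the boundary values along the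
imaginary axis, at positive points. -/
noncomputable def kerPos (p u : ℝ) : ℂ := 1 / ((u : ℂ) + p) - 1 / ((p : ℂ) + u * Complex.I)

/-- The same kernel at negative points. -/
noncomputable def kerNeg (p u : ℝ) : ℂ :=
  1 / ((u : ℂ) + p) + 1 / (((-p : ℝ) : ℂ) + u * Complex.I)

theorem measurable_kerPos : Measurable (Function.uncurry kerPos) := by
  simp only [Function.uncurry_def, kerPos]
  fun_prop

theorem measurable_kerNeg : Measurable (Function.uncurry kerNeg) := by
  simp only [Function.uncurry_def, kerNeg]
  fun_prop

theorem norm_div_poisson_le {p u : ℝ} (hp : 0 < p) (hu : 0 < u) {w z : ℂ}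
    (hw : ‖w‖ ^ 2 = 2 * u ^ 2) (hz : ‖z‖ ^ 2 = u ^ 2 + p ^ 2) :
    ‖w / ((u + p) * z)‖ ≤ 2 * (u / (u ^ 2 + p ^ 2)) := by
  have hz0 : 0 < ‖z‖ := by
    have h1 : 0 < ‖z‖ ^ 2 := by rw [hz]; positivity
    exact lt_of_le_of_ne (norm_nonneg _) fun h => by rw [← h] at h1; simp at h1
  rw [norm_div, norm_mul, ← Complex.ofReal_add, Complex.norm_of_nonneg (by positivity),
    ← mul_div_assoc, ← hz]
  have h1 : ‖w‖ ≤ 2 * u := le_of_sq_le_sq (by rw [hw]; nlinarith) (by positivity)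
  have h2 : ‖z‖ ≤ u + p := le_of_sq_le_sq (by rw [hz]; nlinarith) (by positivity)
  rw [sq]
  gcongr

/-- Each of the two terms decays only like `1/p`, but these leading terms cancel: the difference is
`u(i - 1) / ((u + p)(p + iu))`. -/
theorem norm_kerPos_le (p u : ℝ) (hp : 0 < p) (hu : 0 < u) :
    ‖kerPos p u‖ ≤ 2 * (u / (u ^ 2 + p ^ 2)) := by
  have h1 : (u + p : ℂ) ≠ 0 := by exact_mod_cast (by positivity : u + p ≠ 0)
  have h2 : ((p : ℂ) + u * Complex.I) ≠ 0 := fun h => by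
    have := congrArg Complex.re h
    simp at this
    linarith
  have e : kerPos p u = (u * (Complex.I - 1)) / ((u + p) * ((p : ℂ) + u * Complex.I)) := by
    rw [kerPos]
    field_simp
    ring
  rw [e]
  refine norm_div_poisson_le hp hu ?_ ?_
  · rw [Complex.sq_norm, Complex.normSq_apply]; simp; ring
  · rw [Complex.sq_norm, Complex.normSq_apply]; simp; ring

theorem norm_kerNeg_le (p u : ℝ) (hp : 0 < p) (hu : 0 < u) :
    ‖kerNeg p u‖ ≤ 2 * (u / (u ^ 2 + p ^ 2)) := by
  have h1 : (u + p : ℂ) ≠ 0 := by exact_mod_cast (by positivity : u + p ≠ 0)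
  have h2 : (((-p : ℝ) : ℂ) + u * Complex.I) ≠ 0 := fun h => by
    have := congrArg Complex.re h
    simp at this
    linarith
  have e : kerNeg p u =
      (u * (Complex.I + 1)) / ((u + p) * (((-p : ℝ) : ℂ) + u * Complex.I)) := by
    rw [kerNeg]
    field_simp
    push_cast
    ring
  rw [e]
  refine norm_div_poisson_le hp hu ?_ ?_
  · rw [Complex.sq_norm, Complex.normSq_apply]; simp; ring
  · rw [Complex.sq_norm, Complex.normSq_apply]; simp; ring

theorem integrableOn_mul_imag {g : ℝ → ℂ} (hg : IntegrableOn g (Ioi 0)) {x : ℝ} (hx : x ≠ 0) :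
    IntegrableOn (fun u => g u * (1 / ((x : ℂ) + u * Complex.I))) (Ioi 0) := by
  refine Integrable.mul_bdd (c := 1 / |x|) hg (Measurable.aestronglyMeasurable (by fun_prop))
    (ae_of_all _ fun u => ?_)
  rw [norm_div, norm_one]
  have h1 : |x| ≤ ‖(x : ℂ) + u * Complex.I‖ := by
    refine le_trans (le_of_eq ?_) (Complex.abs_re_le_norm _)
    simp
  have := abs_pos.2 hx
  gcongr

theorem integral_kerPos {g : ℝ → ℂ} (hg : IntegrableOn g (Ioi 0)) {p : ℝ} (hp : 0 < p) :
    ∫ u in Ioi (0 : ℝ), g u * kerPos p u = stieltjes g p - imagBoundary g p := by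
  simp_rw [kerPos, mul_sub]
  rw [integral_sub (integrableOn_mul_inv_add hg hp) (integrableOn_mul_imag hg hp.ne'), stieltjes,
    imagBoundary]

theorem integral_kerNeg {g : ℝ → ℂ} (hg : IntegrableOn g (Ioi 0)) {p : ℝ} (hp : 0 < p) :
    ∫ u in Ioi (0 : ℝ), g u * kerNeg p u = stieltjes g p + imagBoundary g (-p) := by
  simp_rw [kerNeg, mul_add]
  rw [integral_add (integrableOn_mul_inv_add hg hp) (integrableOn_mul_imag hg (by linarith)),
    stieltjes, imagBoundary]

section Hardy

variable {g h : ℝ → ℂ}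

theorem ae_hasBoundary (hg : IntegrableOn g (Ioi 0))
    (hlim : ∀ᵐ p ∂volume.restrict (Ioi (0 : ℝ)),
      Tendsto (fun δ => truncH g p δ) (𝓝[>] 0) (𝓝 (h p))) :
    ∀ᵐ p ∂volume.restrict (Ioi (0 : ℝ)), 0 < p ∧
      Tendsto (fun δ => truncH g p δ) (𝓝[>] 0) (𝓝 (h p)) ∧
      Tendsto (meanOsc ((Ioi (0 : ℝ)).indicator g) p) (𝓝[>] 0) (𝓝 0) := by
  have hf : Integrable ((Ioi (0 : ℝ)).indicator g) := hg.integrable_indicator measurableSet_Ioi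
  filter_upwards [ae_restrict_mem measurableSet_Ioi, hlim,
    ae_restrict_of_ae (ae_tendsto_meanOsc hf)] with p h1 h2 h3 using ⟨h1, h2, h3⟩

/-- This is the boundary function of `(cauchyPos g - cauchyNeg g)/π`, in which the Stieltjes
transforms cancel on both half-lines. -/
theorem fourierInt_odd_eq_zero (hg : IntegrableOn g (Ioi 0)) (hh : IntegrableOn h (Ioi 0))
    (hlim : ∀ᵐ p ∂volume.restrict (Ioi (0 : ℝ)),
      Tendsto (fun δ => truncH g p δ) (𝓝[>] 0) (𝓝 (h p))) {ξ : ℝ} (hξ : ξ ≤ 0) :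
    fourierInt (glue (fun p => g p - Complex.I * h p) fun p => -g p - Complex.I * h p) ξ = 0 := by
  have hpi : (Real.pi : ℂ) ≠ 0 := by exact_mod_cast Real.pi_ne_zero
  have hα : IntegrableOn (fun p => g p - Complex.I * h p) (Ioi 0) := hg.sub (hh.const_mul _)
  have hβ : IntegrableOn (fun p => -g p - Complex.I * h p) (Ioi 0) := hg.neg.sub (hh.const_mul _)
  refine fourierInt_boundary_eq_zero
    (((regularizable_cauchyPos hg).add ((regularizable_cauchyNeg hg).const_mul (-1))).const_mul
      (1 / (Real.pi : ℂ))) (integrable_glue hα hβ)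
    (ae_of_ae_Ioi ?_) hξ
  filter_upwards [ae_hasBoundary hg hlim] with p ⟨hp, hc, hL⟩
  constructor
  · convert ((tendsto_cauchyPos_pos hg hp hc hL).add
      ((tendsto_cauchyNeg_pos hg hp).const_mul (-1))).const_mul (1 / (Real.pi : ℂ)) using 2
    rw [glue, if_pos hp]
    field_simp
    ring
  · convert ((tendsto_cauchyPos_neg hg hp).add
      ((tendsto_cauchyNeg_neg hg hp hc hL).const_mul (-1))).const_mul (1 / (Real.pi : ℂ)) using 2
    rw [glue, if_neg (by linarith), neg_neg]
    field_simp
    ring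

/-- In `cauchyPos g + cauchyNeg g` the Stieltjes transforms add up instead of cancelling, and they
behave like `p⁻¹ ∫ g` at infinity. Subtracting `2 cauchyImag g`, whose boundary values on the real
line have no singular part for `x ≠ 0`, replaces them by integrals against `kerPos` and `kerNeg`. -/
theorem fourierInt_even_eq_zero (hg : IntegrableOn g (Ioi 0)) (hh : IntegrableOn h (Ioi 0))
    (hlim : ∀ᵐ p ∂volume.restrict (Ioi (0 : ℝ)),
      Tendsto (fun δ => truncH g p δ) (𝓝[>] 0) (𝓝 (h p)))
    (hRp : IntegrableOn (fun p => ∫ u in Ioi (0 : ℝ), g u * kerPos p u) (Ioi 0))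
    (hRn : IntegrableOn (fun p => ∫ u in Ioi (0 : ℝ), g u * kerNeg p u) (Ioi 0))
    {ξ : ℝ} (hξ : ξ ≤ 0) :
    fourierInt (glue
      (fun p => g p - Complex.I * h p +
        2 * Complex.I / Real.pi * ∫ u in Ioi (0 : ℝ), g u * kerPos p u)
      fun p => g p + Complex.I * h p -
        2 * Complex.I / Real.pi * ∫ u in Ioi (0 : ℝ), g u * kerNeg p u) ξ = 0 := by
  have hpi : (Real.pi : ℂ) ≠ 0 := by exact_mod_cast Real.pi_ne_zero
  have hα : IntegrableOn (fun p => g p - Complex.I * h p +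
      2 * Complex.I / Real.pi * ∫ u in Ioi (0 : ℝ), g u * kerPos p u) (Ioi 0) :=
    (hg.sub (hh.const_mul _)).add (hRp.const_mul _)
  have hβ : IntegrableOn (fun p => g p + Complex.I * h p -
      2 * Complex.I / Real.pi * ∫ u in Ioi (0 : ℝ), g u * kerNeg p u) (Ioi 0) :=
    (hg.add (hh.const_mul _)).sub (hRn.const_mul _)
  refine fourierInt_boundary_eq_zero
    (((regularizable_cauchyPos hg).add ((regularizable_cauchyNeg hg).add
      ((regularizable_cauchyImag hg).const_mul (-2)))).const_mul (1 / (Real.pi : ℂ)))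
    (integrable_glue hα hβ)
    (ae_of_ae_Ioi ?_) hξ
  filter_upwards [ae_hasBoundary hg hlim] with p ⟨hp, hc, hL⟩
  constructor
  · convert ((tendsto_cauchyPos_pos hg hp hc hL).add
      ((tendsto_cauchyNeg_pos hg hp).add
        ((tendsto_cauchyImag hg hp.ne').const_mul (-2)))).const_mul (1 / (Real.pi : ℂ)) using 2
    rw [glue, if_pos hp, integral_kerPos hg hp]
    field_simp
    ring
  · convert ((tendsto_cauchyPos_neg hg hp).add
      ((tendsto_cauchyNeg_neg hg hp hc hL).add
        ((tendsto_cauchyImag hg (neg_ne_zero.2 hp.ne')).const_mul (-2)))).const_mul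
          (1 / (Real.pi : ℂ)) using 2
    rw [glue, if_neg (by linarith), neg_neg, integral_kerNeg hg hp]
    field_simp
    ring

theorem ofReal_integral_norm_glue {α β : ℝ → ℂ} (hα : IntegrableOn α (Ioi 0))
    (hβ : IntegrableOn β (Ioi 0)) : ENNReal.ofReal (4 * ∫ x, ‖glue α β x‖) =
      4 * ((∫⁻ x in Ioi (0 : ℝ), ‖α x‖ₑ) + ∫⁻ x in Ioi (0 : ℝ), ‖β x‖ₑ) := by
  rw [ENNReal.ofReal_mul (by norm_num), ← lintegral_glue,
    ofReal_integral_norm_eq_lintegral_enorm (integrable_glue hα hβ)]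
  norm_num

theorem integrableOn_mul_exp {α : ℝ → ℂ} (hα : IntegrableOn α (Ioi 0)) (ξ : ℝ) :
    IntegrableOn (fun x : ℝ => α x * Complex.exp (-(Complex.I * ξ * x))) (Ioi 0) ∧
      IntegrableOn (fun x : ℝ => α x * Complex.exp (Complex.I * ξ * x)) (Ioi 0) :=
  ⟨Integrable.mul_bdd (c := 1) hα (by fun_prop) (ae_of_all _ fun x => (norm_exp_neg_I_mul ξ x).le),
    Integrable.mul_bdd (c := 1) hα (by fun_prop) (ae_of_all _ fun x => (norm_exp_I_mul ξ x).le)⟩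

theorem fourierInt_glue_neg {α β : ℝ → ℂ} (hα : IntegrableOn α (Ioi 0))
    (hβ : IntegrableOn β (Ioi 0)) (ξ : ℝ) :
    fourierInt (glue α β) (-ξ) =
      (∫ x in Ioi (0 : ℝ), α x * Complex.exp (Complex.I * ξ * x)) +
        ∫ x in Ioi (0 : ℝ), β x * Complex.exp (-(Complex.I * ξ * x)) := by
  rw [fourierInt_glue hα hβ]
  push_cast
  congr! 5 <;> ring

theorem fourierInt_glue_sub {α β : ℝ → ℂ} (hα : IntegrableOn α (Ioi 0))
    (hβ : IntegrableOn β (Ioi 0)) (ξ : ℝ) :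
    fourierInt (glue α β) ξ - fourierInt (glue α β) (-ξ) =
      ∫ x in Ioi (0 : ℝ), (β x - α x) *
        (Complex.exp (Complex.I * ξ * x) - Complex.exp (-(Complex.I * ξ * x))) := by
  have a := integrableOn_mul_exp hα ξ
  have b := integrableOn_mul_exp hβ ξ
  have i1 : IntegrableOn (fun x : ℝ => α x * Complex.exp (-(Complex.I * ξ * x)) -
      α x * Complex.exp (Complex.I * ξ * x)) (Ioi 0) := a.1.sub a.2
  have i2 : IntegrableOn (fun x : ℝ => β x * Complex.exp (Complex.I * ξ * x) -
      β x * Complex.exp (-(Complex.I * ξ * x))) (Ioi 0) := b.2.sub b.1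
  rw [fourierInt_glue hα hβ, fourierInt_glue_neg hα hβ, add_sub_add_comm,
    ← integral_sub a.1 a.2, ← integral_sub b.2 b.1, ← integral_add i1 i2]
  refine integral_congr_ae (ae_of_all _ fun x => ?_)
  ring

theorem fourierInt_glue_add {α β : ℝ → ℂ} (hα : IntegrableOn α (Ioi 0))
    (hβ : IntegrableOn β (Ioi 0)) (ξ : ℝ) :
    fourierInt (glue α β) ξ + fourierInt (glue α β) (-ξ) =
      ∫ x in Ioi (0 : ℝ), (α x + β x) *
        (Complex.exp (Complex.I * ξ * x) + Complex.exp (-(Complex.I * ξ * x))) := by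
  have a := integrableOn_mul_exp hα ξ
  have b := integrableOn_mul_exp hβ ξ
  have i1 : IntegrableOn (fun x : ℝ => α x * Complex.exp (-(Complex.I * ξ * x)) +
      α x * Complex.exp (Complex.I * ξ * x)) (Ioi 0) := a.1.add a.2
  have i2 : IntegrableOn (fun x : ℝ => β x * Complex.exp (Complex.I * ξ * x) +
      β x * Complex.exp (-(Complex.I * ξ * x))) (Ioi 0) := b.2.add b.1
  rw [fourierInt_glue hα hβ, fourierInt_glue_neg hα hβ, add_add_add_comm,
    ← integral_add a.1 a.2, ← integral_add b.2 b.1, ← integral_add i1 i2]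
  refine integral_congr_ae (ae_of_all _ fun x => ?_)
  ring

/-- Hardy's inequality for the sine transform. -/
theorem lintegral_sineQuot_le (hg : IntegrableOn g (Ioi 0)) (hh : IntegrableOn h (Ioi 0))
    (hlim : ∀ᵐ p ∂volume.restrict (Ioi (0 : ℝ)),
      Tendsto (fun δ => truncH g p δ) (𝓝[>] 0) (𝓝 (h p))) :
    ∫⁻ ξ in Ioi (0 : ℝ), ‖sineQuot g ξ‖ₑ ≤
      8 * ((∫⁻ x in Ioi (0 : ℝ), ‖g x‖ₑ) + ∫⁻ x in Ioi (0 : ℝ), ‖h x‖ₑ) := by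
  set α : ℝ → ℂ := fun p => g p - Complex.I * h p with hαd
  set β : ℝ → ℂ := fun p => -g p - Complex.I * h p with hβd
  have hα : IntegrableOn α (Ioi 0) := hg.sub (hh.const_mul _)
  have hβ : IntegrableOn β (Ioi 0) := hg.neg.sub (hh.const_mul _)
  have hzero : ∀ ξ ≤ 0, fourierInt (glue α β) ξ = 0 := fun ξ hξ =>
    fourierInt_odd_eq_zero hg hh hlim hξ
  have main := lintegral_fourierInt_div_le (integrable_glue hα hβ) hzero
  rw [ofReal_integral_norm_glue hα hβ] at main
  -- The value at `-ξ` is zero and may be subtracted. This leaves the transform of `β - α = -2g`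
  -- against `e^{iξx} - e^{-iξx} = 2i sin ξx`, so `h` drops out.
  have hft : ∀ ξ : ℝ, 0 < ξ → fourierInt (glue α β) ξ = -4 * Complex.I * sineTransform g ξ := by
    intro ξ hξ
    rw [← sub_zero (fourierInt (glue α β) ξ), ← hzero (-ξ) (by linarith),
      fourierInt_glue_sub hα hβ, sineTransform, ← integral_const_mul]
    refine integral_congr_ae (ae_of_all _ fun x => ?_)
    simp only [hαd, hβd]
    rw [Complex.ofReal_sin, Complex.sin]
    push_cast
    have e3 : Complex.exp (-(Complex.I * ξ * x)) = Complex.exp (-(ξ * x) * Complex.I) := by ring_nf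
    have e4 : Complex.exp (Complex.I * ξ * x) = Complex.exp (ξ * x * Complex.I) := by ring_nf
    rw [e3, e4]
    linear_combination (2 * g x * (Complex.exp (-(ξ * x) * Complex.I) -
      Complex.exp (ξ * x * Complex.I))) * Complex.I_sq
  have hle : ∀ ξ ∈ Ioi (0 : ℝ), ‖fourierInt (glue α β) ξ / ξ‖ₑ = 4 * ‖sineQuot g ξ‖ₑ := by
    intro ξ hξ
    rw [hft ξ hξ, sineQuot, mul_div_assoc, enorm_mul]
    congr 1
    rw [← ofReal_norm]
    simp
  rw [setLIntegral_congr_fun measurableSet_Ioi hle, lintegral_const_mul' _ _ (by norm_num)] at main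
  have main2 := (ENNReal.mul_le_mul_iff_right (by norm_num) (by norm_num)).1 main
  refine main2.trans ?_
  have hαβ : ∀ s t : ℂ, ‖s - Complex.I * t‖ₑ ≤ ‖s‖ₑ + ‖t‖ₑ := fun s t => by
    refine (enorm_sub_le).trans (le_of_eq ?_)
    rw [enorm_mul]
    congr 1
    rw [← ofReal_norm, Complex.norm_I]
    simp
  have hs : ∫⁻ x in Ioi (0 : ℝ), (‖g x‖ₑ + ‖h x‖ₑ) =
      (∫⁻ x in Ioi (0 : ℝ), ‖g x‖ₑ) + ∫⁻ x in Ioi (0 : ℝ), ‖h x‖ₑ :=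
    lintegral_add_left' hg.aestronglyMeasurable.enorm _
  have b1 : ∫⁻ x in Ioi (0 : ℝ), ‖α x‖ₑ ≤
      (∫⁻ x in Ioi (0 : ℝ), ‖g x‖ₑ) + ∫⁻ x in Ioi (0 : ℝ), ‖h x‖ₑ := by
    rw [← hs]
    exact lintegral_mono fun x => hαβ _ _
  have b2 : ∫⁻ x in Ioi (0 : ℝ), ‖β x‖ₑ ≤
      (∫⁻ x in Ioi (0 : ℝ), ‖g x‖ₑ) + ∫⁻ x in Ioi (0 : ℝ), ‖h x‖ₑ := by
    rw [← hs]
    refine lintegral_mono fun x => (hαβ _ _).trans (le_of_eq ?_)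
    rw [enorm_neg]
  refine (add_le_add b1 b2).trans ?_
  rw [← two_mul]
  gcongr
  norm_num

end Hardy

/-! ### The even Hardy inequality -/

theorem norm_exp_I_mul_le_one {ξ : ℝ} (hξ : 0 ≤ ξ) {z : ℂ} (hz : 0 ≤ z.im) :
    ‖Complex.exp (Complex.I * ξ * z)‖ ≤ 1 := by
  rw [Complex.norm_exp, Real.exp_le_one_iff]
  simp
  positivity

theorem dslope_exp_of_ne {ξ : ℝ} {a z : ℂ} (h : z ≠ a) :
    dslope (fun w => Complex.exp (Complex.I * ξ * w)) a z =
      (Complex.exp (Complex.I * ξ * z) - Complex.exp (Complex.I * ξ * a)) / (z - a) := by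
  rw [dslope_of_ne _ h, slope_def_field]

theorem differentiable_dslope_exp (ξ : ℝ) (a : ℂ) :
    Differentiable ℂ (dslope (fun w => Complex.exp (Complex.I * ξ * w)) a) := by
  have h : DifferentiableOn ℂ (fun w => Complex.exp (Complex.I * ξ * w)) univ :=
    Differentiable.differentiableOn (by fun_prop)
  exact differentiableOn_univ.1 ((Complex.differentiableOn_dslope univ_mem).2 h)

/-- Subtracting the value of the exponential at `iu` removes the only pole in the upper half-plane;
the quotient decays quadratically because `ξ ≥ 0`. -/
theorem integral_exp_sub_mul_poisson {ξ u : ℝ} (hξ : 0 ≤ ξ) (hu : 0 < u) :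
    ∫ x : ℝ, (Complex.exp (Complex.I * ξ * x) - Complex.exp (-(ξ * u))) /
      ((u : ℂ) ^ 2 + x ^ 2) = 0 := by
  set a : ℂ := u * Complex.I with ha
  have hea : Complex.exp (Complex.I * ξ * a) = Complex.exp (-(ξ * u)) := by
    congr 1
    rw [ha]
    linear_combination ((ξ : ℂ) * u) * Complex.I_sq
  have hne : ∀ z : ℂ, 0 ≤ z.im → z + a ≠ 0 := fun z hz h => by
    have := congrArg Complex.im h
    simp [ha] at this
    linarith
  have hd : DifferentiableOn ℂ (fun z => dslope (fun w => Complex.exp (Complex.I * ξ * w)) a z /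
      (z + a)) {z | 0 ≤ z.im} := by
    refine (differentiable_dslope_exp ξ a).differentiableOn.div (by fun_prop) fun z hz => hne z hz
  have key := integral_line_eq_zero le_rfl hd (C := 8) (R₀ := 2 * u) fun z hz hR => by
    have hna : ‖a‖ = u := by simp [ha, abs_of_pos hu]
    have h1 : ‖z‖ / 2 ≤ ‖z - a‖ := by
      have := norm_sub_norm_le z a
      linarith
    have h2 : ‖z‖ / 2 ≤ ‖z + a‖ := by
      have := norm_sub_norm_le z (-a)
      rw [norm_neg, sub_neg_eq_add] at this
      linarith
    have hz0 : 0 < ‖z‖ := by linarith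
    have hza : z ≠ a := fun h => by
      rw [h, sub_self, norm_zero, hna] at h1
      linarith
    rw [dslope_exp_of_ne hza, norm_div, norm_div, div_div]
    have h3 : ‖Complex.exp (Complex.I * ξ * z) - Complex.exp (Complex.I * ξ * a)‖ ≤ 2 := by
      refine (norm_sub_le _ _).trans ?_
      have := norm_exp_I_mul_le_one hξ hz
      have := norm_exp_I_mul_le_one hξ (z := a) (by simp [ha, hu.le])
      linarith
    calc _ ≤ 2 / (‖z‖ / 2 * (‖z‖ / 2)) := by gcongr
      _ = _ := by field_simp; norm_num
  rw [← key]
  refine integral_congr_ae (ae_of_all _ fun x => ?_)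
  have hxa : (x : ℂ) ≠ a := fun h => by
    have := congrArg Complex.im h
    simp [ha] at this
    linarith
  simp only [Complex.ofReal_zero, zero_mul, add_zero]
  rw [dslope_exp_of_ne hxa, div_div, hea]
  congr 1
  rw [ha]
  linear_combination ((u : ℂ) ^ 2) * Complex.I_sq

/-- The Fourier transform of the Poisson kernel. -/
theorem integral_exp_mul_poisson {ξ u : ℝ} (hξ : 0 ≤ ξ) (hu : 0 < u) :
    ∫ x : ℝ, ((u / (u ^ 2 + x ^ 2) : ℝ) : ℂ) * Complex.exp (Complex.I * ξ * x) =
      Real.pi * Complex.exp (-(ξ * u)) := by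
  obtain ⟨hi, hv⟩ := integral_poissonKernel hu
  have hi2 : Integrable fun x : ℝ => ((u / (u ^ 2 + x ^ 2) : ℝ) : ℂ) := hi.ofReal
  have hi1 : Integrable fun x : ℝ =>
      ((u / (u ^ 2 + x ^ 2) : ℝ) : ℂ) * Complex.exp (Complex.I * ξ * x) :=
    hi2.mul_bdd (c := 1) (by fun_prop) (ae_of_all _ fun x => (norm_exp_I_mul ξ x).le)
  have h := integral_exp_sub_mul_poisson hξ hu
  have h2 := congrArg (fun w => (u : ℂ) * w) h
  simp only [mul_zero] at h2
  rw [← integral_const_mul] at h2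
  have e : ∀ x : ℝ, (u : ℂ) * ((Complex.exp (Complex.I * ξ * x) - Complex.exp (-(ξ * u))) /
      ((u : ℂ) ^ 2 + x ^ 2)) = ((u / (u ^ 2 + x ^ 2) : ℝ) : ℂ) * Complex.exp (Complex.I * ξ * x) -
        ((u / (u ^ 2 + x ^ 2) : ℝ) : ℂ) * Complex.exp (-(ξ * u)) := fun x => by
    push_cast
    ring
  simp_rw [e] at h2
  rw [integral_sub hi1 (hi2.mul_const _), integral_mul_const, integral_complex_ofReal, hv] at h2
  exact sub_eq_zero.1 h2

/-- The Poisson kernel times twice a cosine. -/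
noncomputable def cosPoisson (ξ p u : ℝ) : ℂ :=
  ((u / (u ^ 2 + p ^ 2) : ℝ) : ℂ) *
    (Complex.exp (Complex.I * ξ * p) + Complex.exp (-(Complex.I * ξ * p)))

theorem measurable_cosPoisson (ξ : ℝ) : Measurable (Function.uncurry (cosPoisson ξ)) := by
  simp only [Function.uncurry_def, cosPoisson]
  fun_prop

theorem norm_cosPoisson_le (ξ p u : ℝ) (hp : 0 < p) (hu : 0 < u) :
    ‖cosPoisson ξ p u‖ ≤ 2 * (u / (u ^ 2 + p ^ 2)) := by
  rw [cosPoisson, norm_mul, Complex.norm_of_nonneg (by positivity), mul_comm]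
  gcongr
  refine (norm_add_le _ _).trans ?_
  rw [norm_exp_I_mul, norm_exp_neg_I_mul]
  norm_num

theorem integral_cosPoisson {ξ u : ℝ} (hξ : 0 ≤ ξ) (hu : 0 < u) :
    ∫ p in Ioi (0 : ℝ), cosPoisson ξ p u = Real.pi * Complex.exp (-(ξ * u)) := by
  have hi2 : Integrable fun x : ℝ => ((u / (u ^ 2 + x ^ 2) : ℝ) : ℂ) :=
    (integral_poissonKernel hu).1.ofReal
  have a := integrableOn_mul_exp (hi2.integrableOn (s := Ioi 0)) ξ
  rw [← integral_exp_mul_poisson hξ hu]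
  -- The even kernel is its own glueing, so its Fourier integral over the line folds into a cosine
  -- integral over the half-line.
  have h := fourierInt_glue_neg hi2.integrableOn hi2.integrableOn ξ
  rw [← integral_add a.2 a.1] at h
  rw [fourierInt] at h
  simp_rw [cosPoisson, mul_add]
  rw [← h]
  refine integral_congr_ae (ae_of_all _ fun x => ?_)
  simp only [glue, even_two, Even.neg_pow, ite_self]
  push_cast
  congr 2
  ring

section Even

variable {g h : ℝ → ℂ}

/-- The difference of the cosine transform and the Laplace transform. -/
noncomputable def cosExp (g : ℝ → ℂ) (ξ : ℝ) : ℂ :=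
  ∫ u in Ioi (0 : ℝ), g u * ((Real.cos (ξ * u) - Real.exp (-(ξ * u)) : ℝ) : ℂ)

theorem integral_integral_poisson_mul (hg : IntegrableOn g (Ioi 0)) {ξ : ℝ} (hξ : 0 ≤ ξ) :
    IntegrableOn (fun p => ∫ u in Ioi (0 : ℝ), g u * cosPoisson ξ p u) (Ioi 0) ∧
    ∫ p in Ioi (0 : ℝ), ∫ u in Ioi (0 : ℝ), g u * cosPoisson ξ p u =
      Real.pi * ∫ u in Ioi (0 : ℝ), g u * Complex.exp (-(ξ * u)) := by
  have hi := integrable_kernel hg (measurable_cosPoisson ξ) ENNReal.ofReal_ne_top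
    fun u hu => lintegral_poisson_le (by norm_num) (norm_cosPoisson_le ξ) hu
  refine ⟨hi.integral_prod_left, ?_⟩
  rw [integral_integral_swap hi, ← integral_const_mul]
  refine setIntegral_congr_fun measurableSet_Ioi fun u hu => ?_
  rw [integral_const_mul, integral_cosPoisson hξ hu]
  ring

/-- The Stieltjes terms cancel and leave a Poisson kernel, whose cosine transform is the Laplace
exponential in `cosExp`. -/
theorem kerPos_sub_kerNeg {p u : ℝ} (hp : 0 < p) :
    kerPos p u - kerNeg p u = 2 * Complex.I * ((u / (u ^ 2 + p ^ 2) : ℝ) : ℂ) := by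
  have h2 : ((p : ℂ) + u * Complex.I) ≠ 0 := fun h => by
    have := congrArg Complex.re h
    simp at this
    linarith
  have h3 : (((-p : ℝ) : ℂ) + u * Complex.I) ≠ 0 := fun h => by
    have := congrArg Complex.re h
    simp at this
    linarith
  have e : ((u : ℂ) ^ 2 + p ^ 2) = -((p : ℂ) + u * Complex.I) * (((-p : ℝ) : ℂ) + u * Complex.I) := by
    push_cast
    linear_combination ((u : ℂ) ^ 2) * Complex.I_sq
  rw [kerPos, kerNeg]
  push_cast
  rw [e]
  push_cast at h3 ⊢
  field_simp
  ring

/-- Hardy's inequality for the difference of the cosine and Laplace transforms. -/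
theorem lintegral_cosExp_div_le (hg : IntegrableOn g (Ioi 0)) (hh : IntegrableOn h (Ioi 0))
    (hlim : ∀ᵐ p ∂volume.restrict (Ioi (0 : ℝ)),
      Tendsto (fun δ => truncH g p δ) (𝓝[>] 0) (𝓝 (h p))) :
    ∫⁻ ξ in Ioi (0 : ℝ), ‖cosExp g ξ / ξ‖ₑ ≤
      10 * ((∫⁻ x in Ioi (0 : ℝ), ‖g x‖ₑ) + ∫⁻ x in Ioi (0 : ℝ), ‖h x‖ₑ) := by
  have hbp : ∀ u : ℝ, 0 < u → ∫⁻ p in Ioi (0 : ℝ), ‖kerPos p u‖ₑ ≤ ENNReal.ofReal (2 * Real.pi) :=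
    fun u hu => lintegral_poisson_le (by norm_num) norm_kerPos_le hu
  have hbn : ∀ u : ℝ, 0 < u → ∫⁻ p in Ioi (0 : ℝ), ‖kerNeg p u‖ₑ ≤ ENNReal.ofReal (2 * Real.pi) :=
    fun u hu => lintegral_poisson_le (by norm_num) norm_kerNeg_le hu
  have hkp := integrable_kernel hg measurable_kerPos ENNReal.ofReal_ne_top hbp
  have hkn := integrable_kernel hg measurable_kerNeg ENNReal.ofReal_ne_top hbn
  have hRp : IntegrableOn (fun p => ∫ u in Ioi (0 : ℝ), g u * kerPos p u) (Ioi 0) :=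
    hkp.integral_prod_left
  have hRn : IntegrableOn (fun p => ∫ u in Ioi (0 : ℝ), g u * kerNeg p u) (Ioi 0) :=
    hkn.integral_prod_left
  set α : ℝ → ℂ := fun p => g p - Complex.I * h p +
    2 * Complex.I / Real.pi * ∫ u in Ioi (0 : ℝ), g u * kerPos p u with hαd
  set β : ℝ → ℂ := fun p => g p + Complex.I * h p -
    2 * Complex.I / Real.pi * ∫ u in Ioi (0 : ℝ), g u * kerNeg p u with hβd
  have hα : IntegrableOn α (Ioi 0) := (hg.sub (hh.const_mul _)).add (hRp.const_mul _)
  have hβ : IntegrableOn β (Ioi 0) := (hg.add (hh.const_mul _)).sub (hRn.const_mul _)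
  have hzero : ∀ ξ ≤ 0, fourierInt (glue α β) ξ = 0 := fun ξ hξ =>
    fourierInt_even_eq_zero hg hh hlim hRp hRn hξ
  have main := lintegral_fourierInt_div_le (integrable_glue hα hβ) hzero
  rw [ofReal_integral_norm_glue hα hβ] at main
  have hpi : (Real.pi : ℂ) ≠ 0 := by exact_mod_cast Real.pi_ne_zero
  -- Adding the zero value at `-ξ` leaves `α + β` against `2 cos ξp`. There `h` drops out and `α +
  -- β` is `2g` minus `4/π` times the Poisson integral of `g`, whose transform is `π` times the
  -- Laplace transform.
  have hft : ∀ ξ : ℝ, 0 < ξ → fourierInt (glue α β) ξ = 4 * cosExp g ξ := by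
    intro ξ hξ
    obtain ⟨hP, hPv⟩ := integral_integral_poisson_mul hg hξ.le
    have hge := integrableOn_mul_exp hg ξ
    have hgL : IntegrableOn (fun u : ℝ => g u * Complex.exp (-(ξ * u))) (Ioi 0) := by
      refine Integrable.mul_bdd (c := 1) hg (by fun_prop) ?_
      filter_upwards [ae_restrict_mem measurableSet_Ioi] with u hu
      have hu' : (0 : ℝ) < u := hu
      rw [Complex.norm_exp, Real.exp_le_one_iff]
      simp
      positivity
    have hE : IntegrableOn (fun u : ℝ => g u * (Complex.exp (Complex.I * ξ * u) +
        Complex.exp (-(Complex.I * ξ * u)))) (Ioi 0) :=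
      (hge.2.add hge.1).congr (ae_of_all _ fun u => by simp [mul_add])
    rw [← add_zero (fourierInt (glue α β) ξ), ← hzero (-ξ) (by linarith),
      fourierInt_glue_add hα hβ]
    have e : ∀ p ∈ Ioi (0 : ℝ), (α p + β p) *
        (Complex.exp (Complex.I * ξ * p) + Complex.exp (-(Complex.I * ξ * p))) =
        2 * (g p * (Complex.exp (Complex.I * ξ * p) + Complex.exp (-(Complex.I * ξ * p)))) -
          4 / Real.pi * ∫ u in Ioi (0 : ℝ), g u * cosPoisson ξ p u := by
      intro p hp
      have e1 : (∫ u in Ioi (0 : ℝ), g u * kerPos p u) - (∫ u in Ioi (0 : ℝ), g u * kerNeg p u) =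
          2 * Complex.I * ∫ u in Ioi (0 : ℝ), g u * ((u / (u ^ 2 + p ^ 2) : ℝ) : ℂ) := by
        rw [integral_kerPos hg hp, integral_kerNeg hg hp, stieltjes, imagBoundary, imagBoundary,
          ← integral_const_mul]
        have j1 := integrableOn_mul_imag hg (x := p) (ne_of_gt hp)
        have j2 := integrableOn_mul_imag hg (x := -p) (neg_ne_zero.2 (ne_of_gt hp))
        rw [add_comm, sub_add_eq_sub_sub_swap, sub_sub_cancel_left, ← neg_add', ← integral_add j1 j2,
          ← integral_neg]
        refine integral_congr_ae (ae_of_all _ fun u => ?_)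
        have := kerPos_sub_kerNeg (u := u) hp
        rw [kerPos, kerNeg] at this
        linear_combination g u * this
      have e2 : (∫ u in Ioi (0 : ℝ), g u * cosPoisson ξ p u) =
          (∫ u in Ioi (0 : ℝ), g u * ((u / (u ^ 2 + p ^ 2) : ℝ) : ℂ)) *
            (Complex.exp (Complex.I * ξ * p) + Complex.exp (-(Complex.I * ξ * p))) := by
        rw [← integral_mul_const]
        simp_rw [cosPoisson, mul_assoc]
      rw [e2]
      simp only [hαd, hβd]
      linear_combination (2 * Complex.I / Real.pi *
        (Complex.exp (Complex.I * ξ * p) + Complex.exp (-(Complex.I * ξ * p)))) * e1 +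
        (4 / Real.pi * (∫ u in Ioi (0 : ℝ), g u * ((u / (u ^ 2 + p ^ 2) : ℝ) : ℂ)) *
          (Complex.exp (Complex.I * ξ * p) + Complex.exp (-(Complex.I * ξ * p)))) * Complex.I_sq
    rw [setIntegral_congr_fun measurableSet_Ioi e, integral_sub (hE.const_mul _) (hP.const_mul _),
      integral_const_mul, integral_const_mul, hPv, cosExp, ← mul_assoc, div_mul_cancel₀ _ hpi,
      ← integral_const_mul, ← integral_const_mul, ← integral_const_mul,
      ← integral_sub (hE.const_mul _) (hgL.const_mul _)]
    refine integral_congr_ae (ae_of_all _ fun x => ?_)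
    push_cast
    rw [Complex.cos]
    have e3 : Complex.exp (-(Complex.I * ξ * x)) = Complex.exp (-(ξ * x) * Complex.I) := by ring_nf
    have e4 : Complex.exp (Complex.I * ξ * x) = Complex.exp (ξ * x * Complex.I) := by ring_nf
    simp only [e3, e4]
    ring
  have hle : ∀ ξ ∈ Ioi (0 : ℝ), ‖fourierInt (glue α β) ξ / ξ‖ₑ = 4 * ‖cosExp g ξ / ξ‖ₑ := by
    intro ξ hξ
    rw [hft ξ hξ, mul_div_assoc, enorm_mul]
    congr 1
    rw [← ofReal_norm]
    simp
  rw [setLIntegral_congr_fun measurableSet_Ioi hle, lintegral_const_mul' _ _ (by norm_num)] at main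
  have main2 := (ENNReal.mul_le_mul_iff_right (by norm_num) (by norm_num)).1 main
  refine main2.trans ?_
  set G := ∫⁻ x in Ioi (0 : ℝ), ‖g x‖ₑ
  set H := ∫⁻ x in Ioi (0 : ℝ), ‖h x‖ₑ
  -- Each correction term costs `(2/π)(2π) = 4` times the norm of `g`; hence `10 = 2(1 + 4)`.
  have hc : ‖2 * Complex.I / (Real.pi : ℂ)‖ₑ * ENNReal.ofReal (2 * Real.pi) = 4 := by
    rw [← ofReal_norm, ← ENNReal.ofReal_mul (norm_nonneg _)]
    simp only [Complex.norm_div, Complex.norm_mul, Complex.norm_ofNat, Complex.norm_I, mul_one,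
      Complex.norm_real, Real.norm_eq_abs, abs_of_pos Real.pi_pos]
    rw [div_mul_eq_mul_div, mul_left_comm, mul_div_assoc, mul_div_assoc, div_self Real.pi_ne_zero]
    norm_num
  have bound : ∀ {K : ℝ → ℝ → ℂ}, Measurable (Function.uncurry K) →
      (∀ u : ℝ, 0 < u → ∫⁻ p in Ioi (0 : ℝ), ‖K p u‖ₑ ≤ ENNReal.ofReal (2 * Real.pi)) →
      ∫⁻ p in Ioi (0 : ℝ), (‖g p‖ₑ + ‖h p‖ₑ +
        ‖2 * Complex.I / (Real.pi : ℂ)‖ₑ * ‖∫ u in Ioi (0 : ℝ), g u * K p u‖ₑ) ≤ G + H + 4 * G := by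
    intro K hKm hK
    have hm : AEMeasurable (fun p => ‖g p‖ₑ + ‖h p‖ₑ) (volume.restrict (Ioi 0)) :=
      hg.aestronglyMeasurable.enorm.add hh.aestronglyMeasurable.enorm
    rw [lintegral_add_left' hm,
      lintegral_add_left' hg.aestronglyMeasurable.enorm, lintegral_const_mul' _ _ enorm_ne_top,
      ← hc, mul_assoc]
    gcongr
    exact lintegral_integral_kernel_le hg hKm hK
  have b1 : ∫⁻ x in Ioi (0 : ℝ), ‖α x‖ₑ ≤ G + H + 4 * G := by
    refine le_trans (lintegral_mono fun p => ?_) (bound measurable_kerPos hbp)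
    refine (enorm_add_le _ _).trans ?_
    rw [enorm_mul (2 * Complex.I / (Real.pi : ℂ))]
    gcongr
    refine enorm_sub_le.trans (le_of_eq ?_)
    rw [enorm_mul]
    congr 1
    rw [← ofReal_norm, Complex.norm_I]
    simp
  have b2 : ∫⁻ x in Ioi (0 : ℝ), ‖β x‖ₑ ≤ G + H + 4 * G := by
    refine le_trans (lintegral_mono fun p => ?_) (bound measurable_kerNeg hbn)
    refine enorm_sub_le.trans ?_
    rw [enorm_mul (2 * Complex.I / (Real.pi : ℂ))]
    gcongr
    refine (enorm_add_le _ _).trans (le_of_eq ?_)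
    rw [enorm_mul]
    congr 1
    rw [← ofReal_norm, Complex.norm_I]
    simp
  refine (add_le_add b1 b2).trans ?_
  calc G + H + 4 * G + (G + H + 4 * G) = 10 * G + 2 * H := by ring
    _ ≤ 10 * G + 10 * H := by gcongr; norm_num
    _ = _ := by ring

end Even

/-! ### The sine integral and the kernel of the composed transform -/

/-- An oscillatory integral against a decreasing amplitude. -/
theorem abs_integral_sin_mul_le {f f' : ℝ → ℝ} {a b v : ℝ} (hab : a ≤ b) (hv : 0 < v)
    (hf : ∀ t ∈ Icc a b, HasDerivAt f (f' t) t) (hc : ContinuousOn f' (Icc a b))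
    (hneg : ∀ t ∈ Icc a b, f' t ≤ 0) (hpos : ∀ t ∈ Icc a b, 0 ≤ f t) :
    |∫ t in a..b, Real.sin (v * t) * f t| ≤ 2 * f a / v := by
  have hu : uIcc a b = Icc a b := uIcc_of_le hab
  have hder : ∀ t ∈ uIcc a b, HasDerivAt (fun t => -Real.cos (v * t) / v) (Real.sin (v * t)) t := by
    intro t _
    have h := (((hasDerivAt_id t).const_mul v).cos.neg).div_const v
    have e : Real.sin (v * t) = -(-Real.sin (v * id t) * (v * 1)) / v := by
      simp only [id_eq]
      field_simp
    rw [e]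
    exact h
  have hi : IntervalIntegrable f' volume a b := ContinuousOn.intervalIntegrable (by rwa [hu])
  have hs : IntervalIntegrable (fun t => Real.sin (v * t)) volume a b :=
    Continuous.intervalIntegrable (by fun_prop) _ _
  have key := intervalIntegral.integral_mul_deriv_eq_deriv_mul
    (fun t ht => hf t (by rwa [hu] at ht)) hder hi hs
  have hftc : ∫ t in a..b, f' t = f b - f a :=
    intervalIntegral.integral_eq_sub_of_hasDerivAt (fun t ht => hf t (by rwa [hu] at ht)) hi
  have hcos : ∀ t, |-Real.cos (v * t) / v| ≤ 1 / v := fun t => by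
    rw [abs_div, abs_neg, abs_of_pos hv]
    gcongr
    exact Real.abs_cos_le_one _
  have hrest : |∫ t in a..b, f' t * (-Real.cos (v * t) / v)| ≤ (f a - f b) / v := by
    have e : (f a - f b) / v = ∫ t in a..b, -f' t * (1 / v) := by
      rw [intervalIntegral.integral_mul_const, intervalIntegral.integral_neg, hftc]
      ring
    rw [e, ← Real.norm_eq_abs]
    refine intervalIntegral.norm_integral_le_of_norm_le hab (ae_of_all _ fun t ht => ?_)
      (hi.neg.mul_const _)
    rw [norm_mul, Real.norm_eq_abs, Real.norm_eq_abs,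
      abs_of_nonpos (hneg t (Ioc_subset_Icc_self ht))]
    exact mul_le_mul_of_nonneg_left (hcos t) (neg_nonneg.2 (hneg t (Ioc_subset_Icc_self ht)))
  simp_rw [mul_comm (Real.sin _)]
  rw [key]
  have ha := hpos a ⟨le_rfl, hab⟩
  have hb := hpos b ⟨hab, le_rfl⟩
  have h1 : |f b * (-Real.cos (v * b) / v)| ≤ f b * (1 / v) := by
    rw [abs_mul, abs_of_nonneg hb]
    exact mul_le_mul_of_nonneg_left (hcos b) hb
  have h2 : |f a * (-Real.cos (v * a) / v)| ≤ f a * (1 / v) := by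
    rw [abs_mul, abs_of_nonneg ha]
    exact mul_le_mul_of_nonneg_left (hcos a) ha
  have e2 : 2 * f a / v = f b * (1 / v) + f a * (1 / v) + (f a - f b) / v := by ring
  rw [e2]
  refine (abs_sub _ _).trans (add_le_add ((abs_sub _ _).trans (add_le_add h1 h2)) hrest)

/-- The sine integral. -/
noncomputable def sineInt (v : ℝ) : ℝ := ∫ s in (0 : ℝ)..v, Real.sinc s

theorem continuous_sineInt : Continuous sineInt :=
  intervalIntegral.continuous_primitive
    (fun _ _ => Real.continuous_sinc.intervalIntegrable _ _) 0

theorem abs_sineInt_le (v : ℝ) : |sineInt v| ≤ |v| := by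
  have h := intervalIntegral.norm_integral_le_of_norm_le_const (a := 0) (b := v) (C := 1)
    (f := Real.sinc) fun x _ => Real.abs_sinc_le_one x
  simpa [sineInt] using h

theorem sineInt_sub (a b : ℝ) : sineInt b - sineInt a = ∫ s in a..b, Real.sinc s :=
  intervalIntegral.integral_interval_sub_left
    (Real.continuous_sinc.intervalIntegrable _ _) (Real.continuous_sinc.intervalIntegrable _ _)

theorem abs_sineInt_sub_le {a b : ℝ} (ha : 0 < a) (hab : a ≤ b) :
    |sineInt b - sineInt a| ≤ 2 / a := by
  have hne : ∀ t ∈ Icc a b, t ≠ 0 := fun t ht => (ha.trans_le ht.1).ne'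
  have h := abs_integral_sin_mul_le (f := fun t => t⁻¹) (f' := fun t => -(t ^ 2)⁻¹) hab one_pos
    (fun t ht => hasDerivAt_inv (hne t ht))
    (ContinuousOn.neg (ContinuousOn.inv₀ (by fun_prop) fun t ht => pow_ne_zero 2 (hne t ht)))
    (fun t ht => by simp; positivity) (fun t ht => inv_nonneg.2 (ha.le.trans ht.1))
  rw [sineInt_sub]
  have e : ∫ s in a..b, Real.sinc s = ∫ t in a..b, Real.sin (1 * t) * t⁻¹ := by
    refine intervalIntegral.integral_congr fun t ht => ?_
    rw [uIcc_of_le hab] at ht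
    simp only [one_mul]
    rw [Real.sinc_of_ne_zero (hne t ht), div_eq_mul_inv]
  rw [e]
  simpa [div_eq_mul_inv] using h

theorem exists_tendsto_sineInt : ∃ L, Tendsto sineInt atTop (𝓝 L) := by
  refine cauchySeq_tendsto_of_complete (Metric.cauchySeq_iff'.2 fun ε hε => ?_)
  have hN : 0 < 4 / ε := by positivity
  refine ⟨4 / ε, fun n hn => ?_⟩
  rw [Real.dist_eq]
  refine (abs_sineInt_sub_le hN hn).trans_lt ?_
  field_simp
  norm_num

/-- The limit of the sine integral at infinity. -/
noncomputable def sineIntLim : ℝ := exists_tendsto_sineInt.choose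

theorem abs_sineIntLim_sub_le {v : ℝ} (hv : 0 < v) : |sineInt v - sineIntLim| ≤ 2 / v := by
  have h := (exists_tendsto_sineInt.choose_spec.sub_const (sineInt v)).abs
  rw [abs_sub_comm]
  refine le_of_tendsto h ?_
  filter_upwards [eventually_ge_atTop v] with w hw using abs_sineInt_sub_le hv hw

/-- At `v = 1` the integral is at most `1` and the tail at most `2`. The exact value `π/2` plays no
role. -/
theorem abs_sineIntLim_le : |sineIntLim| ≤ 3 := by
  have h1 := abs_sineIntLim_sub_le one_pos
  have h2 := abs_sineInt_le 1
  rw [abs_le] at *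
  norm_num at *
  constructor <;> linarith

theorem abs_sineInt_le_five {v : ℝ} (hv : 0 ≤ v) : |sineInt v| ≤ 5 := by
  rcases le_or_gt v 1 with h | h
  · have := abs_sineInt_le v
    rw [abs_of_nonneg hv] at this
    linarith
  · have h1 := abs_sineIntLim_sub_le (one_pos.trans h)
    have h2 := abs_sineIntLim_le
    have h3 : 2 / v ≤ 2 := by rw [div_le_iff₀ (by linarith)]; linarith
    rw [abs_le] at *
    constructor <;> linarith

theorem integral_sin_div {u δ x : ℝ} (hu : 0 < u) (hδ : 0 < δ) (hx : δ ≤ x) :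
    ∫ s in δ..x, Real.sin (u * s) / s = sineInt (u * x) - sineInt (u * δ) := by
  rw [sineInt_sub, ← intervalIntegral.mul_integral_comp_mul_left,
    ← intervalIntegral.integral_const_mul]
  refine intervalIntegral.integral_congr fun s hs => ?_
  rw [uIcc_of_le hx] at hs
  have : s ≠ 0 := (hδ.trans_le hs.1).ne'
  rw [Real.sinc_of_ne_zero (by positivity)]
  field_simp

/-- The part of `1 / (t² - 1)` that remains when the singular part `1 / (2 (t - 1))` is removed
on `(0, 2]`. -/
noncomputable def remKer (t : ℝ) : ℝ := if t ≤ 2 then -(1 / (2 * (t + 1))) else 1 / (t ^ 2 - 1)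

theorem measurable_remKer : Measurable remKer :=
  Measurable.ite measurableSet_Iic (by fun_prop) (by fun_prop)

theorem abs_remKer_le {t : ℝ} (ht : 0 < t) : |remKer t| ≤ 5 / 2 * (1 + t ^ 2)⁻¹ := by
  rw [remKer, ← div_eq_mul_inv]
  split_ifs with h
  · rw [abs_neg, abs_of_pos (by positivity), div_le_div_iff₀ (by positivity) (by positivity)]
    nlinarith
  · have : 0 < t ^ 2 - 1 := by nlinarith
    rw [abs_of_pos (by positivity), div_le_div_iff₀ (by positivity) (by positivity)]
    nlinarith

theorem integrableOn_remKer : IntegrableOn remKer (Ioi 0) := by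
  refine Integrable.mono' ((integrable_inv_one_add_sq.const_mul (5 / 2)).integrableOn)
    measurable_remKer.aestronglyMeasurable ?_
  filter_upwards [ae_restrict_mem measurableSet_Ioi] with t ht using abs_remKer_le ht

/-- The remainder decays like `t⁻²`, so a full factor `t` would diverge logarithmically. The half
power is affordable and, with `|sin y| ≤ √y`, makes `remSine v` of order `√v` at the origin. -/
theorem integrableOn_sqrt_mul_remKer : IntegrableOn (fun t => √t * |remKer t|) (Ioi 0) := by
  have h := (integrable_one_add_norm (E := ℝ) (μ := volume) (r := 3 / 2) (by simp; norm_num)).const_mul 5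
  refine Integrable.mono' h.integrableOn
    ((Real.continuous_sqrt.measurable.mul measurable_remKer.abs).aestronglyMeasurable) ?_
  filter_upwards [ae_restrict_mem measurableSet_Ioi] with t ht
  have ht' : (0 : ℝ) < t := ht
  have e : (1 + ‖t‖) ^ (-(3 / 2 : ℝ)) = √(1 + t) * ((1 + t) ^ 2)⁻¹ := by
    rw [Real.norm_eq_abs, abs_of_pos ht', Real.sqrt_eq_rpow, ← Real.rpow_natCast,
      ← Real.rpow_neg (by positivity), ← Real.rpow_add (by positivity)]
    norm_num
  rw [e, norm_mul, Real.norm_of_nonneg (Real.sqrt_nonneg t), Real.norm_eq_abs, abs_abs,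
    mul_left_comm]
  have h1 : |remKer t| ≤ 5 * ((1 + t) ^ 2)⁻¹ := by
    refine (abs_remKer_le ht').trans ?_
    rw [← div_eq_mul_inv, ← div_eq_mul_inv, div_le_div_iff₀ (by positivity) (by positivity)]
    nlinarith [sq_nonneg (t - 1)]
  have h2 : √t ≤ √(1 + t) := Real.sqrt_le_sqrt (by linarith)
  gcongr

/-- The sine transform of the remainder kernel. -/
noncomputable def remSine (v : ℝ) : ℝ := ∫ t in Ioi (0 : ℝ), Real.sin (v * t) * remKer t

theorem measurable_remSine : Measurable remSine := by
  have h : StronglyMeasurable (Function.uncurry fun v t : ℝ => Real.sin (v * t) * remKer t) := by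
    refine Measurable.stronglyMeasurable ?_
    simp only [Function.uncurry_def]
    have := measurable_remKer.comp (measurable_snd : Measurable (Prod.snd : ℝ × ℝ → ℝ))
    exact Measurable.mul (by fun_prop) this
  exact (h.integral_prod_right (ν := volume.restrict (Ioi 0))).measurable

theorem integrableOn_sin_mul_remKer (v : ℝ) :
    IntegrableOn (fun t => Real.sin (v * t) * remKer t) (Ioi 0) :=
  Integrable.bdd_mul (c := 1) integrableOn_remKer (by fun_prop)
    (ae_of_all _ fun t => Real.abs_sin_le_one _)

theorem abs_sin_le_sqrt {y : ℝ} (hy : 0 ≤ y) : |Real.sin y| ≤ √y := by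
  rcases le_or_gt y 1 with h | h
  · refine (Real.abs_sin_le_abs).trans ?_
    rw [abs_of_nonneg hy]
    exact Real.le_sqrt_of_sq_le (by nlinarith)
  · exact (Real.abs_sin_le_one y).trans (Real.one_le_sqrt.2 h.le)

theorem abs_remSine_le_sqrt {v : ℝ} (hv : 0 ≤ v) :
    |remSine v| ≤ √v * ∫ t in Ioi (0 : ℝ), √t * |remKer t| := by
  rw [remSine, ← integral_const_mul, ← Real.norm_eq_abs]
  refine norm_integral_le_of_norm_le (integrableOn_sqrt_mul_remKer.const_mul _) ?_
  filter_upwards [ae_restrict_mem measurableSet_Ioi] with t ht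
  have ht' : (0 : ℝ) < t := ht
  rw [norm_mul, Real.norm_eq_abs, Real.norm_eq_abs, ← mul_assoc, ← Real.sqrt_mul hv]
  gcongr
  exact abs_sin_le_sqrt (by positivity)

/-- On each side of the jump at `t = 2` the remainder is monotone of constant sign, so integration
by parts applies; `|remKer|` is `1/2` at `t = 0` and tends to `1/3` as `t → 2+`, so each piece costs
at most `1/v`. -/
theorem abs_remSine_le_div {v : ℝ} (hv : 0 < v) : |remSine v| ≤ 2 / v := by
  have hi := integrableOn_sin_mul_remKer v
  have hd : Disjoint (Ioc (0 : ℝ) 2) (Ioi 2) := by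
    rw [Set.disjoint_left]
    exact fun t ht ht2 => not_lt.2 ht.2 ht2
  have hU : Ioc (0 : ℝ) 2 ∪ Ioi 2 = Ioi 0 := Ioc_union_Ioi_eq_Ioi (by norm_num)
  have h1 : |∫ t in Ioc (0 : ℝ) 2, Real.sin (v * t) * remKer t| ≤ 1 / v := by
    have h := abs_integral_sin_mul_le (f := fun t => 1 / 2 * (t + 1)⁻¹)
      (f' := fun t => 1 / 2 * (-1 / (t + 1) ^ 2)) (a := 0) (b := 2) (by norm_num) hv
      (fun t ht => (((hasDerivAt_id t).add_const 1).inv (by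
        have := ht.1
        simp
        positivity)).const_mul _)
      (ContinuousOn.mul continuousOn_const (ContinuousOn.div continuousOn_const (by fun_prop)
        fun t ht => by have := ht.1; positivity))
      (fun t ht => by
        have := ht.1
        have : 0 < (t + 1) ^ 2 := by positivity
        rw [neg_div]
        have : 0 ≤ 1 / (t + 1) ^ 2 := by positivity
        linarith)
      (fun t ht => by have := ht.1; positivity)
    rw [← intervalIntegral.integral_of_le (by norm_num)]
    have e : ∫ t in (0 : ℝ)..2, Real.sin (v * t) * remKer t =
        -∫ t in (0 : ℝ)..2, Real.sin (v * t) * (1 / 2 * (t + 1)⁻¹) := by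
      rw [← intervalIntegral.integral_neg]
      refine intervalIntegral.integral_congr fun t ht => ?_
      rw [uIcc_of_le (by norm_num)] at ht
      have := ht.1
      simp only [remKer, if_pos ht.2]
      field_simp
    rw [e, abs_neg]
    refine h.trans (le_of_eq ?_)
    norm_num
  have h2 : |∫ t in Ioi (2 : ℝ), Real.sin (v * t) * remKer t| ≤ 1 / v := by
    have hlim := intervalIntegral_tendsto_integral_Ioi 2
      (hi.mono_set (Ioi_subset_Ioi (by norm_num))) tendsto_id
    refine le_of_tendsto hlim.abs ?_
    filter_upwards [eventually_ge_atTop 2] with b hb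
    have hpos : ∀ t ∈ Icc (2 : ℝ) b, 0 < t ^ 2 - 1 := fun t ht => by nlinarith [ht.1]
    have h := abs_integral_sin_mul_le (f := fun t => (t ^ 2 - 1)⁻¹)
      (f' := fun t => -(2 * t) / (t ^ 2 - 1) ^ 2) hb hv
      (fun t ht => by
        have := ((hasDerivAt_pow 2 t).sub_const 1).fun_inv (hpos t ht).ne'
        simpa using this)
      (ContinuousOn.div (by fun_prop) (by fun_prop) fun t ht => by
        have := hpos t ht; positivity)
      (fun t ht => by
        have := ht.1
        exact div_nonpos_of_nonpos_of_nonneg (by linarith) (by positivity))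
      (fun t ht => by have := hpos t ht; positivity)
    have e : ∫ t in (2 : ℝ)..id b, Real.sin (v * t) * remKer t =
        ∫ t in (2 : ℝ)..b, Real.sin (v * t) * (t ^ 2 - 1)⁻¹ := by
      refine intervalIntegral.integral_congr_ae (ae_of_all _ fun t ht => ?_)
      rw [uIoc_of_le (by exact hb)] at ht
      rw [remKer, if_neg (not_le.2 ht.1), one_div]
    rw [e]
    refine h.trans ?_
    gcongr
    norm_num
  rw [remSine, ← hU, setIntegral_union hd measurableSet_Ioi (hi.mono_set (hU ▸ subset_union_left))
    (hi.mono_set (hU ▸ subset_union_right))]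
  refine (abs_add_le _ _).trans ((add_le_add h1 h2).trans (le_of_eq ?_))
  ring

/-- The kernel of the composition of the odd Hilbert transform and the sine quotient. -/
noncomputable def compKer (v : ℝ) : ℝ := Real.cos v * sineInt v + remSine v

theorem measurable_compKer : Measurable compKer :=
  (Real.measurable_cos.mul continuous_sineInt.measurable).add measurable_remSine

/-- The part of the kernel that is integrable with respect to `dv / v`. -/
noncomputable def smallKer (v : ℝ) : ℝ :=
  compKer v - sineIntLim * (Real.cos v - Real.exp (-v))

theorem measurable_smallKer : Measurable smallKer :=
  measurable_compKer.sub (Measurable.const_mul (by fun_prop) _)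

theorem abs_cos_sub_exp_le {v : ℝ} (h0 : 0 ≤ v) (h1 : v ≤ 1) :
    |Real.cos v - Real.exp (-v)| ≤ v := by
  have a := Real.one_sub_sq_div_two_le_cos (x := v)
  have b := Real.cos_le_one v
  have c := Real.add_one_le_exp (-v)
  have d : Real.exp (-v) ≤ 1 := Real.exp_le_one_iff.2 (by linarith)
  rw [abs_le]
  constructor <;> nlinarith

/-- Near zero all terms are `O(√v)`, which is why `e^{-v}` accompanies `cos v`. At infinity `cos v
(Si(v) - L)`, `remSine v` and `e^{-v}` are each `O(1/v)`, and `√v/(1 + v)` dominates both regimes.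
-/
theorem exists_abs_smallKer_le :
    ∃ C : ℝ, 0 ≤ C ∧ ∀ v, 0 < v → |smallKer v| ≤ C * (√v / (1 + v)) := by
  set D := ∫ t in Ioi (0 : ℝ), √t * |remKer t|
  have hD : 0 ≤ D := integral_nonneg fun t => by positivity
  -- For `v > 1` the three terms give `2 + 2 + 3 = 7`; for `v ≤ 1` they give `D + 4`. The factor `2`
  -- absorbs `1 + v ≤ 2 max(1, v)`.
  refine ⟨2 * (D + 7), by positivity, fun v hv => ?_⟩
  have hL := abs_sineIntLim_le
  rcases le_or_gt v 1 with h | h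
  · have hs : v ≤ √v := Real.le_sqrt_of_sq_le (by nlinarith)
    have h1 : |Real.cos v * sineInt v| ≤ v := by
      rw [abs_mul]
      have := abs_sineInt_le v
      rw [abs_of_pos hv] at this
      nlinarith [Real.abs_cos_le_one v, abs_nonneg (Real.cos v), abs_nonneg (sineInt v)]
    have h2 := abs_remSine_le_sqrt hv.le
    have h3 : |sineIntLim * (Real.cos v - Real.exp (-v))| ≤ 3 * v := by
      rw [abs_mul]
      exact mul_le_mul hL (abs_cos_sub_exp_le hv.le h) (abs_nonneg _) (by norm_num)
    have h4 : |smallKer v| ≤ (D + 7) * √v := by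
      refine (abs_sub _ _).trans ?_
      refine (add_le_add ((abs_add_le _ _).trans (add_le_add h1 h2)) h3).trans ?_
      nlinarith
    refine h4.trans ?_
    rw [mul_div_assoc', le_div_iff₀ (by positivity)]
    have : 0 ≤ (D + 7) * √v := by positivity
    nlinarith
  · have e : smallKer v = Real.cos v * (sineInt v - sineIntLim) + remSine v +
        sineIntLim * Real.exp (-v) := by rw [smallKer, compKer]; ring
    have h1 : |Real.cos v * (sineInt v - sineIntLim)| ≤ 2 / v := by
      rw [abs_mul]
      have := abs_sineIntLim_sub_le hv
      nlinarith [Real.abs_cos_le_one v, abs_nonneg (Real.cos v), abs_nonneg (sineInt v - sineIntLim)]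
    have h2 := abs_remSine_le_div hv
    have h3 : |sineIntLim * Real.exp (-v)| ≤ 3 * (1 / v) := by
      rw [abs_mul, abs_of_pos (Real.exp_pos _)]
      refine mul_le_mul hL ?_ (Real.exp_pos _).le (by norm_num)
      rw [Real.exp_neg, ← one_div]
      gcongr
      linarith [Real.add_one_le_exp v]
    have h4 : |smallKer v| ≤ 7 / v := by
      rw [e]
      refine (abs_add_le _ _).trans ?_
      refine (add_le_add ((abs_add_le _ _).trans (add_le_add h1 h2)) h3).trans (le_of_eq ?_)
      ring
    refine h4.trans ?_
    rw [mul_div_assoc', div_le_div_iff₀ hv (by positivity)]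
    have hs : 1 ≤ √v := Real.one_le_sqrt.2 h.le
    have h5 : 0 ≤ D * √v * v := by positivity
    have h6 : v ≤ √v * v := by nlinarith
    nlinarith

/-- The scale invariant integral dominating the small part of the kernel. -/
theorem integral_sqrt_div {u : ℝ} (hu : 0 < u) :
    IntegrableOn (fun x => √(x * u) / (1 + x * u) / x) (Ioi 0) ∧
      ∫ x in Ioi (0 : ℝ), √(x * u) / (1 + x * u) / x = Real.pi := by
  have hc : ContinuousWithinAt (fun x => 2 * Real.arctan √(x * u)) (Ici 0) 0 :=
    Continuous.continuousWithinAt (by fun_prop)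
  have hd : ∀ x ∈ Ioi (0 : ℝ), HasDerivAt (fun x => 2 * Real.arctan √(x * u))
      (√(x * u) / (1 + x * u) / x) x := by
    intro x hx
    have hx' : (0 : ℝ) < x := hx
    have hxu : 0 < x * u := by positivity
    have h := ((((hasDerivAt_id x).mul_const u).sqrt hxu.ne').arctan).const_mul 2
    have hs : √(x * u) ^ 2 = x * u := Real.sq_sqrt hxu.le
    have hs0 : √(x * u) ≠ 0 := (Real.sqrt_pos.2 hxu).ne'
    have e : √(x * u) / (1 + x * u) / x =
        2 * (1 / (1 + √(id x * u) ^ 2) * (1 * u / (2 * √(id x * u)))) := by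
      simp only [id_eq, hs]
      field_simp
      linear_combination hs
    rw [e]
    exact h
  have hn : ∀ x ∈ Ioi (0 : ℝ), 0 ≤ √(x * u) / (1 + x * u) / x := fun x hx => by
    have hx' : (0 : ℝ) < x := hx
    positivity
  have hl : Tendsto (fun x => 2 * Real.arctan √(x * u)) atTop (𝓝 (2 * (Real.pi / 2))) := by
    refine Tendsto.const_mul 2 ((tendsto_nhds_of_tendsto_nhdsWithin Real.tendsto_arctan_atTop).comp
      (Real.tendsto_sqrt_atTop.comp (tendsto_id.atTop_mul_const hu)))
  refine ⟨integrableOn_Ioi_deriv_of_nonneg hc hd hn hl, ?_⟩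
  rw [integral_Ioi_of_hasDerivAt_of_nonneg hc hd hn hl, zero_mul, Real.sqrt_zero,
    Real.arctan_zero]
  ring

/-! ### The odd Hilbert transform of the sine quotient -/

section Compose

variable {g : ℝ → ℂ}

theorem continuous_sineTransform (hg : IntegrableOn g (Ioi 0)) : Continuous (sineTransform g) := by
  refine continuous_of_dominated (bound := fun t => ‖g t‖)
    (fun x => hg.aestronglyMeasurable.mul (by fun_prop)) (fun x => ae_of_all _ fun t => ?_) hg.norm
    (ae_of_all _ fun t => by fun_prop)
  rw [norm_mul, Complex.norm_real]
  exact mul_le_of_le_one_right (norm_nonneg _) (Real.abs_sin_le_one _)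

theorem integrableOn_mul_real (hg : IntegrableOn g (Ioi 0)) {f : ℝ → ℝ} (hf : Measurable f)
    {C : ℝ} (hC : ∀ u, 0 < u → |f u| ≤ C) : IntegrableOn (fun u => g u * ((f u : ℝ) : ℂ)) (Ioi 0) := by
  refine Integrable.mul_bdd (c := C) hg
    (Complex.measurable_ofReal.comp hf).aestronglyMeasurable ?_
  filter_upwards [ae_restrict_mem measurableSet_Ioi] with u hu
  rw [Complex.norm_real]
  exact hC u hu

theorem sineTransform_add_sub (hg : IntegrableOn g (Ioi 0)) (x s : ℝ) :
    sineTransform g (x + s) - sineTransform g (x - s) =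
      ∫ u in Ioi (0 : ℝ), g u * ((2 * Real.cos (x * u) * Real.sin (s * u) : ℝ) : ℂ) := by
  have h : ∀ y : ℝ, IntegrableOn (fun u => g u * ((Real.sin (y * u) : ℝ) : ℂ)) (Ioi 0) := fun y =>
    integrableOn_mul_real hg (by fun_prop) fun u _ => Real.abs_sin_le_one _
  rw [sineTransform, sineTransform, ← integral_sub (h _) (h _)]
  refine integral_congr_ae (ae_of_all _ fun u => ?_)
  simp only
  rw [← mul_sub, ← Complex.ofReal_sub, add_mul, sub_mul, Real.sin_add, Real.sin_sub]
  congr 2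
  ring

/-- The symmetric difference of the sine transform carries `2 cos(xu) sin(su)`, and after Fubini the
integral of `sin(us)/s` is an increment of the sine integral. The cutoff `δ` makes Fubini
legitimate. -/
theorem integral_near_eq (hg : IntegrableOn g (Ioi 0)) {x δ : ℝ} (hx : 0 < x) (hδ : 0 < δ)
    (hδx : δ < x) :
    ∫ s in δ..x, (sineTransform g (x + s) - sineTransform g (x - s)) * ((1 / (2 * x * s) : ℝ) : ℂ) =
      ∫ u in Ioi (0 : ℝ), g u *
        ((Real.cos (x * u) * (sineInt (u * x) - sineInt (u * δ)) / x : ℝ) : ℂ) := by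
  set K : ℝ → ℝ → ℂ := fun s u =>
    g u * ((Real.cos (x * u) * Real.sin (s * u) * (1 / (x * s)) : ℝ) : ℂ) with hK
  have e1 : ∀ s ∈ Ioc δ x, (sineTransform g (x + s) - sineTransform g (x - s)) *
      ((1 / (2 * x * s) : ℝ) : ℂ) = ∫ u in Ioi (0 : ℝ), K s u := by
    intro s hs
    have hs0 : 0 < s := hδ.trans hs.1
    rw [sineTransform_add_sub hg, ← integral_mul_const]
    refine integral_congr_ae (ae_of_all _ fun u => ?_)
    simp only [hK]
    rw [mul_assoc, ← Complex.ofReal_mul]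
    congr 2
    field_simp
  have hi : Integrable (Function.uncurry K)
      ((volume.restrict (Ioc δ x)).prod (volume.restrict (Ioi 0))) := by
    have h1 := Integrable.comp_snd hg (volume.restrict (Ioc δ x))
    refine Integrable.mul_bdd (c := 1 / (x * δ)) h1
      (Measurable.aestronglyMeasurable (by fun_prop)) ?_
    rw [Measure.prod_restrict]
    filter_upwards [ae_restrict_mem (measurableSet_Ioc.prod measurableSet_Ioi)] with z hz
    have hz1 : δ < z.1 := hz.1.1
    have hz0 : 0 < z.1 := hδ.trans hz1
    rw [Complex.norm_real, Real.norm_eq_abs, abs_mul, abs_mul, abs_of_pos (a := 1 / (x * z.1))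
      (by positivity)]
    calc _ ≤ 1 * 1 * (1 / (x * δ)) := by
          gcongr
          · exact Real.abs_cos_le_one _
          · exact Real.abs_sin_le_one _
      _ = _ := by ring
  rw [intervalIntegral.integral_of_le hδx.le, setIntegral_congr_fun measurableSet_Ioc e1,
    integral_integral_swap hi]
  refine setIntegral_congr_fun measurableSet_Ioi fun u hu => ?_
  simp only [hK]
  rw [integral_const_mul, ← intervalIntegral.integral_of_le hδx.le, intervalIntegral.integral_ofReal,
    ← integral_sin_div hu hδ hδx.le]
  congr 2
  rw [mul_div_right_comm, ← intervalIntegral.integral_const_mul]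
  refine intervalIntegral.integral_congr fun s hs => ?_
  rw [mul_comm s u]
  ring

theorem tendsto_integral_near (hg : IntegrableOn g (Ioi 0)) {x : ℝ} (hx : 0 < x) :
    Tendsto (fun δ : ℝ => ∫ u in Ioi (0 : ℝ), g u *
        ((Real.cos (x * u) * (sineInt (u * x) - sineInt (u * δ)) / x : ℝ) : ℂ)) (𝓝[>] 0)
      (𝓝 (∫ u in Ioi (0 : ℝ), g u * ((Real.cos (x * u) * sineInt (x * u) / x : ℝ) : ℂ))) := by
  have hc := continuous_sineInt
  refine tendsto_integral_filter_of_dominated_convergence (fun u => ‖g u‖ * (10 / x))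
    (Eventually.of_forall fun δ => hg.aestronglyMeasurable.mul
      (Continuous.aestronglyMeasurable (by fun_prop))) ?_ (hg.norm.mul_const _)
    (ae_of_all _ fun u => ?_)
  · filter_upwards [self_mem_nhdsWithin] with δ hδ
    filter_upwards [ae_restrict_mem measurableSet_Ioi] with u hu
    have hu' : (0 : ℝ) < u := hu
    have hδ' : (0 : ℝ) < δ := hδ
    rw [norm_mul, Complex.norm_real, Real.norm_eq_abs, abs_div, abs_mul, abs_of_pos hx]
    gcongr
    have h1 := abs_sineInt_le_five (v := u * x) (by positivity)
    have h2 := abs_sineInt_le_five (v := u * δ) (by positivity)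
    calc _ ≤ (1 : ℝ) * 10 := by
          gcongr
          · exact Real.abs_cos_le_one _
          · exact (abs_sub _ _).trans (by linarith)
      _ = 10 := one_mul _
  · have h : Continuous fun δ : ℝ => g u *
        ((Real.cos (x * u) * (sineInt (u * x) - sineInt (u * δ)) / x : ℝ) : ℂ) := by fun_prop
    have h0 : sineInt 0 = 0 := by simp [sineInt]
    have := h.tendsto 0
    simp only [mul_zero, h0, sub_zero, mul_comm u x] at this
    simp only [mul_comm u x]
    exact tendsto_nhdsWithin_of_tendsto_nhds this

theorem integrableOn_scaled_remKer {x : ℝ} (hx : 0 < x) :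
    IntegrableOn (fun t => remKer (t / x) / x ^ 2) (Ioi 0) := by
  simp_rw [div_eq_mul_inv _ x]
  refine Integrable.div_const ?_ _
  rw [← IntegrableOn, integrableOn_Ioi_comp_mul_right_iff _ _ (inv_pos.2 hx), zero_mul]
  exact integrableOn_remKer

theorem integral_sin_mul_scaled_remKer {x : ℝ} (hx : 0 < x) (u : ℝ) :
    ∫ t in Ioi (0 : ℝ), Real.sin (t * u) * (remKer (t / x) / x ^ 2) = remSine (x * u) / x := by
  have h := integral_comp_mul_left_Ioi
    (fun t => Real.sin (t * u) * (remKer (t / x) / x ^ 2)) 0 hx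
  rw [mul_zero, smul_eq_mul] at h
  have e : ∀ s : ℝ, Real.sin (x * s * u) * (remKer (x * s / x) / x ^ 2) =
      Real.sin (x * u * s) * remKer s * (1 / x ^ 2) := fun s => by
    rw [mul_div_cancel_left₀ _ hx.ne', mul_right_comm x s u]
    ring
  simp_rw [e] at h
  rw [integral_mul_const, ← remSine] at h
  generalize ∫ t in Ioi (0 : ℝ), Real.sin (t * u) * (remKer (t / x) / x ^ 2) = J at h ⊢
  have e2 : J = x * (x⁻¹ * J) := by field_simp
  rw [e2, ← h]
  field_simp

theorem integral_far_eq (hg : IntegrableOn g (Ioi 0)) {x : ℝ} (hx : 0 < x) :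
    IntegrableOn (fun t => sineTransform g t * ((remKer (t / x) / x ^ 2 : ℝ) : ℂ)) (Ioi 0) ∧
    ∫ t in Ioi (0 : ℝ), sineTransform g t * ((remKer (t / x) / x ^ 2 : ℝ) : ℂ) =
      ∫ u in Ioi (0 : ℝ), g u * ((remSine (x * u) / x : ℝ) : ℂ) := by
  have hr : IntegrableOn (fun t => ((remKer (t / x) / x ^ 2 : ℝ) : ℂ)) (Ioi 0) :=
    (integrableOn_scaled_remKer hx).ofReal
  have hi : Integrable (Function.uncurry fun t u : ℝ => ((remKer (t / x) / x ^ 2 : ℝ) : ℂ) * g u *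
      ((Real.sin (t * u) : ℝ) : ℂ)) ((volume.restrict (Ioi 0)).prod (volume.restrict (Ioi 0))) :=
    Integrable.mul_bdd (c := 1) (hr.mul_prod hg) (Measurable.aestronglyMeasurable (by fun_prop))
      (ae_of_all _ fun z => by
        rw [Complex.norm_real]
        exact Real.abs_sin_le_one _)
  have e : ∀ t : ℝ, sineTransform g t * ((remKer (t / x) / x ^ 2 : ℝ) : ℂ) =
      ∫ u in Ioi (0 : ℝ), ((remKer (t / x) / x ^ 2 : ℝ) : ℂ) * g u *
        ((Real.sin (t * u) : ℝ) : ℂ) := fun t => by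
    simp_rw [mul_assoc]
    rw [integral_const_mul, mul_comm, sineTransform]
  simp_rw [e]
  refine ⟨hi.integral_prod_left, ?_⟩
  rw [integral_integral_swap hi]
  refine integral_congr_ae (ae_of_all _ fun u => ?_)
  simp only
  rw [← integral_sin_mul_scaled_remKer hx, ← integral_complex_ofReal, ← integral_const_mul]
  refine integral_congr_ae (ae_of_all _ fun t => ?_)
  push_cast
  ring

theorem trunc_inter_Iic {x δ : ℝ} (hδ : 0 < δ) (hδx : δ < x) :
    {t : ℝ | 0 < t ∧ δ < |t - x|} ∩ Iic (2 * x) = Ioo 0 (x - δ) ∪ Ioc (x + δ) (2 * x) := by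
  ext t
  simp only [mem_inter_iff, mem_ofPred_eq, mem_Iic, mem_union, mem_Ioo, mem_Ioc, lt_abs]
  constructor
  · rintro ⟨⟨h1, h2 | h2⟩, h3⟩
    · exact Or.inr ⟨by linarith, h3⟩
    · exact Or.inl ⟨h1, by linarith⟩
  · rintro (⟨h1, h2⟩ | ⟨h1, h2⟩)
    · exact ⟨⟨h1, Or.inr (by linarith)⟩, by linarith⟩
    · exact ⟨⟨by linarith, Or.inl (by linarith)⟩, h2⟩

/-- The range `(0, 2x]` is symmetric about the singularity, so the substitutions `t = x ± s` pair
the two sides. This is the reason for the cut at `2` in `remKer`. -/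
theorem setIntegral_singular_eq {F : ℝ → ℂ} (hF : Continuous F) {x δ : ℝ} (hδ : 0 < δ)
    (hδx : δ < x) :
    IntegrableOn ((Iic (2 * x)).indicator fun t => F t * ((1 / (2 * x * (t - x)) : ℝ) : ℂ))
      {t : ℝ | 0 < t ∧ δ < |t - x|} ∧
    ∫ t in {t : ℝ | 0 < t ∧ δ < |t - x|},
      (Iic (2 * x)).indicator (fun t => F t * ((1 / (2 * x * (t - x)) : ℝ) : ℂ)) t =
      ∫ s in δ..x, (F (x + s) - F (x - s)) * ((1 / (2 * x * s) : ℝ) : ℂ) := by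
  have hx : 0 < x := hδ.trans hδx
  set f : ℝ → ℂ := fun t => F t * ((1 / (2 * x * (t - x)) : ℝ) : ℂ) with hf
  have hcont : ∀ {s : Set ℝ}, (∀ t ∈ s, t ≠ x) → ContinuousOn f s := fun {s} hs => by
    refine hF.continuousOn.mul (Complex.continuous_ofReal.comp_continuousOn
      (continuousOn_const.div (by fun_prop) fun t ht => ?_))
    have := sub_ne_zero.2 (hs t ht)
    positivity
  have i1 : IntervalIntegrable f volume 0 (x - δ) :=
    ContinuousOn.intervalIntegrable (hcont fun t ht => by
      rw [uIcc_of_le (by linarith)] at ht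
      have := ht.2
      intro h
      linarith)
  have i2 : IntervalIntegrable f volume (x + δ) (2 * x) :=
    ContinuousOn.intervalIntegrable (hcont fun t ht => by
      rw [uIcc_of_le (by linarith)] at ht
      have := ht.1
      intro h
      linarith)
  have j1 : IntegrableOn f (Ioo 0 (x - δ)) :=
    ((intervalIntegrable_iff_integrableOn_Ioo_of_le (by linarith)).1 i1)
  have j2 : IntegrableOn f (Ioc (x + δ) (2 * x)) :=
    ((intervalIntegrable_iff_integrableOn_Ioc_of_le (by linarith)).1 i2)
  constructor
  · rw [IntegrableOn, integrable_indicator_iff measurableSet_Iic, IntegrableOn,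
      Measure.restrict_restrict measurableSet_Iic, inter_comm, trunc_inter_Iic hδ hδx]
    exact j1.union j2
  · rw [setIntegral_indicator measurableSet_Iic, trunc_inter_Iic hδ hδx,
      setIntegral_union (Set.disjoint_left.2 fun t h1 h2 => by
        have := h1.2
        have := h2.1
        linarith) measurableSet_Ioc j1 j2, ← integral_Ioc_eq_integral_Ioo,
      ← intervalIntegral.integral_of_le (by linarith),
      ← intervalIntegral.integral_of_le (by linarith)]
    have c1 := intervalIntegral.integral_comp_sub_left f x (a := δ) (b := x)
    have c2 := intervalIntegral.integral_comp_add_left f x (a := δ) (b := x)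
    rw [sub_self] at c1
    rw [← two_mul] at c2
    have k1 : IntervalIntegrable (fun s => f (x - s)) volume δ x := by
      refine ContinuousOn.intervalIntegrable ((hcont (s := {x}ᶜ) fun t ht => ht).comp
        (by fun_prop) fun s hs => ?_)
      rw [uIcc_of_le hδx.le] at hs
      have := hs.1
      intro h
      rw [mem_singleton_iff] at h
      linarith
    have k2 : IntervalIntegrable (fun s => f (x + s)) volume δ x := by
      refine ContinuousOn.intervalIntegrable ((hcont (s := {x}ᶜ) fun t ht => ht).comp
        (by fun_prop) fun s hs => ?_)
      rw [uIcc_of_le hδx.le] at hs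
      have := hs.1
      intro h
      rw [mem_singleton_iff] at h
      linarith
    rw [← c1, ← c2, ← intervalIntegral.integral_add k1 k2]
    refine intervalIntegral.integral_congr fun s hs => ?_
    simp only [hf]
    rw [add_sub_cancel_left, sub_sub_cancel_left, mul_neg, div_neg]
    push_cast
    ring

/-- The factor `t` of the Hilbert kernel cancels the denominator of `sineQuot`. Then `1/(t² - x²)`
is the rescaled remainder `remKer(t/x)/x²` plus `1/(2x(t - x))` on `t ≤ 2x`. -/
theorem truncH_sineQuot_eq (hg : IntegrableOn g (Ioi 0)) {x δ : ℝ} (hδ : 0 < δ) (hδx : δ < x) :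
    truncH (sineQuot g) x δ = ((2 / Real.pi : ℝ) : ℂ) *
      ((∫ t in {t : ℝ | 0 < t ∧ δ < |t - x|},
          sineTransform g t * ((remKer (t / x) / x ^ 2 : ℝ) : ℂ)) +
        ∫ s in δ..x, (sineTransform g (x + s) - sineTransform g (x - s)) *
          ((1 / (2 * x * s) : ℝ) : ℂ)) := by
  have hx : 0 < x := hδ.trans hδx
  obtain ⟨h1, h2⟩ := setIntegral_singular_eq (continuous_sineTransform hg) hδ hδx
  have hms : MeasurableSet {t : ℝ | 0 < t ∧ δ < |t - x|} := by
    rw [trunc_eq_inter]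
    exact (measurableSet_trunc x δ).inter measurableSet_Ioi
  rw [← h2, ← integral_add ((integral_far_eq hg hx).1.mono_set fun t ht => ht.1) h1, truncH]
  congr 1
  refine setIntegral_congr_fun hms fun t ht => ?_
  have ht0 : (0 : ℝ) < t := ht.1
  have htx : t - x ≠ 0 := fun h => by
    have := ht.2
    rw [h, abs_zero] at this
    linarith
  have hF : ((t / (t ^ 2 - x ^ 2) : ℝ) : ℂ) * sineQuot g t =
      sineTransform g t * ((1 / (t ^ 2 - x ^ 2) : ℝ) : ℂ) := by
    have : (t : ℂ) ≠ 0 := by exact_mod_cast ht0.ne'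
    rw [sineQuot]
    push_cast
    rw [div_mul_div_comm, mul_comm ((t : ℂ) ^ 2 - x ^ 2), mul_div_mul_left _ _ this]
    ring
  have e : t ^ 2 - x ^ 2 = (t - x) * (t + x) := by ring
  have hp : t + x ≠ 0 := by positivity
  rw [hF, e, remKer]
  by_cases h : t ≤ 2 * x
  · rw [indicator_of_mem (by exact h), if_pos (by rwa [div_le_iff₀ hx]), ← mul_add,
      ← Complex.ofReal_add]
    congr 2
    field_simp
    ring
  · rw [indicator_of_notMem (by exact h), if_neg (by rwa [div_le_iff₀ hx]), add_zero]
    congr 2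
    have h3 : (t / x) ^ 2 - 1 = (t - x) * (t + x) / x ^ 2 := by
      field_simp
      ring
    rw [h3]
    field_simp

/-- Once `g` is outermost, the cutoff survives only in `sineInt (u δ)`, which tends to zero
boundedly, and in the truncated remainder integral. The principal value thus exists at every `x >
0`, whatever `𝓗₀ g` does. -/
theorem tendsto_truncH_sineQuot (hg : IntegrableOn g (Ioi 0)) {x : ℝ} (hx : 0 < x) :
    Tendsto (fun δ => truncH (sineQuot g) x δ) (𝓝[>] 0)
      (𝓝 (((2 / Real.pi : ℝ) : ℂ) *
        ∫ u in Ioi (0 : ℝ), g u * ((compKer (x * u) / x : ℝ) : ℂ))) := by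
  obtain ⟨hf1, hf2⟩ := integral_far_eq hg hx
  have h := ((tendsto_setIntegral_trunc (p := x) hf1).add
    (tendsto_integral_near hg hx)).const_mul ((2 / Real.pi : ℝ) : ℂ)
  have i1 : IntegrableOn (fun u => g u * ((remSine (x * u) / x : ℝ) : ℂ)) (Ioi 0) := by
    refine integrableOn_mul_real hg (C := (∫ t in Ioi (0 : ℝ), |remKer t|) / x)
      ((measurable_remSine.comp (measurable_const_mul x)).div_const x) fun u _ => ?_
    rw [abs_div, abs_of_pos hx]
    gcongr
    rw [remSine, ← Real.norm_eq_abs]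
    refine norm_integral_le_of_norm_le integrableOn_remKer.norm (ae_of_all _ fun t => ?_)
    rw [norm_mul]
    exact mul_le_of_le_one_left (norm_nonneg _) (Real.abs_sin_le_one _)
  have i2 : IntegrableOn (fun u => g u * ((Real.cos (x * u) * sineInt (x * u) / x : ℝ) : ℂ))
      (Ioi 0) := by
    have hc := continuous_sineInt
    refine integrableOn_mul_real hg (C := 5 / x)
      (Continuous.measurable (by fun_prop)) fun u hu => ?_
    rw [abs_div, abs_mul, abs_of_pos hx]
    gcongr
    calc _ ≤ (1 : ℝ) * 5 := by
          gcongr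
          · exact Real.abs_cos_le_one _
          · exact abs_sineInt_le_five (by positivity)
      _ = 5 := one_mul _
  rw [hf2, ← integral_add i1 i2] at h
  have e : (∫ u in Ioi (0 : ℝ), g u * ((compKer (x * u) / x : ℝ) : ℂ)) =
      ∫ u in Ioi (0 : ℝ), (g u * ((remSine (x * u) / x : ℝ) : ℂ) +
        g u * ((Real.cos (x * u) * sineInt (x * u) / x : ℝ) : ℂ)) := by
    refine integral_congr_ae (ae_of_all _ fun u => ?_)
    simp only [compKer]
    push_cast
    ring
  rw [e]
  refine h.congr' ?_
  filter_upwards [self_mem_nhdsWithin, Ioo_mem_nhdsGT hx] with δ hδ hδx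
  rw [truncH_sineQuot_eq hg hδ hδx.2, integral_near_eq hg hx hδ hδx.2]

theorem hilbertOddExists_sineQuot (hg : IntegrableOn g (Ioi 0)) : HilbertOddExists (sineQuot g) := by
  rw [HilbertOddExists]
  filter_upwards [ae_restrict_mem measurableSet_Ioi] with x hx
  exact ⟨_, tendsto_truncH_sineQuot hg hx⟩

theorem hilbertOdd_sineQuot (hg : IntegrableOn g (Ioi 0)) {x : ℝ} (hx : 0 < x) :
    hilbertOdd (sineQuot g) x = ((2 / Real.pi : ℝ) : ℂ) *
      ∫ u in Ioi (0 : ℝ), g u * ((compKer (x * u) / x : ℝ) : ℂ) :=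
  (tendsto_truncH_sineQuot hg hx).limUnder_eq

end Compose

/-! ### The norm inequality and the inclusions -/

section Final

variable {g h : ℝ → ℂ}

theorem aestronglyMeasurable_truncH (hg : AEStronglyMeasurable g (volume.restrict (Ioi 0))) (δ : ℝ) :
    AEStronglyMeasurable (fun x => truncH g x δ) (volume.restrict (Ioi 0)) := by
  have hS : MeasurableSet {z : ℝ × ℝ | δ < |z.2 - z.1|} :=
    measurableSet_lt measurable_const (by fun_prop)
  have h1 : AEStronglyMeasurable ({z : ℝ × ℝ | δ < |z.2 - z.1|}.indicator fun z : ℝ × ℝ =>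
      ((z.2 / (z.2 ^ 2 - z.1 ^ 2) : ℝ) : ℂ) * g z.2)
      ((volume.restrict (Ioi 0)).prod (volume.restrict (Ioi 0))) :=
    AEStronglyMeasurable.indicator
      ((Measurable.aestronglyMeasurable (by fun_prop)).mul hg.comp_snd) hS
  refine (h1.integral_prod_right'.const_mul ((2 / Real.pi : ℝ) : ℂ)).congr
    (ae_of_all _ fun x => ?_)
  simp only [truncH]
  rw [trunc_eq_inter, ← Measure.restrict_restrict (measurableSet_trunc x δ),
    ← integral_indicator (measurableSet_trunc x δ)]
  rfl

theorem ae_tendsto_hilbertOdd (h : HilbertOddExists g) :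
    ∀ᵐ x ∂volume.restrict (Ioi (0 : ℝ)),
      Tendsto (fun δ => truncH g x δ) (𝓝[>] 0) (𝓝 (hilbertOdd g x)) :=
  h.mono fun _ ⟨_, hc⟩ => tendsto_nhds_limUnder ⟨_, hc⟩

theorem aestronglyMeasurable_hilbertOdd (hg : AEStronglyMeasurable g (volume.restrict (Ioi 0)))
    (h : HilbertOddExists g) : AEStronglyMeasurable (hilbertOdd g) (volume.restrict (Ioi 0)) :=
  aestronglyMeasurable_of_tendsto_ae (𝓝[>] (0 : ℝ)) (aestronglyMeasurable_truncH hg)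
    (ae_tendsto_hilbertOdd h)

theorem aestronglyMeasurable_sineQuot (hg : IntegrableOn g (Ioi 0)) :
    AEStronglyMeasurable (sineQuot g) (volume.restrict (Ioi 0)) :=
  ((continuous_sineTransform hg).measurable.div
    Complex.measurable_ofReal).aestronglyMeasurable

theorem measurable_smallKer_mul_div :
    Measurable (Function.uncurry fun x u : ℝ => ((smallKer (x * u) / x : ℝ) : ℂ)) := by
  have := measurable_smallKer.comp (measurable_fst.mul measurable_snd :
    Measurable fun z : ℝ × ℝ => z.1 * z.2)
  exact Complex.measurable_ofReal.comp (this.div measurable_fst)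

theorem lintegral_smallKer_le {C : ℝ} (hC : 0 ≤ C)
    (hk : ∀ v, 0 < v → |smallKer v| ≤ C * (√v / (1 + v))) {u : ℝ} (hu : 0 < u) :
    ∫⁻ x in Ioi (0 : ℝ), ‖((smallKer (x * u) / x : ℝ) : ℂ)‖ₑ ≤ ENNReal.ofReal (C * Real.pi) := by
  obtain ⟨h1, h2⟩ := integral_sqrt_div hu
  have hn : 0 ≤ᵐ[volume.restrict (Ioi 0)] fun x => C * (√(x * u) / (1 + x * u) / x) := by
    filter_upwards [ae_restrict_mem measurableSet_Ioi] with x hx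
    have hx' : (0 : ℝ) < x := hx
    simp only [Pi.zero_apply]
    positivity
  rw [← h2, ← integral_const_mul, ofReal_integral_eq_lintegral_ofReal (h1.const_mul C) hn]
  refine lintegral_mono_ae ?_
  filter_upwards [ae_restrict_mem measurableSet_Ioi] with x hx
  have hx' : (0 : ℝ) < x := hx
  rw [← ofReal_norm, Complex.norm_real, Real.norm_eq_abs, abs_div, abs_of_pos hx', mul_div_assoc']
  refine ENNReal.ofReal_le_ofReal ?_
  gcongr
  exact hk _ (by positivity)

theorem integral_compKer_eq (hg : IntegrableOn g (Ioi 0)) {x : ℝ} (hx : 0 < x) :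
    ∫ u in Ioi (0 : ℝ), g u * ((compKer (x * u) / x : ℝ) : ℂ) =
      (∫ u in Ioi (0 : ℝ), g u * ((smallKer (x * u) / x : ℝ) : ℂ)) +
        sineIntLim * (cosExp g x / x) := by
  obtain ⟨C, hC, hk⟩ := exists_abs_smallKer_le
  have i1 : IntegrableOn (fun u => g u * ((smallKer (x * u) / x : ℝ) : ℂ)) (Ioi 0) := by
    refine integrableOn_mul_real hg (C := C / x)
      ((measurable_smallKer.comp (measurable_const_mul x)).div_const x) fun u hu => ?_
    rw [abs_div, abs_of_pos hx]
    gcongr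
    have hxu : 0 < x * u := by positivity
    refine (hk _ hxu).trans (mul_le_of_le_one_right hC ?_)
    rw [div_le_one (by positivity)]
    nlinarith [Real.sq_sqrt hxu.le, Real.sqrt_nonneg (x * u)]
  have i2 : IntegrableOn (fun u => g u * ((Real.cos (x * u) - Real.exp (-(x * u)) : ℝ) : ℂ))
      (Ioi 0) := by
    refine integrableOn_mul_real hg (C := 1 + 1) (by fun_prop) fun u hu => ?_
    refine (abs_sub _ _).trans (add_le_add (Real.abs_cos_le_one _) ?_)
    rw [abs_of_pos (Real.exp_pos _), Real.exp_le_one_iff]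
    have : 0 < x * u := by positivity
    linarith
  rw [cosExp, mul_div_assoc', ← integral_const_mul, ← integral_div,
    ← integral_add i1 ((i2.const_mul _).div_const _)]
  refine integral_congr_ae (ae_of_all _ fun u => ?_)
  simp only [smallKer]
  push_cast
  ring

/-- The composed transform is bounded by the norms of a function and its odd Hilbert transform. -/
theorem exists_lintegral_hilbertOdd_sineQuot_le :
    ∃ C : ℝ, 0 < C ∧ ∀ g h : ℝ → ℂ, IntegrableOn g (Ioi 0) → IntegrableOn h (Ioi 0) →
      (∀ᵐ p ∂volume.restrict (Ioi (0 : ℝ)),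
        Tendsto (fun δ => truncH g p δ) (𝓝[>] 0) (𝓝 (h p))) →
      ∫⁻ x in Ioi (0 : ℝ), ‖hilbertOdd (sineQuot g) x‖ₑ ≤
        ENNReal.ofReal C * ((∫⁻ x in Ioi (0 : ℝ), ‖g x‖ₑ) + ∫⁻ x in Ioi (0 : ℝ), ‖h x‖ₑ) := by
  obtain ⟨C, hC, hk⟩ := exists_abs_smallKer_le
  -- `C π` is the norm of the small kernel; `30 = 3 · 10` combines `|sineIntLim| ≤ 3` with the even
  -- Hardy inequality. The prefactor `2/π` is at most `1`.
  refine ⟨C * Real.pi + 30, by positivity, fun g h hg hh hlim => ?_⟩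
  have hcos := lintegral_cosExp_div_le hg hh hlim
  set G := ∫⁻ x in Ioi (0 : ℝ), ‖g x‖ₑ
  set H := ∫⁻ x in Ioi (0 : ℝ), ‖h x‖ₑ
  have hb : ∀ u : ℝ, 0 < u → ∫⁻ x in Ioi (0 : ℝ), ‖((smallKer (x * u) / x : ℝ) : ℂ)‖ₑ ≤
      ENNReal.ofReal (C * Real.pi) := fun u hu => lintegral_smallKer_le hC hk hu
  have hi := integrable_kernel hg measurable_smallKer_mul_div ENNReal.ofReal_ne_top hb
  have hle := lintegral_integral_kernel_le hg measurable_smallKer_mul_div hb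
  have hpt : ∀ x ∈ Ioi (0 : ℝ), ‖hilbertOdd (sineQuot g) x‖ₑ ≤
      ‖∫ u in Ioi (0 : ℝ), g u * ((smallKer (x * u) / x : ℝ) : ℂ)‖ₑ + 3 * ‖cosExp g x / x‖ₑ := by
    intro x hx
    rw [hilbertOdd_sineQuot hg hx, integral_compKer_eq hg hx, enorm_mul]
    have e1 : ‖((2 / Real.pi : ℝ) : ℂ)‖ₑ ≤ 1 := by
      rw [← ofReal_norm, Complex.norm_real, Real.norm_of_nonneg (by positivity),
        ENNReal.ofReal_le_one, div_le_one Real.pi_pos]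
      exact Real.two_le_pi
    have e2 : ‖(sineIntLim : ℂ)‖ₑ ≤ 3 := by
      rw [← ofReal_norm, Complex.norm_real, Real.norm_eq_abs]
      exact (ENNReal.ofReal_le_ofReal abs_sineIntLim_le).trans (by norm_num)
    refine (mul_le_of_le_one_left zero_le e1).trans ((enorm_add_le _ _).trans ?_)
    rw [enorm_mul]
    gcongr
  calc _ ≤ ∫⁻ x in Ioi (0 : ℝ), (‖∫ u in Ioi (0 : ℝ), g u * ((smallKer (x * u) / x : ℝ) : ℂ)‖ₑ +
        3 * ‖cosExp g x / x‖ₑ) := by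
        refine lintegral_mono_ae ?_
        filter_upwards [ae_restrict_mem measurableSet_Ioi] with x hx using hpt x hx
    _ = (∫⁻ x in Ioi (0 : ℝ), ‖∫ u in Ioi (0 : ℝ), g u * ((smallKer (x * u) / x : ℝ) : ℂ)‖ₑ) +
        3 * ∫⁻ x in Ioi (0 : ℝ), ‖cosExp g x / x‖ₑ := by
        have hm : AEMeasurable (fun x : ℝ =>
            ‖∫ u in Ioi (0 : ℝ), g u * ((smallKer (x * u) / x : ℝ) : ℂ)‖ₑ)
            (volume.restrict (Ioi 0)) := hi.integral_prod_left.aestronglyMeasurable.enorm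
        rw [lintegral_add_left' hm,
          lintegral_const_mul' _ _ (by norm_num)]
    _ ≤ ENNReal.ofReal (C * Real.pi) * G + 3 * (10 * (G + H)) := by gcongr
    _ ≤ ENNReal.ofReal (C * Real.pi) * (G + H) + 30 * (G + H) := by
        rw [← mul_assoc]
        gcongr
        · exact le_self_add
        · norm_num
    _ = _ := by
        rw [ENNReal.ofReal_add (by positivity) (by norm_num), add_mul]
        congr 2
        norm_num

theorem integrableOn_hilbertOdd (hg : AEStronglyMeasurable g (volume.restrict (Ioi 0)))
    (h : HilbertOddExists g) (hfin : ∫⁻ x in Ioi (0 : ℝ), ‖hilbertOdd g x‖ₑ < ∞) :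
    IntegrableOn (hilbertOdd g) (Ioi 0) :=
  ⟨aestronglyMeasurable_hilbertOdd hg h, hfin⟩

theorem exists_hilbertOddNorm_sineQuot_le :
    ∃ C : ℝ, 0 < C ∧ ∀ g : ℝ → ℂ, Integrable g →
      hilbertOddNorm (sineQuot g) ≤ ENNReal.ofReal C * hardyOddNorm g := by
  obtain ⟨C, hC, key⟩ := exists_lintegral_hilbertOdd_sineQuot_le
  refine ⟨C, hC, fun g hg => ?_⟩
  have hg0 : IntegrableOn g (Ioi 0) := hg.integrableOn
  -- A finite norm forces `𝓗₀ g` to exist almost everywhere and to be integrable, which is what the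
  -- estimate needs.
  rcases eq_or_ne (hardyOddNorm g) ∞ with htop | htop
  · rw [htop, ENNReal.mul_top (ENNReal.ofReal_pos.2 hC).ne']
    exact le_top
  have hex : HilbertOddExists g := by
    by_contra hn
    exact htop (by rw [hardyOddNorm, hilbertOddNorm, if_neg hn, add_top])
  have hfin : ∫⁻ x in Ioi (0 : ℝ), ‖hilbertOdd g x‖ₑ < ∞ := by
    rw [hardyOddNorm, hilbertOddNorm, if_pos hex] at htop
    exact (ENNReal.add_ne_top.1 htop).2.lt_top
  rw [hilbertOddNorm, if_pos (hilbertOddExists_sineQuot hg0), hardyOddNorm, hilbertOddNorm,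
    if_pos hex]
  exact key g _ hg0 (integrableOn_hilbertOdd hg0.aestronglyMeasurable hex hfin)
    (ae_tendsto_hilbertOdd hex)

theorem H10_subset_H1Q : H10 ⊆ H1Q := by
  rintro g ⟨hg, hodd, hex, hint⟩
  have hg0 : IntegrableOn g (Ioi 0) := hg.integrableOn
  have hG : ∫⁻ x in Ioi (0 : ℝ), ‖g x‖ₑ < ∞ := hg0.hasFiniteIntegral
  have hH : ∫⁻ x in Ioi (0 : ℝ), ‖hilbertOdd g x‖ₑ < ∞ := hint.hasFiniteIntegral
  have hlim := ae_tendsto_hilbertOdd hex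
  obtain ⟨C, -, key⟩ := exists_lintegral_hilbertOdd_sineQuot_le
  have hsum := ENNReal.add_lt_top.2 ⟨hG, hH⟩
  exact ⟨⟨hg, hodd, (lintegral_sineQuot_le hg0 hint hlim).trans_lt
      (ENNReal.mul_lt_top (by norm_num) hsum)⟩,
    hilbertOddExists_sineQuot hg0,
    integrableOn_hilbertOdd (aestronglyMeasurable_sineQuot hg0) (hilbertOddExists_sineQuot hg0)
      ((key g _ hg0 hint hlim).trans_lt (ENNReal.mul_lt_top ENNReal.ofReal_lt_top hsum))⟩

theorem integral_eq_zero_of_isOdd (h : IsOdd g) : ∫ t, g t = 0 := by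
  have h1 : ∫ t, g t = -∫ t, g t := by
    rw [← integral_neg, ← integral_neg_eq_self g]
    exact integral_congr_ae h
  exact self_eq_neg.1 h1

/-- The integral is over the whole line, so the cancellation is that of an odd function. -/
theorem Q0_subset_L10 : Q0 ⊆ L10 :=
  fun _ ⟨hg, hodd, _⟩ => ⟨hg, hodd, integral_eq_zero_of_isOdd hodd⟩

end Final

end HardyType

theorem proposition1 :
    (∃ C : ℝ, 0 < C ∧ ∀ g : ℝ → ℂ, Integrable g → HardyType.IsOdd g →
      HardyType.hilbertOddNorm (HardyType.sineQuot g)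
        ≤ ENNReal.ofReal C * HardyType.hardyOddNorm g) ∧
    HardyType.H10 ⊆ HardyType.H1Q ∧
    HardyType.H1Q ⊆ HardyType.Q0 ∧
    HardyType.Q0 ⊆ HardyType.L10 := by
  obtain ⟨C, hC, h⟩ := HardyType.exists_hilbertOddNorm_sineQuot_le
  exact ⟨⟨C, hC, fun g hg _ => h g hg⟩, HardyType.H10_subset_H1Q, fun _ hg => hg.1,
    HardyType.Q0_subset_L10⟩
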